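/- **Setting.** Let two balls of radii $R,r>0$ roll on each other without slipping or spinning, the first (radius $R$) being fixed. The configuration space is $Q=\mathrm{SO}_3\times S^2$, where $(g,\mathbf x)$ means that the rolling ball is rotated by $g$ and the contact point is in the direction $\mathbf x$. The rolling distribution $D\subset TQ$ consists of the tangent vectors $(\dot g,\dot{\mathbf x})$ such that, with $\omega\in\mathbb R^3$ the angular velocity ($\dot g P=\omega\times gP$ for all $P\in\mathbb R^3$), $$\Bigl(\tfrac{R}{r}+1\Bigr)\dot{\mathbf x}=\omega\times\mathbf x,\qquad \langle\omega,\mathbf x\rangle=0 .$$ The group $\mathrm{SO}_3\times \mathrm{SO}_3$ acts on $Q$ by $(g',g'')\cdot(g,\mathbf x)=(g'g g''^{-1},g'\mathbf x)$. Let $S^3$ be the group of unit quaternions, $\tilde Q=S^3\times S^2$, and let $\pi:\tilde Q\to Q$, $\pi(q,\mathbf x)=(\mathrm{R}_q,\mathbf x)$, where $\mathrm{R}_q$ is the rotation $v\mapsto qv\bar q$ of the imaginary quaternions $\cong\mathbb R^3$. Let $\tilde D=(d\pi)^{-1}(D)$, and let $\mathrm{Aut}(\tilde Q,\tilde D)$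 be the group of diffeomorphisms of $\tilde Q$ preserving $\tilde D$. The split octonions are $\mathbb H^2$ with the product $(a,b)(c,d)=(ac+\bar d b,\ da+b\bar c)$, and $G_2\subset \mathrm{GL}(\mathbb H^2)$ denotes the group of automorphisms of this real algebra. **Theorem.** Suppose that $R:r=3:1$ or $R:r=1:3$. 1. $G_2$ is the split adjoint group of type $G_2$: it is a closed connected subgroup of $\mathrm{GL}(\mathbb H^2)$, its Lie algebra $\{X:\exp(tX)\in G_2\ \forall t\in\mathbb R\}$ is isomorphic to the split real simple Lie algebra $\mathfrak g_2$, and its centre is trivial. 2. $\pi$ is a covering map with two-point fibres. 3. There is an injective group homomorphism $\Phi:G_2\to\mathrm{Aut}(\tilde Q,\tilde D)$ such that the action $G_2\times\tilde Q\to\tilde Q$, $(g,p)\mapsto\Phi(g)(p)$, is smooth, with the following properties. - There is a maximal compact subgroup $K\subset G_2$, the image of a continuous homomorphism $S^3\times S^3\to G_2$ with kernel $\{\pm(1,1)\}$ (so $K\cong(\mathrm{SU}_2\times\mathrm{SU}_2)/\{\pm(1,1)\}$), and a surjective group homomorphism $c:K\to\mathrm{SO}_3\times\mathrm{SO}_3$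 which is a covering map with kernel of order two, such that $$\pi(\Phi(k)(p))=c(k)\cdot\pi(p)\qquad(k\in K,\ p\in\tilde Q).$$ Thus the action of $K$ descends to $Q$ and covers the $\mathrm{SO}_3\times\mathrm{SO}_3$ action. - The action of $G_2$ does not descend to $Q$: there is $g\in G_2$ for which no map $\psi:Q\to Q$ satisfies $\pi\circ\Phi(g)=\psi\circ\pi$. -/

import Mathlib

open scoped Manifold ContDiff Quaternion Matrix EuclideanSpace

noncomputable section

/-! ### The split octonions and the group `G₂` -/

/-- The split octonions, as pairs of quaternions with the product `octMul`. -/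
abbrev SplitOctonion : Type := ℍ[ℝ] × ℍ[ℝ]

/-- The (Cayley-Dickson) product `(a, b)(c, d) = (ac + d̄b, da + bc̄)` of split octonions. -/
def octMul (x y : SplitOctonion) : SplitOctonion :=
  (x.1 * y.1 + star y.2 * x.2, y.2 * x.1 + x.2 * star y.1)

/-- The group of automorphisms of the algebra of split octonions, as a subgroup of
the general linear group of its underlying vector space. -/
def G2 : Subgroup (SplitOctonion →L[ℝ] SplitOctonion)ˣ where
  carrier := {g | ∀ x y, g.val (octMul x y) = octMul (g.val x) (g.val y)}
  mul_mem' := by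
    intro g h hg hh x y
    change ∀ x y, _ at hg hh
    simp [hg, hh]
  one_mem' := by intro x y; simp
  inv_mem' := by
    intro g hg x y
    change ∀ x y, _ at hg
    have h1 : ∀ z, g.val (g⁻¹.val z) = z := fun z => by
      rw [← mul_apply_eq_comp, Units.mul_inv, one_apply_eq_self]
    have h2 : ∀ z, g⁻¹.val (g.val z) = z := fun z => by
      rw [← mul_apply_eq_comp, Units.inv_mul, one_apply_eq_self]
    change g⁻¹.val (octMul x y) = octMul (g⁻¹.val x) (g⁻¹.val y)
    rw [← h2 (octMul (g⁻¹.val x) (g⁻¹.val y)), hg, h1, h1]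

section LinearGroup

/- The commutator bracket on an associative algebra. -/
attribute [local instance] LieRing.ofAssociativeRing

/-- A linear group `G` (a subgroup of `GL(E)`) *is the split adjoint group of type `G₂`*: it is a
closed connected subgroup, its Lie algebra `{X | exp (tX) ∈ G for all t}` is a Lie algebra
isomorphic to the split real Lie algebra `𝔤₂`, and its centre is trivial. -/
structure IsSplitAdjointG2 {E : Type*} [NormedAddCommGroup E] [NormedSpace ℝ E]
    (G : Subgroup (E →L[ℝ] E)ˣ) : Prop where
  isClosed : IsClosed (G : Set (E →L[ℝ] E)ˣ)
  isConnected : IsConnected (G : Set (E →L[ℝ] E)ˣ)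
  lieAlgebra : ∃ e : LieAlgebra.g₂ ℝ →ₗ⁅ℝ⁆ (E →L[ℝ] E), Function.Injective e ∧
    ∀ X : E →L[ℝ] E, X ∈ Set.range e ↔
      ∀ t : ℝ, ∃ u ∈ G, (u : E →L[ℝ] E) = NormedSpace.exp (t • X)
  center_eq_bot : Subgroup.center G = ⊥

end LinearGroup

/-! ### The configuration space of the rolling balls and its double cover -/

/-- Euclidean three-space. -/
abbrev E3 : Type := EuclideanSpace ℝ (Fin 3)

/-- The unit sphere `S²` of `ℝ³`. -/
abbrev S2 : Type := Metric.sphere (0 : E3) 1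

/-- The unit sphere `S³` of the quaternions; with quaternion multiplication it is `SU(2)`. -/
abbrev S3 : Type := Metric.sphere (0 : ℍ[ℝ]) 1

/-- The rotation group `SO(3)`. -/
abbrev SO3 : Type := Matrix.specialOrthogonalGroup (Fin 3) ℝ

/-- The configuration space `Q = SO(3) × S²`: the second ball is rotated by `g` and the contact
point is in the direction `x`. -/
abbrev RollingSpace : Type := SO3 × S2

/-- The double cover `S³ × S²` of the configuration space. -/
abbrev RollingCover : Type := S3 × S2

instance : Fact (Module.finrank ℝ ℍ[ℝ] = 3 + 1) := ⟨Quaternion.finrank_eq_four⟩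

/-- The model with corners of the smooth manifold `S³ × S²`. -/
abbrev coverModel := (𝓡 3).prod (𝓡 2)

/-- The imaginary quaternion with given coordinates. -/
def imQuat (v : Fin 3 → ℝ) : ℍ[ℝ] := ⟨0, v 0, v 1, v 2⟩

@[simp] theorem re_imQuat (v : Fin 3 → ℝ) : (imQuat v).re = 0 := rfl
@[simp] theorem imI_imQuat (v : Fin 3 → ℝ) : (imQuat v).imI = v 0 := rfl
@[simp] theorem imJ_imQuat (v : Fin 3 → ℝ) : (imQuat v).imJ = v 1 := rfl
@[simp] theorem imK_imQuat (v : Fin 3 → ℝ) : (imQuat v).imK = v 2 := rfl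

/-- The imaginary coordinates of a quaternion. -/
def imVec (q : ℍ[ℝ]) : Fin 3 → ℝ := ![q.imI, q.imJ, q.imK]

/-- The matrix of the linear map `v ↦ q v q̄` on imaginary quaternions. -/
def rotMatrix (q : ℍ[ℝ]) : Matrix (Fin 3) (Fin 3) ℝ :=
  Matrix.of fun i j => imVec (q * imQuat (Pi.single j 1) * star q) i

theorem rotMatrix_mem (q : S3) :
    rotMatrix q.val ∈ Matrix.specialOrthogonalGroup (Fin 3) ℝ := by
  obtain ⟨q, hq⟩ := q
  have h : q.re ^ 2 + q.imI ^ 2 + q.imJ ^ 2 + q.imK ^ 2 = 1 := by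
    rw [← Quaternion.normSq_def', Quaternion.normSq_eq_norm_mul_self, mem_sphere_zero_iff_norm.mp hq,
      mul_one]
  have hm : rotMatrix q = !![
      q.re ^ 2 + q.imI ^ 2 - q.imJ ^ 2 - q.imK ^ 2,
      2 * (q.imI * q.imJ - q.re * q.imK), 2 * (q.imI * q.imK + q.re * q.imJ);
      2 * (q.imI * q.imJ + q.re * q.imK),
      q.re ^ 2 - q.imI ^ 2 + q.imJ ^ 2 - q.imK ^ 2, 2 * (q.imJ * q.imK - q.re * q.imI);
      2 * (q.imI * q.imK - q.re * q.imJ), 2 * (q.imJ * q.imK + q.re * q.imI),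
      q.re ^ 2 - q.imI ^ 2 - q.imJ ^ 2 + q.imK ^ 2] := by
    ext i k
    fin_cases i <;> fin_cases k <;> simp [rotMatrix, imVec] <;> ring
  rw [Matrix.mem_specialOrthogonalGroup_iff, Matrix.mem_orthogonalGroup_iff, hm]
  constructor
  · ext i k
    fin_cases i <;> fin_cases k <;> simp [Matrix.mul_apply, Fin.sum_univ_three] <;> grind
  · rw [Matrix.det_fin_three]
    simp
    grind

/-- The double cover `S³ → SO(3)`. -/
def rot (q : S3) : SO3 := ⟨rotMatrix q.val, rotMatrix_mem q⟩

/-- The double covering map `S³ × S² → SO(3) × S²`. -/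
def coverMap (p : RollingCover) : RollingSpace := (rot p.1, p.2)

/-- A rotation acting on a point of `S²`. -/
def rotSphere (g : SO3) (x : S2) : S2 :=
  ⟨WithLp.toLp 2 (g.val *ᵥ x.val.ofLp), by
    have h1 : g.valᵀ * g.val = 1 :=
      (Matrix.mem_orthogonalGroup_iff' (Fin 3) ℝ).mp
        (Matrix.mem_specialOrthogonalGroup_iff.mp g.property).1
    have h2 := mem_sphere_zero_iff_norm.mp x.property
    rw [mem_sphere_zero_iff_norm]
    refine Eq.trans ?_ h2
    rw [← sq_eq_sq₀ (norm_nonneg _) (norm_nonneg _),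
      ← real_inner_self_eq_norm_sq, ← real_inner_self_eq_norm_sq,
      EuclideanSpace.inner_eq_star_dotProduct, EuclideanSpace.inner_eq_star_dotProduct]
    simp only [star_trivial]
    rw [Matrix.dotProduct_mulVec, Matrix.vecMul_mulVec, h1, Matrix.vecMul_one]⟩

/-- The action `(g', g'') · (g, x) = (g' g g''⁻¹, g' x)` of `SO(3) × SO(3)` on `Q`. -/
def rollingAct (a : SO3 × SO3) (q : RollingSpace) : RollingSpace :=
  (a.1 * q.1 * a.2⁻¹, rotSphere a.1 q.2)

/-! ### The rolling distribution and its lift -/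

/-- The vector space of pairs (matrix, vector), in which `SO(3) × S²` is a submanifold. -/
abbrev AmbientSpace : Type := (Fin 3 → Fin 3 → ℝ) × E3

/-- The plane of the rolling distribution at `(g, x)`, for a ball of radius `r` rolling without
slipping or spinning on a fixed ball of radius `R`. Tangent vectors to `SO(3) × S²` are seen in
the ambient vector space. A tangent vector `(ġ, ẋ)` is in the plane when, for the angular
velocity `w` (so `ġ P = w × g P` for all `P`), there is no slip, `(R / r + 1) ẋ = w × x`, and
no spin, `⟨w, x⟩ = 0`. -/
def rollingPlane (R r : ℝ) (q : RollingSpace) : Submodule ℝ AmbientSpace where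
  carrier := {v | ∃ w : Fin 3 → ℝ,
    (∀ P : Fin 3 → ℝ, Matrix.of v.1 *ᵥ P = w ⨯₃ (q.1.val *ᵥ P)) ∧
    (R / r + 1) • v.2.ofLp = w ⨯₃ q.2.val.ofLp ∧ w ⬝ᵥ q.2.val.ofLp = 0}
  add_mem' := by
    rintro a b ⟨v, h1, h2, h3⟩ ⟨w, k1, k2, k3⟩
    refine ⟨v + w, fun P => ?_, ?_, ?_⟩
    · have : Matrix.of (a + b).1 = Matrix.of a.1 + Matrix.of b.1 := rfl
      rw [this, Matrix.add_mulVec, h1, k1]; simp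
    · simp [h2, k2]
    · simp [add_dotProduct, h3, k3]
  zero_mem' := ⟨0, by
    intro P
    have : Matrix.of (0 : AmbientSpace).1 = 0 := rfl
    simp, by simp, by simp⟩
  smul_mem' := by
    rintro c a ⟨w, h1, h2, h3⟩
    refine ⟨c • w, fun P => ?_, ?_, ?_⟩
    · have : Matrix.of (c • a).1 = c • Matrix.of a.1 := rfl
      rw [this, Matrix.smul_mulVec, h1]; simp
    · have h4 : (R / r + 1) • (c • a).2.ofLp = c • ((R / r + 1) • a.2.ofLp) := by
        simp [smul_comm c]
      rw [h4, h2]; simp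
    · simp [smul_dotProduct, h3]

/-- The covering map, seen with values in the ambient vector space of `SO(3) × S²`. -/
def coverMapAmbient (p : RollingCover) : AmbientSpace :=
  (fun i k => (coverMap p).1.val i k, (coverMap p).2.val)

/-- The lifted rolling distribution on `S³ × S²`: the preimage of the rolling distribution under
the derivative of the covering map. -/
def liftedPlane (R r : ℝ) (p : RollingCover) : Submodule ℝ (TangentSpace coverModel p) :=
  (rollingPlane R r (coverMap p)).comap
    (mfderiv coverModel 𝓘(ℝ, AmbientSpace) coverMapAmbient p).toLinearMap

/-- The group of diffeomorphisms of `S³ × S²` that preserve the lifted rolling distribution. -/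
def rollingAut (R r : ℝ) : Subgroup (Equiv.Perm RollingCover) where
  carrier := {f | ContMDiff coverModel coverModel ∞ f ∧ ContMDiff coverModel coverModel ∞ f.symm ∧
    ∀ p, (liftedPlane R r p).map (mfderiv coverModel coverModel f p).toLinearMap =
      liftedPlane R r (f p)}
  mul_mem' := by
    rintro f g ⟨hf, hf', hfD⟩ ⟨hg, hg', hgD⟩
    refine ⟨hf.comp hg, hg'.comp hf', fun p => ?_⟩
    have h : mfderiv coverModel coverModel (f * g : Equiv.Perm RollingCover) p =
        (mfderiv coverModel coverModel f (g p)).comp (mfderiv coverModel coverModel g p) :=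
      mfderiv_comp p (hf.mdifferentiable (by simp) (g p)) (hg.mdifferentiable (by simp) p)
    rw [h]
    change Submodule.map ((mfderiv coverModel coverModel f (g p)).toLinearMap ∘ₗ
      (mfderiv coverModel coverModel g p).toLinearMap) _ = liftedPlane R r (f (g p))
    rw [Submodule.map_comp, hgD, hfD]
  one_mem' := by
    refine ⟨contMDiff_id, contMDiff_id, fun p => ?_⟩
    have h : mfderiv coverModel coverModel (1 : Equiv.Perm RollingCover) p =
        ContinuousLinearMap.id ℝ (TangentSpace coverModel p) := mfderiv_id
    rw [h]
    exact Submodule.map_id _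
  inv_mem' := by
    rintro f ⟨hf, hf', hfD⟩
    refine ⟨hf', hf, fun p => ?_⟩
    obtain ⟨p, rfl⟩ := f.surjective p
    have h : (mfderiv coverModel coverModel f.symm (f p)).comp
        (mfderiv coverModel coverModel f p) = ContinuousLinearMap.id ℝ (TangentSpace coverModel p) := by
      rw [← mfderiv_comp p (hf'.mdifferentiable (by simp) _) (hf.mdifferentiable (by simp) _)]
      have : (f.symm ∘ f : RollingCover → RollingCover) = id := by ext1 x; simp
      rw [this]
      exact mfderiv_id
    have h2 : (liftedPlane R r (f p)).map
        (mfderiv coverModel coverModel f.symm (f p)).toLinearMap = liftedPlane R r p := by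
      rw [← hfD p, ← Submodule.map_comp]
      ext v
      constructor
      · rintro ⟨u, hu, rfl⟩
        have h3 : mfderiv coverModel coverModel f.symm (f p) (mfderiv coverModel coverModel f p u) = u :=
          congrArg (fun L => L u) h
        exact h3.symm ▸ hu
      · intro hv
        exact ⟨v, hv, congrArg (fun L => L v) h⟩
    have h5 : (f⁻¹ : Equiv.Perm RollingCover) (f p) = p := f.symm_apply_apply p
    rw [h5]
    exact h2

end

/-! The space `S³ × S²` is the space of null rays of the imaginary split octonions. An imaginary
pair `(a, b)` is null for `|a|² - |b|²` exactly when `‖a‖ = ‖b‖`, and scaling both norms to one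
leaves a point of `S² × S³`. Automorphisms preserve the real part and the quadratic form, because
both can be read off from `x² = 2 Re(x) x - N(x)`; so `G2` permutes null rays. It also preserves the
distribution which at the ray of `y` consists of the directions `z` with `yz = 0`, since this is
written with the product alone.

The ratio enters only in matching this distribution with the rolling one. Put `X` for the contact
point as an imaginary quaternion and `W = q' q̄` for half the angular velocity. No slip and no spin
together say `(R/r + 1) X' = 2 W X`. Along `(q, x) ↦ (x, q̄ x)` the annihilation condition reads
`2X' = WX`, which is ratio 3; along `(q, x) ↦ (q̄ x q, x q)` it reads `2X' - WX + 2XW = 0`, which is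
ratio 1/3. `NullChart` isolates what is needed of such an identification, and `chartThree` and
`chartThird` provide the two instances; `NullChart.mem_liftedPlane_perm_iff` is the invariance.

The subgroup `(a, b) ↦ (p a p̄, q b p̄)` acts in either chart as left and right rotations of the
balls. The deck transformation of the cover becomes `(a, b) ↦ (a, -b)`; the hyperbolic one-parameter
group `boost` does not respect its orbits, so the full action does not descend.

For the structure of `G2`: moving the images of `i` and `j` back to `i` and `j` shows that the
compact subgroup and `boost` generate (`range_sup_range_eq_top`), whence connectedness. Its Lie
algebra is the algebra of derivations, for which 14 explicit coordinates are available. Six of the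
coordinate derivations satisfy the Serre relations; conversely the Serre relations force `𝔤₂` to be
spanned by 14 words (`Relations.span_word_eq_top`). As these words go to independent derivations,
the map from `𝔤₂` is an isomorphism onto the derivations, without prior knowledge of its dimension
or simplicity. -/

/-! ### The algebra of split octonions -/

namespace Quaternion

/-- The quaternion with given components. -/
noncomputable def quat (a b c d : ℝ) : ℍ[ℝ] := ⟨a, b, c, d⟩

@[simp] theorem re_quat (a b c d : ℝ) : (quat a b c d).re = a := rfl
@[simp] theorem imI_quat (a b c d : ℝ) : (quat a b c d).imI = b := rfl
@[simp] theorem imJ_quat (a b c d : ℝ) : (quat a b c d).imJ = c := rfl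
@[simp] theorem imK_quat (a b c d : ℝ) : (quat a b c d).imK = d := rfl

/-- The quaternion units. -/
noncomputable def unitI : ℍ[ℝ] := ⟨0, 1, 0, 0⟩
/-- The quaternion units. -/
noncomputable def unitJ : ℍ[ℝ] := ⟨0, 0, 1, 0⟩
/-- The quaternion units. -/
noncomputable def unitK : ℍ[ℝ] := ⟨0, 0, 0, 1⟩

@[simp] theorem re_unitI : unitI.re = 0 := rfl
@[simp] theorem imI_unitI : unitI.imI = 1 := rfl
@[simp] theorem imJ_unitI : unitI.imJ = 0 := rfl
@[simp] theorem imK_unitI : unitI.imK = 0 := rfl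
@[simp] theorem re_unitJ : unitJ.re = 0 := rfl
@[simp] theorem imI_unitJ : unitJ.imI = 0 := rfl
@[simp] theorem imJ_unitJ : unitJ.imJ = 1 := rfl
@[simp] theorem imK_unitJ : unitJ.imK = 0 := rfl
@[simp] theorem re_unitK : unitK.re = 0 := rfl
@[simp] theorem imI_unitK : unitK.imI = 0 := rfl
@[simp] theorem imJ_unitK : unitK.imJ = 0 := rfl
@[simp] theorem imK_unitK : unitK.imK = 1 := rfl

end Quaternion

namespace SplitOct

open Quaternion

/-- The quadratic form `|a|² - |b|²` of the split octonions. -/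
noncomputable def quad (x : SplitOctonion) : ℝ := Quaternion.normSq x.1 - Quaternion.normSq x.2

/-- The octonion units `i`, `j` and `ℓ`, the last one with square `1`. -/
noncomputable def oi : SplitOctonion := (unitI, 0)
/-- An octonion unit. -/
noncomputable def oj : SplitOctonion := (unitJ, 0)
/-- An octonion unit. -/
noncomputable def ol : SplitOctonion := (0, 1)

theorem octMul_add (x y z : SplitOctonion) : octMul x (y + z) = octMul x y + octMul x z := by
  simp only [octMul, Prod.fst_add, Prod.snd_add, star_add, mul_add, add_mul]
  ext <;> simp <;> ring

theorem add_octMul (x y z : SplitOctonion) : octMul (x + y) z = octMul x z + octMul y z := by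
  simp only [octMul, Prod.fst_add, Prod.snd_add, mul_add, add_mul]
  ext <;> simp <;> ring

theorem octMul_smul (c : ℝ) (x y : SplitOctonion) : octMul x (c • y) = c • octMul x y := by
  ext <;> simp [octMul]

theorem smul_octMul (c : ℝ) (x y : SplitOctonion) : octMul (c • x) y = c • octMul x y := by
  ext <;> simp [octMul]

@[simp] theorem one_octMul (x : SplitOctonion) : octMul (1, 0) x = x := by
  ext <;> simp [octMul]

@[simp] theorem octMul_one (x : SplitOctonion) : octMul x (1, 0) = x := by
  ext <;> simp [octMul]

/-- Multiplication of split octonions as a continuous bilinear map. -/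
noncomputable def octMulL : SplitOctonion →L[ℝ] SplitOctonion →L[ℝ] SplitOctonion :=
  LinearMap.toContinuousLinearMap
    (LinearMap.toContinuousLinearMap.toLinearMap ∘ₗ
      LinearMap.mk₂ ℝ octMul (fun x y z => add_octMul x y z) smul_octMul
        (fun x y z => octMul_add x y z) octMul_smul)

@[simp] theorem octMulL_apply (x y : SplitOctonion) : octMulL x y = octMul x y := rfl

/-- This quadratic equation makes the real part and the norm visible to the algebra structure; it is
the source of all invariants of automorphisms and derivations below. -/
theorem octMul_self (x : SplitOctonion) :
    octMul x x = (2 * x.1.re) • x - quad x • ((1, 0) : SplitOctonion) := by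
  ext <;> simp [octMul, quad, Quaternion.normSq_def'] <;> ring

/-- A split octonion in terms of the generators of the algebra. -/
theorem eq_generators (x : SplitOctonion) : x = x.1.re • (1, 0) + x.1.imI • oi + x.1.imJ • oj +
    x.1.imK • octMul oi oj + x.2.re • ol + x.2.imI • octMul oi ol + x.2.imJ • octMul oj ol
      + x.2.imK • octMul (octMul oi oj) ol := by
  ext <;> simp [octMul, oi, oj, ol]

section Automorphism

variable {A : SplitOctonion →L[ℝ] SplitOctonion}

theorem map_one_of_surjective (hA : ∀ x y, A (octMul x y) = octMul (A x) (A y))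
    (hs : Function.Surjective A) : A (1, 0) = (1, 0) := by
  obtain ⟨u, hu⟩ := hs (1, 0)
  have h := hA u (1, 0)
  rw [octMul_one, hu, one_octMul] at h
  exact h.symm

/-- The square of an imaginary octonion is a real multiple of 1, hence so is the square of its
image. If the image had nonzero real part, its quadratic equation would make the image itself a
multiple of 1; by injectivity `x` would then be real and imaginary, so zero. -/
theorem re_map_of_re_eq_zero (hA : ∀ x y, A (octMul x y) = octMul (A x) (A y))
    (hs : Function.Bijective A) {x : SplitOctonion} (hx : x.1.re = 0) : (A x).1.re = 0 := by
  have h1 := map_one_of_surjective hA hs.2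
  have h := hA x x
  rw [octMul_self x, octMul_self (A x), hx] at h
  simp only [mul_zero, zero_smul, zero_sub, map_neg, map_smul, h1] at h
  by_contra hne
  have h2 : A x = A (((2 * (A x).1.re)⁻¹ * (quad (A x) - quad x)) • (1, 0)) := by
    rw [map_smul, h1, mul_smul, sub_smul, sub_eq_add_neg, add_comm, ← neg_smul]
    rw [← neg_smul] at h
    rw [h, sub_add_cancel, smul_smul, inv_mul_cancel₀ (by simpa using hne), one_smul]
  have h3 := hs.1 h2
  have h4 : ((2 * (A x).1.re)⁻¹ * (quad (A x) - quad x)) = 0 := by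
    rw [h3] at hx
    simpa using hx
  rw [h4, zero_smul] at h3
  rw [h3] at hne
  simp at hne

theorem quad_map_of_re_eq_zero (hA : ∀ x y, A (octMul x y) = octMul (A x) (A y))
    (hs : Function.Bijective A) {x : SplitOctonion} (hx : x.1.re = 0) :
    quad (A x) = quad x := by
  have h1 := map_one_of_surjective hA hs.2
  have h := hA x x
  rw [octMul_self x, octMul_self (A x), hx, re_map_of_re_eq_zero hA hs hx] at h
  rw [mul_zero, zero_smul, zero_smul, zero_sub, zero_sub, map_neg, map_smul, h1] at h
  have := congrArg (fun z : SplitOctonion => z.1.re) h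
  simpa using this.symm

end Automorphism

/-- The polar form of `quad`. -/
noncomputable def polar (x y : SplitOctonion) : ℝ :=
  x.1.re * y.1.re + x.1.imI * y.1.imI + x.1.imJ * y.1.imJ + x.1.imK * y.1.imK -
  (x.2.re * y.2.re + x.2.imI * y.2.imI + x.2.imJ * y.2.imJ + x.2.imK * y.2.imK)

theorem quad_add (x y : SplitOctonion) : quad (x + y) = quad x + quad y + 2 * polar x y := by
  simp [quad, polar, Quaternion.normSq_def']; ring

theorem polar_map {A : SplitOctonion →L[ℝ] SplitOctonion}
    (hA : ∀ x y, A (octMul x y) = octMul (A x) (A y)) (hs : Function.Bijective A)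
    {x y : SplitOctonion} (hx : x.1.re = 0) (hy : y.1.re = 0) :
    polar (A x) (A y) = polar x y := by
  have h := quad_map_of_re_eq_zero hA hs (x := x + y) (by simp [hx, hy])
  rw [map_add, quad_add, quad_add, quad_map_of_re_eq_zero hA hs hx,
    quad_map_of_re_eq_zero hA hs hy] at h
  linarith

end SplitOct

/-! ### Rotations as conjugations by quaternions -/

namespace Quaternion

theorem normSq_eq_one_iff_norm (q : ℍ[ℝ]) : normSq q = 1 ↔ ‖q‖ = 1 := by
  rw [normSq_eq_norm_mul_self]
  constructor
  · intro h
    nlinarith [norm_nonneg q]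
  · intro h
    rw [h, one_mul]

theorem mul_star_of_norm_eq_one {q : ℍ[ℝ]} (h : ‖q‖ = 1) : q * star q = 1 := by
  rw [self_mul_star, (normSq_eq_one_iff_norm q).2 h]; rfl

theorem star_mul_of_norm_eq_one {q : ℍ[ℝ]} (h : ‖q‖ = 1) : star q * q = 1 := by
  rw [star_mul_self, (normSq_eq_one_iff_norm q).2 h]; rfl

theorem norm_normalize {q : ℍ[ℝ]} (h : q ≠ 0) : ‖(‖q‖⁻¹ • q)‖ = 1 := by
  rw [norm_smul, norm_inv, norm_norm, inv_mul_cancel₀ (norm_ne_zero_iff.2 h)]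

/-- If `I`, `J`, `K` satisfy the relations of the quaternion units, they are obtained from the
standard ones by conjugation with a unit quaternion. -/
theorem exists_conj_of_relations {I J K : ℍ[ℝ]} (hI : I * I = -1) (hJ : J * J = -1)
    (hK : K * K = -1) (hIJ : I * J = K) (hJK : J * K = I) (hKI : K * I = J) (hJI : J * I = -K)
    (hKJ : K * J = -I) (hIK : I * K = -J) (hI0 : I.re = 0) (hJ0 : J.re = 0) (hK0 : K.re = 0) :
    ∃ q : ℍ[ℝ], ‖q‖ = 1 ∧ I * q = q * unitI ∧ J * q = q * unitJ ∧
      K * q = q * unitK := by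
  -- Up to a factor 4 this is the averaging projection onto the solutions of `Iq = qi`, `Jq = qj`,
  -- `Kq = qk`.
  let T : ℍ[ℝ] → ℍ[ℝ] := fun p => p - I * (p * unitI) - J * (p * unitJ) -
    K * (p * unitK)
  have ii : ∀ p : ℍ[ℝ], p * unitI * unitI = -p := fun p => by ext <;> simp
  have jj : ∀ p : ℍ[ℝ], p * unitJ * unitJ = -p := fun p => by ext <;> simp
  have kk : ∀ p : ℍ[ℝ], p * unitK * unitK = -p := fun p => by ext <;> simp
  have ij : ∀ p : ℍ[ℝ], p * unitI * unitJ = p * unitK :=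
    fun p => by ext <;> simp
  have ji : ∀ p : ℍ[ℝ], p * unitJ * unitI = -(p * unitK) :=
    fun p => by ext <;> simp
  have jk : ∀ p : ℍ[ℝ], p * unitJ * unitK = p * unitI :=
    fun p => by ext <;> simp
  have kj : ∀ p : ℍ[ℝ], p * unitK * unitJ = -(p * unitI) :=
    fun p => by ext <;> simp
  have ki : ∀ p : ℍ[ℝ], p * unitK * unitI = p * unitJ :=
    fun p => by ext <;> simp
  have ik : ∀ p : ℍ[ℝ], p * unitI * unitK = -(p * unitJ) :=
    fun p => by ext <;> simp
  have hT : ∀ p, I * T p = T p * unitI ∧ J * T p = T p * unitJ ∧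
      K * T p = T p * unitK := by
    intro p
    simp only [T, mul_sub, sub_mul, ← mul_assoc I I, ← mul_assoc I J, ← mul_assoc I K,
      ← mul_assoc J I, ← mul_assoc J J, ← mul_assoc J K, ← mul_assoc K I, ← mul_assoc K J,
      ← mul_assoc K K, hI, hJ, hK, hIJ, hJK, hKI, hJI, hKJ, hIK, mul_assoc I (p * _),
      mul_assoc J (p * _), mul_assoc K (p * _), ii, jj, kk, ij, ji, jk, kj, ki, ik, mul_neg,
      neg_mul, one_mul]
    refine ⟨by abel, by abel, by abel⟩
  -- The map `p ↦ a p b` has trace `4 Re(a) Re(b)`, so `T` has trace 4. The four components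
  -- extracted here are its diagonal entries.
  have hne : ∃ p, T p ≠ 0 := by
    by_contra! h
    have h1 := congrArg (fun z : ℍ[ℝ] => z.re) (h 1)
    have h2 := congrArg (fun z : ℍ[ℝ] => z.imI) (h unitI)
    have h3 := congrArg (fun z : ℍ[ℝ] => z.imJ) (h unitJ)
    have h4 := congrArg (fun z : ℍ[ℝ] => z.imK) (h unitK)
    simp [T, hI0, hJ0, hK0] at h1 h2 h3 h4
    linarith
  obtain ⟨p, hp⟩ := hne
  refine ⟨‖T p‖⁻¹ • T p, norm_normalize hp, ?_, ?_, ?_⟩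
  · rw [mul_smul_comm, smul_mul_assoc, (hT p).1]
  · rw [mul_smul_comm, smul_mul_assoc, (hT p).2.1]
  · rw [mul_smul_comm, smul_mul_assoc, (hT p).2.2]

theorem mul_self_of_imaginary {a : ℍ[ℝ]} (h0 : a.re = 0) (h1 : ‖a‖ = 1) : a * a = -1 := by
  have h := mul_star_of_norm_eq_one h1
  rw [star_eq_neg.2 h0, mul_neg] at h
  rw [← h, neg_neg]

/-- Conjugations by unit quaternions act transitively on imaginary unit quaternions. -/
theorem exists_conj_eq {a b : ℍ[ℝ]} (ha : a.re = 0) (ha1 : ‖a‖ = 1) (hb : b.re = 0)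
    (hb1 : ‖b‖ = 1) : ∃ q : ℍ[ℝ], ‖q‖ = 1 ∧ q * a * star q = b := by
  -- The same averaging, now for the single relation `bq = qa`; again `T` has trace 4 and cannot
  -- vanish.
  let T : ℍ[ℝ] → ℍ[ℝ] := fun p => p - b * p * a
  have hT : ∀ p, b * T p = T p * a := by
    intro p
    have h1 := mul_self_of_imaginary ha ha1
    have h2 := mul_self_of_imaginary hb hb1
    simp only [T, mul_sub, sub_mul]
    rw [mul_assoc (b * p), h1, ← mul_assoc b (b * p), ← mul_assoc b b, h2]
    simp only [mul_neg, neg_mul, mul_one, one_mul]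
    abel
  have hne : ∃ p, T p ≠ 0 := by
    by_contra! h
    have h1 := congrArg (fun z : ℍ[ℝ] => z.re) (h 1)
    have h2 := congrArg (fun z : ℍ[ℝ] => z.imI) (h unitI)
    have h3 := congrArg (fun z : ℍ[ℝ] => z.imJ) (h unitJ)
    have h4 := congrArg (fun z : ℍ[ℝ] => z.imK) (h unitK)
    simp [T, ha, hb] at h1 h2 h3 h4
    linarith
  obtain ⟨p, hp⟩ := hne
  refine ⟨‖T p‖⁻¹ • T p, norm_normalize hp, ?_⟩
  have h : (‖T p‖⁻¹ • T p) * a = b * (‖T p‖⁻¹ • T p) := by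
    rw [mul_smul_comm, smul_mul_assoc, hT p]
  rw [h, mul_assoc, mul_star_of_norm_eq_one (norm_normalize hp), mul_one]

/-- A quaternion commuting with `i` and `j` is real. -/
theorem eq_re_smul_one_of_commute {x : ℍ[ℝ]} (h1 : x * unitI = unitI * x)
    (h2 : x * unitJ = unitJ * x) : x = x.re • 1 := by
  have e1 := congrArg (fun z : ℍ[ℝ] => z.imK) h1
  have e2 := congrArg (fun z : ℍ[ℝ] => z.imJ) h1
  have e3 := congrArg (fun z : ℍ[ℝ] => z.imK) h2
  simp at e1 e2 e3
  ext <;> simp <;> linarith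

theorem norm_unitI : ‖unitI‖ = 1 := by
  rw [← normSq_eq_one_iff_norm, normSq_def']; simp

theorem norm_unitJ : ‖unitJ‖ = 1 := by
  rw [← normSq_eq_one_iff_norm, normSq_def']; simp

/-- A unit quaternion commuting with `i` and `j` is `1` or `-1`. -/
theorem eq_one_or_eq_neg_one_of_commute {x : ℍ[ℝ]} (hx : ‖x‖ = 1)
    (h1 : x * unitI = unitI * x) (h2 : x * unitJ = unitJ * x) : x = 1 ∨ x = -1 := by
  have h := eq_re_smul_one_of_commute h1 h2
  have h3 : x.re ^ 2 = 1 := by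
    have := (normSq_eq_one_iff_norm x).2 hx
    rw [h, normSq_def'] at this
    simpa using this
  rcases (sq_eq_sq_iff_eq_or_eq_neg.1 (h3.trans (one_pow 2).symm)) with h4 | h4
  · left; rw [h, h4, one_smul]
  · right; rw [h, h4, neg_one_smul]

end Quaternion

/-! ### Elements of `G₂` -/

namespace SplitOct

open Quaternion

theorem norm_coe_S3 (q : S3) : ‖(q : ℍ[ℝ])‖ = 1 := mem_sphere_zero_iff_norm.1 q.2

theorem norm_coe_S2 (x : S2) : ‖(x : E3)‖ = 1 := mem_sphere_zero_iff_norm.1 x.2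

theorem map_octMul (g : G2) (x y : SplitOctonion) :
    g.val.val (octMul x y) = octMul (g.val.val x) (g.val.val y) := g.2 x y

theorem mul_apply (g h : G2) (x : SplitOctonion) :
    (g * h).val.val x = g.val.val (h.val.val x) := rfl

theorem inv_apply_apply (g : G2) (x : SplitOctonion) :
    (g⁻¹).val.val (g.val.val x) = x := by
  rw [← mul_apply, inv_mul_cancel]; rfl

theorem apply_inv_apply (g : G2) (x : SplitOctonion) :
    g.val.val ((g⁻¹).val.val x) = x := by
  rw [← mul_apply, mul_inv_cancel]; rfl

theorem bijective_apply (g : G2) : Function.Bijective g.val.val :=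
  ⟨Function.LeftInverse.injective (inv_apply_apply g),
    Function.RightInverse.surjective (apply_inv_apply g)⟩

theorem ext_G2 {g h : G2} (H : ∀ x, g.val.val x = h.val.val x) : g = h :=
  Subtype.ext (Units.ext (ContinuousLinearMap.ext H))

theorem map_one_G2 (g : G2) : g.val.val (1, 0) = (1, 0) :=
  map_one_of_surjective (map_octMul g) (bijective_apply g).2

theorem re_map (g : G2) {x : SplitOctonion} (hx : x.1.re = 0) : (g.val.val x).1.re = 0 :=
  re_map_of_re_eq_zero (map_octMul g) (bijective_apply g) hx

theorem quad_map (g : G2) {x : SplitOctonion} (hx : x.1.re = 0) :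
    quad (g.val.val x) = quad x :=
  quad_map_of_re_eq_zero (map_octMul g) (bijective_apply g) hx

theorem polar_map_G2 (g : G2) {x y : SplitOctonion} (hx : x.1.re = 0) (hy : y.1.re = 0) :
    polar (g.val.val x) (g.val.val y) = polar x y :=
  polar_map (map_octMul g) (bijective_apply g) hx hy

/-- The elements `i`, `j`, `ℓ` generate the algebra. -/
theorem ext_generators {g h : G2} (hi : g.val.val oi = h.val.val oi)
    (hj : g.val.val oj = h.val.val oj) (hl : g.val.val ol = h.val.val ol) : g = h := by
  refine ext_G2 fun x => ?_
  rw [eq_generators x]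
  simp only [map_add, map_smul, map_octMul, map_one_G2, hi, hj, hl]

/-- The automorphism `(a, b) ↦ (p a p̄, q b p̄)` of the split octonions. -/
noncomputable def compactHom : S3 × S3 →* G2 :=
  ((MonoidHom.toHomUnits
    { toFun := fun k => ContinuousLinearMap.prodMap
        ((ContinuousLinearMap.mul ℝ ℍ[ℝ] (k.1 : ℍ[ℝ])).comp
          ((ContinuousLinearMap.mul ℝ ℍ[ℝ]).flip (star (k.1 : ℍ[ℝ]))))
        ((ContinuousLinearMap.mul ℝ ℍ[ℝ] (k.2 : ℍ[ℝ])).comp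
          ((ContinuousLinearMap.mul ℝ ℍ[ℝ]).flip (star (k.1 : ℍ[ℝ]))))
      map_one' := by
        ext x <;> simp
      map_mul' := fun k l => by
        ext x <;> simp [-Quaternion.re_mul, -Quaternion.imI_mul, -Quaternion.imJ_mul,
          -Quaternion.imK_mul, mul_assoc] }).codRestrict G2 fun k x y => by
    have h := star_mul_of_norm_eq_one (norm_coe_S3 k.1)
    have h' := star_mul_of_norm_eq_one (norm_coe_S3 k.2)
    have e : ∀ z, star (k.1 : ℍ[ℝ]) * ((k.1 : ℍ[ℝ]) * z) = z := fun z => by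
      rw [← mul_assoc, h, one_mul]
    have e' : ∀ z, star (k.2 : ℍ[ℝ]) * ((k.2 : ℍ[ℝ]) * z) = z := fun z => by
      rw [← mul_assoc, h', one_mul]
    simp [octMul, mul_add, mul_assoc, e, e'])

@[simp] theorem compactHom_apply (k : S3 × S3) (x : SplitOctonion) :
    (compactHom k).val.val x = ((k.1 : ℍ[ℝ]) * (x.1 * star (k.1 : ℍ[ℝ])),
      (k.2 : ℍ[ℝ]) * (x.2 * star (k.1 : ℍ[ℝ]))) := rfl

theorem continuous_compactHom : Continuous compactHom := by
  have h : Continuous fun k : S3 × S3 => (compactHom k).val.val := by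
    refine continuous_clm_apply.2 fun x => ?_
    simp only [compactHom_apply]
    fun_prop
  refine Continuous.subtype_mk (Units.continuous_iff.2 ⟨h, ?_⟩) _
  have h2 : Continuous fun k : S3 × S3 => (compactHom k⁻¹).val.val := h.comp continuous_inv
  exact h2.congr fun k => by rw [map_inv]; rfl

/-- The one-parameter group of automorphisms mixing `j` and `ℓ`, as linear maps. -/
noncomputable def boostMap (s : ℝ) : SplitOctonion →ₗ[ℝ] SplitOctonion where
  toFun x := (quat x.1.re x.1.imI (Real.cosh s * x.1.imJ + Real.sinh s * x.2.re)
      (Real.cosh s * x.1.imK + Real.sinh s * x.2.imI),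
    quat (Real.sinh s * x.1.imJ + Real.cosh s * x.2.re)
      (Real.sinh s * x.1.imK + Real.cosh s * x.2.imI) x.2.imJ x.2.imK)
  map_add' x y := by ext <;> simp <;> ring
  map_smul' c x := by ext <;> simp <;> ring

/-- The one-parameter group of automorphisms mixing `j` and `ℓ`. -/
noncomputable def boost : Multiplicative ℝ →* G2 :=
  ((MonoidHom.toHomUnits
    { toFun := fun s => LinearMap.toContinuousLinearMap (boostMap s.toAdd)
      map_one' := by
        ext x <;> simp [boostMap]
      map_mul' := fun k l => by
        ext x <;> simp [boostMap, Real.cosh_add, Real.sinh_add] <;> ring }).codRestrict G2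
    fun k x y => by
    have h := Real.cosh_sq k.toAdd
    ext <;> simp [boostMap, octMul] <;> grind)

theorem boost_apply (s : ℝ) (x : SplitOctonion) :
    (boost (Multiplicative.ofAdd s)).val.val x =
      (quat x.1.re x.1.imI (Real.cosh s * x.1.imJ + Real.sinh s * x.2.re)
        (Real.cosh s * x.1.imK + Real.sinh s * x.2.imI),
      quat (Real.sinh s * x.1.imJ + Real.cosh s * x.2.re)
        (Real.sinh s * x.1.imK + Real.cosh s * x.2.imI) x.2.imJ x.2.imK) := rfl

theorem continuous_quat {X : Type*} [TopologicalSpace X] {a b c d : X → ℝ} (ha : Continuous a)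
    (hb : Continuous b) (hc : Continuous c) (hd : Continuous d) :
    Continuous fun x => quat (a x) (b x) (c x) (d x) := by
  have h : (fun x => quat (a x) (b x) (c x) (d x)) = fun x =>
      a x • (1 : ℍ[ℝ]) + b x • unitI + c x • unitJ + d x • unitK := by
    ext x <;> simp
  rw [h]
  fun_prop

theorem continuous_boost : Continuous fun s : ℝ => boost (Multiplicative.ofAdd s) := by
  have h : Continuous fun s : ℝ => (boost (Multiplicative.ofAdd s)).val.val := by
    refine continuous_clm_apply.2 fun x => ?_
    simp only [boost_apply]
    refine Continuous.prodMk (continuous_quat ?_ ?_ ?_ ?_) (continuous_quat ?_ ?_ ?_ ?_) <;>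
      fun_prop
  refine Continuous.subtype_mk (Units.continuous_iff.2 ⟨h, ?_⟩) _
  have h2 : Continuous fun s : ℝ => (boost (Multiplicative.ofAdd (-s))).val.val :=
    h.comp continuous_neg
  exact h2.congr fun k => by rw [ofAdd_neg, map_inv]; rfl

end SplitOct

/-! ### Automorphisms preserving the quaternions, and generation of the group. -/

namespace SplitOct

open Quaternion

theorem octMul_fst_fst (a b : ℍ[ℝ]) : octMul (a, 0) (b, 0) = (a * b, 0) := by
  simp [octMul]

theorem apply_fst (g : G2) (a : ℍ[ℝ]) : g.val.val (a, 0) = a.re • (1, 0) +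
    a.imI • g.val.val oi + a.imJ • g.val.val oj +
      a.imK • octMul (g.val.val oi) (g.val.val oj) := by
  rw [eq_generators (a, 0)]
  simp only [map_add, map_smul, map_octMul, map_one_G2]
  simp

/-- An automorphism of the split octonions that preserves the quaternions is in the image of
`compactHom`. -/
theorem mem_range_compactHom {g : G2} (hi : (g.val.val oi).2 = 0) (hj : (g.val.val oj).2 = 0) :
    g ∈ compactHom.range := by
  obtain ⟨φ, hφ⟩ : ∃ φ : ℍ[ℝ] → ℍ[ℝ], ∀ a, g.val.val (a, 0) = (φ a, 0) := by
    refine ⟨fun a => (g.val.val (a, 0)).1, fun a => Prod.ext rfl ?_⟩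
    rw [apply_fst]
    simp [hi, hj, octMul]
  have hmul : ∀ a b, φ a * φ b = φ (a * b) := fun a b => by
    have := map_octMul g (a, 0) (b, 0)
    rw [octMul_fst_fst, hφ, hφ, hφ, octMul_fst_fst] at this
    exact (Prod.mk.inj this).1.symm
  have hadd : ∀ a b, φ (a + b) = φ a + φ b := fun a b => by
    have := map_add g.val.val (a, 0) (b, 0)
    rw [Prod.mk_add_mk, add_zero, hφ, hφ, hφ] at this
    exact (Prod.mk.inj this).1
  have hsmul : ∀ (c : ℝ) b, φ (c • b) = c • φ b := fun c b => by
    have := map_smul g.val.val c (b, 0)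
    rw [Prod.smul_mk, smul_zero, hφ, hφ] at this
    exact (Prod.mk.inj this).1
  have hone : φ 1 = 1 := by
    have := map_one_G2 g
    rw [hφ] at this
    exact (Prod.mk.inj this).1
  have hneg : ∀ a, φ (-a) = -φ a := fun a => by
    rw [← neg_one_smul ℝ, hsmul, neg_one_smul]
  have hre : ∀ a : ℍ[ℝ], a.re = 0 → (φ a).re = 0 := fun a ha => by
    have := re_map g (x := (a, 0)) ha
    rwa [hφ] at this
  obtain ⟨q, hq, hqi, hqj, hqk⟩ := exists_conj_of_relations (I := φ unitI) (J := φ unitJ)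
    (K := φ unitK)
    (by rw [hmul, ← hone, ← hneg, show unitI * unitI = -1 by ext <;> simp])
    (by rw [hmul, ← hone, ← hneg, show unitJ * unitJ = -1 by ext <;> simp])
    (by rw [hmul, ← hone, ← hneg, show unitK * unitK = -1 by ext <;> simp])
    (by rw [hmul, show unitI * unitJ = unitK by ext <;> simp])
    (by rw [hmul, show unitJ * unitK = unitI by ext <;> simp])
    (by rw [hmul, show unitK * unitI = unitJ by ext <;> simp])
    (by rw [hmul, ← hneg, show unitJ * unitI = -unitK by ext <;> simp])
    (by rw [hmul, ← hneg, show unitK * unitJ = -unitI by ext <;> simp])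
    (by rw [hmul, ← hneg, show unitI * unitK = -unitJ by ext <;> simp])
    (hre _ rfl) (hre _ rfl) (hre _ rfl)
  have hqq := mul_star_of_norm_eq_one hq
  have hconj : ∀ a, φ a = q * a * star q := fun a => by
    have h1 : φ a * q = q * a := by
      rw [show a = a.re • 1 + a.imI • unitI + a.imJ • unitJ + a.imK • unitK by ext <;> simp]
      simp only [hadd, hsmul, add_mul, mul_add, smul_mul_assoc, mul_smul_comm, hqi, hqj, hqk,
        hone, one_mul, mul_one]
    rw [← h1, mul_assoc, hqq, mul_one]
  obtain ⟨c, d, hcd⟩ : ∃ c d, g.val.val ol = (c, d) := ⟨_, _, rfl⟩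
  have hc0 : c.re = 0 := by
    have := re_map g (x := ol) rfl
    rwa [hcd] at this
  have hcc : φ (star q * c * q) = c := by
    rw [hconj, mul_assoc q, mul_assoc _ q, hqq, mul_one, ← mul_assoc, hqq, one_mul]
  -- The image of `ℓ` is orthogonal to the images of the imaginary quaternions, which fill the
  -- imaginary quaternions. Testing against `c` itself, written as the image of `q̄ c q`, gives
  -- `|c|² = 0`.
  have hc : c = 0 := by
    have h := polar_map_G2 g (x := ol) (y := (star q * c * q, 0)) rfl
      (by simp [hc0]; ring)
    rw [hcd, hφ, hcc] at h
    rw [← normSq_eq_zero, normSq_def']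
    simp [polar, ol] at h
    linarith
  have hd : ‖d‖ = 1 := by
    have := quad_map g (x := ol) rfl
    rw [hcd, hc] at this
    rw [← normSq_eq_one_iff_norm]
    simpa [quad, ol] using this
  -- A pair `(q, p)` sends `ℓ = (0, 1)` to `(0, p q̄)`, so the value `d` requires `p = d q`.
  refine ⟨(⟨q, mem_sphere_zero_iff_norm.2 hq⟩, ⟨d * q, mem_sphere_zero_iff_norm.2
    (by rw [norm_mul, hd, hq, one_mul])⟩), ext_generators ?_ ?_ ?_⟩
  · rw [compactHom_apply, oi, hφ, hconj]; simp [mul_assoc]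
  · rw [compactHom_apply, oj, hφ, hconj]; simp [mul_assoc]
  · rw [compactHom_apply, hcd, ol, hc]
    simp only [zero_mul, mul_zero, one_mul]
    rw [mul_assoc, hqq, mul_one]

/-! ### Connectedness -/

/-- As `a` is orthogonal to `i`, the quaternion `1 - ja` lies in `ℝ + ℝi` and so commutes with `i`;
it also satisfies `(1 - ja)a = j(1 - ja)`. It vanishes only for `a = -j`, where conjugation by `i`
does the job. -/
theorem exists_conj_eq_unitJ {a : ℍ[ℝ]} (ha : a.re = 0) (ha1 : ‖a‖ = 1) (hi : a.imI = 0) :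
    ∃ q : ℍ[ℝ], ‖q‖ = 1 ∧ q * unitI * star q = unitI ∧ q * a * star q = unitJ := by
  have key : ∀ q : ℍ[ℝ], ‖q‖ = 1 → q * unitI = unitI * q → q * a = unitJ * q →
      ∃ q : ℍ[ℝ], ‖q‖ = 1 ∧ q * unitI * star q = unitI ∧ q * a * star q = unitJ := by
    intro q hq h1 h2
    refine ⟨q, hq, ?_, ?_⟩
    · rw [h1, mul_assoc, mul_star_of_norm_eq_one hq, mul_one]
    · rw [h2, mul_assoc, mul_star_of_norm_eq_one hq, mul_one]
  by_cases h : 1 - unitJ * a = 0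
  · have h1 := congrArg (fun z : ℍ[ℝ] => z.re) h
    have h2 := congrArg (fun z : ℍ[ℝ] => z.imI) h
    simp [ha, hi] at h1 h2
    refine key unitI ?_ rfl ?_
    · rw [← normSq_eq_one_iff_norm, normSq_def']; simp
    · ext <;> simp [ha, hi, h2]
      linarith
  · have h2 := mul_self_of_imaginary ha ha1
    refine key _ (norm_normalize h) ?_ ?_
    · rw [mul_smul_comm, smul_mul_assoc]
      congr 1
      ext <;> simp [ha, hi]
    · rw [mul_smul_comm, smul_mul_assoc]
      congr 1
      rw [sub_mul, mul_assoc, h2, mul_sub, ← mul_assoc, show unitJ * unitJ = -1 by ext <;> simp]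
      simp
      abel

/-- The second factor of `compactHom` can be used to rotate the second component of an octonion to
a nonnegative real number. -/
theorem exists_mul_eq_norm (b : ℍ[ℝ]) (q : S3) :
    ∃ p : S3, (p : ℍ[ℝ]) * (b * star (q : ℍ[ℝ])) = ‖b‖ • (1 : ℍ[ℝ]) := by
  by_cases hb : b = 0
  · exact ⟨1, by simp [hb]⟩
  · have h : b * star (q : ℍ[ℝ]) ≠ 0 := by
      rw [← norm_ne_zero_iff, norm_mul, norm_star, norm_coe_S3, mul_one]
      exact norm_ne_zero_iff.2 hb
    have hn : ‖b * star (q : ℍ[ℝ])‖ = ‖b‖ := by rw [norm_mul, norm_star, norm_coe_S3, mul_one]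
    refine ⟨⟨‖star (b * star (q : ℍ[ℝ]))‖⁻¹ • star (b * star (q : ℍ[ℝ])),
      mem_sphere_zero_iff_norm.2 (norm_normalize (star_ne_zero.2 h))⟩, ?_⟩
    rw [smul_mul_assoc, star_mul_self, normSq_eq_norm_mul_self, norm_star, hn]
    have := norm_ne_zero_iff.2 hb
    ext <;> simp
    field_simp

/-- The automorphisms `compactHom` act transitively on pairs of directions. -/
theorem exists_compactHom_apply {x : SplitOctonion} (hx : x.1.re = 0) (hx1 : x.1 ≠ 0) {u : ℍ[ℝ]}
    (hu : u.re = 0) (hu1 : ‖u‖ = 1) :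
    ∃ k, (compactHom k).val.val x = (‖x.1‖ • u, ‖x.2‖ • (1 : ℍ[ℝ])) := by
  obtain ⟨q, hq, h⟩ := exists_conj_eq (a := ‖x.1‖⁻¹ • x.1) (by simp [hx]) (norm_normalize hx1)
    hu hu1
  obtain ⟨p, hp⟩ := exists_mul_eq_norm x.2 ⟨q, mem_sphere_zero_iff_norm.2 hq⟩
  refine ⟨(⟨q, mem_sphere_zero_iff_norm.2 hq⟩, p), ?_⟩
  rw [compactHom_apply, hp, ← h]
  congr 1
  rw [mul_smul_comm, smul_mul_assoc, smul_inv_smul₀ (norm_ne_zero_iff.2 hx1), mul_assoc]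

/-- The variant of the preceding statement inside the stabiliser of `i`, which can only move vectors
orthogonal to `i` within the orthogonal complement. -/
theorem exists_compactHom_apply_fixing {x : SplitOctonion} (hx : x.1.re = 0) (hx1 : x.1 ≠ 0)
    (hi : x.1.imI = 0) : ∃ k, (compactHom k).val.val oi = oi ∧
      (compactHom k).val.val x = (‖x.1‖ • unitJ, ‖x.2‖ • (1 : ℍ[ℝ])) := by
  obtain ⟨q, hq, h1, h⟩ := exists_conj_eq_unitJ (a := ‖x.1‖⁻¹ • x.1) (by simp [hx])
    (norm_normalize hx1) (by simp [hi])
  obtain ⟨p, hp⟩ := exists_mul_eq_norm x.2 ⟨q, mem_sphere_zero_iff_norm.2 hq⟩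
  refine ⟨(⟨q, mem_sphere_zero_iff_norm.2 hq⟩, p), ?_, ?_⟩
  · rw [compactHom_apply, oi]
    simp only [zero_mul, mul_zero, ← mul_assoc, h1]
  · rw [compactHom_apply, hp, ← h]
    congr 1
    rw [mul_smul_comm, smul_mul_assoc, smul_inv_smul₀ (norm_ne_zero_iff.2 hx1), mul_assoc]

/-- The point `(t, r)` lies on the branch of the unit hyperbola parametrised by `(cosh s, sinh s)`,
and the boost by `-s` with `s = arsinh r` brings it to `(1, 0)`. -/
theorem exists_boost_apply {t r : ℝ} (ht : 0 ≤ t) (h : t ^ 2 - r ^ 2 = 1) :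
    ∃ s, (boost s).val.val (t • unitJ, r • (1 : ℍ[ℝ])) = oj ∧ (boost s).val.val oi = oi := by
  have hc : Real.cosh (Real.arsinh r) = t := by
    rw [Real.cosh_arsinh, show 1 + r ^ 2 = t ^ 2 by linarith, Real.sqrt_sq ht]
  refine ⟨Multiplicative.ofAdd (-Real.arsinh r), ?_, ?_⟩
  · rw [boost_apply, Real.cosh_neg, Real.sinh_neg, Real.sinh_arsinh, hc]
    ext <;> simp [oj] <;> linarith
  · rw [boost_apply]
    ext <;> simp [oi]

theorem quad_eq_norm (x : SplitOctonion) : quad x = ‖x.1‖ ^ 2 - ‖x.2‖ ^ 2 := by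
  rw [quad, normSq_eq_norm_mul_self, normSq_eq_norm_mul_self]; ring

theorem fst_ne_zero_of_quad {x : SplitOctonion} (h : quad x = 1) : x.1 ≠ 0 := by
  intro h0
  rw [quad_eq_norm, h0, norm_zero] at h
  nlinarith [sq_nonneg ‖x.2‖]

/-- The group `G₂` is generated by `compactHom` and `boost`. -/
theorem range_sup_range_eq_top : compactHom.range ⊔ boost.range = ⊤ := by
  refine eq_top_iff.2 fun g _ => ?_
  set S := compactHom.range ⊔ boost.range with hS
  have hK : ∀ k, compactHom k ∈ S := fun k => (le_sup_left : _ ≤ S) ⟨k, rfl⟩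
  have hB : ∀ s, boost s ∈ S := fun s => (le_sup_right : _ ≤ S) ⟨s, rfl⟩
  -- The image of `i` has norm form 1: rotate it into the plane of `j` and `ℓ`, boost it to `j`, and
  -- rotate `j` to `i`. The detour through `j` is needed because `boost` fixes `i`.
  obtain ⟨h₁, hh₁, e₁⟩ : ∃ h ∈ S, (h * g).val.val oi = oi := by
    have hq : quad (g.val.val oi) = 1 := by
      rw [quad_map g rfl]; simp [quad, oi, normSq_def']
    obtain ⟨k, hk⟩ := exists_compactHom_apply (re_map g (x := oi) rfl) (fst_ne_zero_of_quad hq)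
      (u := unitJ) rfl norm_unitJ
    obtain ⟨s, hs, -⟩ := exists_boost_apply (norm_nonneg (g.val.val oi).1)
      (by rw [← quad_eq_norm, hq])
    obtain ⟨k', hk'⟩ := exists_compactHom_apply (x := oj) rfl (by simp [oj, ← norm_ne_zero_iff, norm_unitJ])
      (u := unitI) rfl norm_unitI
    refine ⟨compactHom k' * (boost s * compactHom k), mul_mem (hK _) (mul_mem (hB _) (hK _)), ?_⟩
    rw [mul_apply, mul_apply, mul_apply, hk, hs, hk']
    simp [oj, oi, norm_unitJ]
  -- Once `i` is fixed, the image of `j` is orthogonal to `i` and can be moved to `j` by elements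
  -- fixing `i`. What remains fixes `i` and `j`, hence preserves the quaternions.
  obtain ⟨h₂, hh₂, e₂, e₃⟩ : ∃ h ∈ S, (h * (h₁ * g)).val.val oi = oi ∧
      (h * (h₁ * g)).val.val oj = oj := by
    set f := h₁ * g
    have hq : quad (f.val.val oj) = 1 := by
      rw [quad_map f rfl]; simp [quad, oj, normSq_def']
    have hp : (f.val.val oj).1.imI = 0 := by
      have := polar_map_G2 f (x := oi) (y := oj) rfl rfl
      rw [e₁] at this
      simpa [polar, oi, oj] using this
    obtain ⟨k, hki, hk⟩ := exists_compactHom_apply_fixing (re_map f (x := oj) rfl)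
      (fst_ne_zero_of_quad hq) hp
    obtain ⟨s, hs, hsi⟩ := exists_boost_apply (norm_nonneg (f.val.val oj).1)
      (by rw [← quad_eq_norm, hq])
    refine ⟨boost s * compactHom k, mul_mem (hB _) (hK _), ?_, ?_⟩
    · rw [mul_apply, mul_apply, e₁, hki, hsi]
    · rw [mul_apply, mul_apply, hk, hs]
  have h3 : h₂ * (h₁ * g) ∈ S :=
    (le_sup_left : _ ≤ S) (mem_range_compactHom (by rw [e₂]; rfl) (by rw [e₃]; rfl))
  exact (Subgroup.mul_mem_cancel_left S hh₁).1 ((Subgroup.mul_mem_cancel_left S hh₂).1 h3)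

theorem continuousMul_continuousLinearMap (E : Type*) [NormedAddCommGroup E] [NormedSpace ℝ E] :
    ContinuousMul (E →L[ℝ] E) := inferInstance

instance : ContinuousMul (SplitOctonion →L[ℝ] SplitOctonion) :=
  continuousMul_continuousLinearMap SplitOctonion

instance : PreconnectedSpace S3 := by
  refine Subtype.preconnectedSpace (isPreconnected_sphere ?_ 0 1)
  rw [← Module.finrank_eq_rank, Quaternion.finrank_eq_four]
  norm_num

/-- The identity component is a subgroup containing the two connected generating subgroups. -/
theorem isConnected_G2 : IsConnected (G2 : Set (SplitOctonion →L[ℝ] SplitOctonion)ˣ) := by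
  have htop : Subgroup.connectedComponentOfOne G2 = ⊤ := by
    rw [eq_top_iff, ← range_sup_range_eq_top]
    refine sup_le ?_ ?_
    · have h := (isPreconnected_range continuous_compactHom).subset_connectedComponent
        (x := 1) ⟨1, map_one _⟩
      rintro _ ⟨k, rfl⟩
      exact h ⟨k, rfl⟩
    · have h := (isPreconnected_range continuous_boost).subset_connectedComponent
        (x := 1) ⟨0, map_one _⟩
      rintro _ ⟨k, rfl⟩
      exact h ⟨k.toAdd, rfl⟩
  have h2 : connectedComponent (1 : G2) = Set.univ :=
    congrArg (fun H : Subgroup G2 => (H : Set G2)) htop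
  have h3 : IsConnected (Set.univ : Set G2) := h2 ▸ isConnected_connectedComponent
  have h4 := h3.image Subtype.val continuous_subtype_val.continuousOn
  rwa [Set.image_univ, Subtype.range_coe] at h4

theorem isClosed_G2 : IsClosed (G2 : Set (SplitOctonion →L[ℝ] SplitOctonion)ˣ) := by
  have h : (G2 : Set (SplitOctonion →L[ℝ] SplitOctonion)ˣ) =
      ⋂ x : SplitOctonion, ⋂ y : SplitOctonion,
        {g | g.val (octMul x y) = octMulL (g.val x) (g.val y)} := by
    ext g; simp [G2]
  rw [h]
  have he : ∀ x : SplitOctonion, Continuous fun g : (SplitOctonion →L[ℝ] SplitOctonion)ˣ =>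
      g.val x := fun x => (ContinuousLinearMap.apply ℝ _ x).continuous.comp Units.continuous_val
  refine isClosed_iInter fun x => isClosed_iInter fun y => isClosed_eq (he _) ?_
  exact (octMulL.continuous.comp (he x)).clm_apply (he y)

/-! ### The centre -/

/-- Commuting with the involution `(a, b) ↦ (a, -b)` forces a central element to preserve the
quaternions, so it comes from a pair `(q, p)`. Commuting with the rest of the compact subgroup makes
`q` and `p` real, leaving `(a, b) ↦ (a, pq b)`; a boost mixes the two components, so `pq = 1`. -/
theorem center_G2_eq_bot : Subgroup.center G2 = ⊥ := by
  refine (Subgroup.eq_bot_iff_forall _).2 fun z hz => ?_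
  have hc : ∀ (h : G2) x, z.val.val (h.val.val x) = h.val.val (z.val.val x) := fun h x => by
    rw [← mul_apply, ← mul_apply, (Subgroup.mem_center_iff.1 hz h)]
  have hz2 : ∀ a : ℍ[ℝ], (z.val.val (a, 0)).2 = 0 := fun a => by
    have h := congrArg Prod.snd (hc (compactHom (1, -1)) (a, 0))
    rw [compactHom_apply, compactHom_apply] at h
    simp at h
    have h2 : (2 : ℝ) • (z.val.val (a, 0)).2 = 0 := by
      rw [two_smul]
      nth_rw 2 [h]
      exact add_neg_cancel _
    exact (smul_eq_zero.1 h2).resolve_left two_ne_zero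
  obtain ⟨⟨q, p⟩, rfl⟩ := mem_range_compactHom (hz2 unitI) (hz2 unitJ)
  have hp0 : (p : ℍ[ℝ]) ≠ 0 := norm_ne_zero_iff.1 (by rw [norm_coe_S3]; norm_num)
  have hq0 : star (q : ℍ[ℝ]) ≠ 0 :=
    star_ne_zero.2 (norm_ne_zero_iff.1 (by rw [norm_coe_S3]; norm_num))
  have hu : ∀ u : ℍ[ℝ], ‖u‖ = 1 → (p : ℍ[ℝ]) * u = u * p ∧
      (q : ℍ[ℝ]) * u = u * q := fun u hu => by
    have h1 := congrArg Prod.snd (hc (compactHom (1, ⟨u, mem_sphere_zero_iff_norm.2 hu⟩)) ol)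
    have h2 := congrArg Prod.snd (hc (compactHom (⟨u, mem_sphere_zero_iff_norm.2 hu⟩, 1)) ol)
    have e : ((1 : S3) : ℍ[ℝ]) = 1 := rfl
    simp only [compactHom_apply, ol, e, star_one, mul_one, one_mul] at h1 h2
    rw [← mul_assoc, ← mul_assoc] at h1
    rw [mul_assoc] at h2
    refine ⟨mul_right_cancel₀ hq0 h1, star_injective ?_⟩
    rw [star_mul, star_mul]
    exact mul_left_cancel₀ hp0 h2
  have hp := eq_re_smul_one_of_commute (hu _ norm_unitI).1 (hu _ norm_unitJ).1
  have hq := eq_re_smul_one_of_commute (hu _ norm_unitI).2 (hu _ norm_unitJ).2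
  have hq1 : (q : ℍ[ℝ]).re * (q : ℍ[ℝ]).re = 1 := by
    have := (normSq_eq_one_iff_norm _).2 (norm_coe_S3 q)
    rw [hq, normSq_def'] at this
    simpa [sq] using this
  have hz : ∀ x, (compactHom (q, p)).val.val x =
      (x.1, ((p : ℍ[ℝ]).re * (q : ℍ[ℝ]).re) • x.2) := fun x => by
    rw [compactHom_apply]
    dsimp only
    generalize (p : ℍ[ℝ]).re = u at *
    generalize (q : ℍ[ℝ]).re = v at *
    rw [hq, hp]
    ext <;> simp <;> grind
  have hb := hc (boost (Multiplicative.ofAdd 1)) oj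
  rw [hz, hz, boost_apply, boost_apply] at hb
  have hb' := congrArg (fun z : SplitOctonion => z.2.re) hb
  have he : (p : ℍ[ℝ]).re * (q : ℍ[ℝ]).re = 1 := by
    simp [oj] at hb'
    exact hb'
  refine ext_G2 fun x => ?_
  rw [hz, he, one_smul]
  rfl

/-! ### Maximality of the compact subgroup -/

/-- On a compact overgroup `H` the size of the first component of `h(i)` attains a maximum `M`. If
`m` attains it, products `m k m` with `k` in the compact subgroup would go further unless `M ≤ 1`.
Since the squared size is one plus that of the second component, every element of `H` then maps `i`
into the quaternions; composing with a rotation taking `i` to `j` gives the same for `j`. -/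
theorem maximal_compactHom :
    Maximal (fun H : Subgroup G2 => IsCompact (H : Set G2)) compactHom.range := by
  refine ⟨?_, fun H hH hle g hg => ?_⟩
  · change IsCompact (compactHom.range : Set G2)
    rw [MonoidHom.coe_range]
    exact isCompact_range continuous_compactHom
  have hK : ∀ k, compactHom k ∈ H := fun k => hle ⟨k, rfl⟩
  have hcont : Continuous fun h : G2 => ‖(h.val.val oi).1‖ :=
    (((ContinuousLinearMap.apply ℝ _ oi).continuous.comp
      (Units.continuous_val.comp continuous_subtype_val)).fst).norm
  obtain ⟨m, hm, hmax⟩ := hH.exists_isMaxOn ⟨1, H.one_mem⟩ hcont.continuousOn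
  have hquad : ∀ h : G2, ‖(h.val.val oi).1‖ ^ 2 = 1 + ‖(h.val.val oi).2‖ ^ 2 := fun h => by
    have := quad_map h (x := oi) rfl
    rw [quad_eq_norm, quad_eq_norm] at this
    simp [oi, norm_unitI] at this ⊢
    linarith
  set M := ‖(m.val.val oi).1‖ with hM
  have hM0 : 0 ≤ M := norm_nonneg _
  have hm0 : (m.val.val oi).1 ≠ 0 := fun h => by
    have := hquad m
    rw [h, norm_zero] at this
    nlinarith [sq_nonneg ‖(m.val.val oi).2‖]
  obtain ⟨⟨q, p⟩, hk⟩ := exists_compactHom_apply (re_map m (x := oi) rfl) hm0 (u := unitI) rfl norm_unitI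
  -- Negating `p` flips the second component only. Thus both `(M i, s)` and `(M i, -s)`, with `s`
  -- the norm of the second component of `m(i)`, lie in the orbit of `m(i)`.
  have hk' : (compactHom (q, -p)).val.val (m.val.val oi) =
      (M • unitI, -(‖(m.val.val oi).2‖ • (1 : ℍ[ℝ]))) := by
    have h1 := (Prod.mk.inj hk).1
    have h2 := (Prod.mk.inj hk).2
    rw [compactHom_apply, ← h2]
    refine Prod.ext h1 ?_
    exact neg_mul _ _
  have hv : ∀ (t : ℝ) (u : ℍ[ℝ]), ((t • unitI, u) : SplitOctonion) = t • oi + (0, u) :=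
    fun t u => by simp [oi]
  set P := m.val.val (0, ‖(m.val.val oi).2‖ • (1 : ℍ[ℝ])) with hP
  have e1 : ((m * (compactHom (q, p) * m)).val.val oi).1 = M • (m.val.val oi).1 + P.1 := by
    rw [mul_apply, mul_apply, hk, hP, ← Prod.smul_fst, ← Prod.fst_add, ← map_smul, ← map_add,
      hv]
  have e2 : ((m * (compactHom (q, -p) * m)).val.val oi).1 = M • (m.val.val oi).1 - P.1 := by
    rw [mul_apply, mul_apply, hk', hP, ← Prod.smul_fst, ← Prod.fst_sub, ← map_smul, ← map_sub,
      hv, sub_eq_add_neg, Prod.neg_mk, neg_zero]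
  have f1 : ‖M • (m.val.val oi).1 + P.1‖ ≤ M :=
    e1 ▸ hmax (H.mul_mem hm (H.mul_mem (hK _) hm))
  have f2 : ‖M • (m.val.val oi).1 - P.1‖ ≤ M :=
    e2 ▸ hmax (H.mul_mem hm (H.mul_mem (hK _) hm))
  -- The two vectors have norm at most `M` and add up to `2M` times a vector of norm `M`, so `2M² ≤
  -- 2M`.
  have hM1 : M ≤ 1 := by
    have h := norm_add_le (M • (m.val.val oi).1 + P.1) (M • (m.val.val oi).1 - P.1)
    rw [add_add_sub_cancel, ← two_smul ℝ, norm_smul, norm_smul, ← hM, Real.norm_of_nonneg hM0,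
      Real.norm_of_nonneg two_pos.le] at h
    by_contra! hlt
    nlinarith
  have hall : ∀ h ∈ H, (h.val.val oi).2 = 0 := fun h hh => by
    have h1 : ‖(h.val.val oi).1‖ ≤ M := hmax hh
    have h2 := hquad h
    have h3 := norm_nonneg (h.val.val oi).1
    rw [← norm_eq_zero]
    have h4 := norm_nonneg (h.val.val oi).2
    nlinarith
  refine mem_range_compactHom (hall g hg) ?_
  obtain ⟨k, hk⟩ := exists_compactHom_apply (x := oi) rfl
    (by simp [oi, ← norm_ne_zero_iff, norm_unitI]) (u := unitJ) rfl norm_unitJ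
  have h := hall (g * compactHom k) (H.mul_mem hg (hK k))
  rw [mul_apply, hk] at h
  simpa [oi, oj, norm_unitI] using h

end SplitOct

/-! ### The double covers -/

namespace SplitOct

open Quaternion

theorem rotMatrix_mulVec (q : ℍ[ℝ]) (v : Fin 3 → ℝ) :
    rotMatrix q *ᵥ v = imVec (q * imQuat v * star q) := by
  ext i
  fin_cases i <;>
    simp [Matrix.mulVec, dotProduct, Fin.sum_univ_three, rotMatrix, imVec] <;> ring

theorem imQuat_imVec {z : ℍ[ℝ]} (h : z.re = 0) : imQuat (imVec z) = z := by
  ext <;> simp [imVec, h]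

@[simp] theorem imVec_imQuat (v : Fin 3 → ℝ) : imVec (imQuat v) = v := by
  ext i; fin_cases i <;> simp [imVec]

theorem imQuat_rotMatrix_mulVec (q : ℍ[ℝ]) (v : Fin 3 → ℝ) :
    imQuat (rotMatrix q *ᵥ v) = q * imQuat v * star q := by
  rw [rotMatrix_mulVec, imQuat_imVec]
  simp; ring

theorem rotMatrix_mul (p q : ℍ[ℝ]) : rotMatrix (p * q) = rotMatrix p * rotMatrix q := by
  refine Matrix.ext_of_mulVec_single fun i => ?_
  rw [← Matrix.mulVec_mulVec, rotMatrix_mulVec, rotMatrix_mulVec p, imQuat_rotMatrix_mulVec,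
    star_mul]
  simp only [mul_assoc]

/-- The double cover `S³ → SO(3)` as a group homomorphism. -/
noncomputable def rotHom : S3 →* SO3 where
  toFun := rot
  map_one' := by
    refine Subtype.ext (Matrix.ext_of_mulVec_single fun i => ?_)
    change rotMatrix 1 *ᵥ _ = 1 *ᵥ _
    rw [rotMatrix_mulVec, star_one, one_mul, mul_one, imVec_imQuat, Matrix.one_mulVec]
  map_mul' p q := Subtype.ext (rotMatrix_mul p q)

@[simp] theorem rotHom_apply (q : S3) : rotHom q = rot q := rfl

theorem continuous_imVec : Continuous imVec := by
  refine continuous_pi fun i => ?_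
  fin_cases i
  · exact Quaternion.continuous_imI
  · exact Quaternion.continuous_imJ
  · exact Quaternion.continuous_imK

theorem continuous_rot : Continuous rot := by
  refine Continuous.subtype_mk (continuous_matrix fun i j => ?_) _
  simp only [rotMatrix, Matrix.of_apply]
  exact (continuous_apply i).comp (continuous_imVec.comp (by fun_prop))

theorem imQuat_single_zero : imQuat (Pi.single 0 1) = unitI := by ext <;> simp
theorem imQuat_single_one : imQuat (Pi.single 1 1) = unitJ := by ext <;> simp
theorem imQuat_single_two : imQuat (Pi.single 2 1) = unitK := by ext <;> simp

theorem rotMatrix_eq_of_mul_eq {q : ℍ[ℝ]} (hq : ‖q‖ = 1) {M : Matrix (Fin 3) (Fin 3) ℝ}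
    (h0 : imQuat (M.col 0) * q = q * unitI) (h1 : imQuat (M.col 1) * q = q * unitJ)
    (h2 : imQuat (M.col 2) * q = q * unitK) : rotMatrix q = M := by
  have key : ∀ i (u : ℍ[ℝ]), imQuat (Pi.single i 1) = u → imQuat (M.col i) * q = q * u →
      rotMatrix q *ᵥ Pi.single i 1 = M *ᵥ Pi.single i 1 := by
    intro i u hu h
    rw [rotMatrix_mulVec, hu, ← h, mul_assoc, mul_star_of_norm_eq_one hq, mul_one, imVec_imQuat,
      Matrix.mulVec_single_one]
  refine Matrix.ext_of_mulVec_single fun i => ?_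
  fin_cases i
  · exact key 0 _ imQuat_single_zero h0
  · exact key 1 _ imQuat_single_one h1
  · exact key 2 _ imQuat_single_two h2

/-- For a rotation matrix the adjugate equals the transpose, which says that each column is the
cross product of the other two. Together with orthonormality, the columns multiply like `i`, `j`,
`k` and are therefore conjugate to them by a unit quaternion. -/
theorem surjective_rot : Function.Surjective rot := by
  rintro ⟨M, hM⟩
  obtain ⟨hO, hdet⟩ := Matrix.mem_specialOrthogonalGroup_iff.1 hM
  have hadj : M.adjugate = Mᵀ := by
    have h1 := Matrix.adjugate_mul M
    rw [hdet, one_smul] at h1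
    have h2 : M * Mᵀ = 1 := (Matrix.mem_orthogonalGroup_iff (Fin 3) ℝ).1 hO
    calc M.adjugate = M.adjugate * (M * Mᵀ) := by rw [h2, mul_one]
      _ = Mᵀ := by rw [← mul_assoc, h1, one_mul]
  have hO' : Mᵀ * M = 1 := (Matrix.mem_orthogonalGroup_iff' (Fin 3) ℝ).1 hO
  rw [Matrix.adjugate_fin_three] at hadj
  have a := fun i j => congrFun (congrFun hadj i) j
  have o := fun i j => congrFun (congrFun hO' i) j
  simp only [Matrix.mul_apply, Fin.sum_univ_three, Matrix.transpose_apply] at o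
  have a00 := a 0 0
  have a01 := a 0 1
  have a02 := a 0 2
  have a10 := a 1 0
  have a11 := a 1 1
  have a12 := a 1 2
  have a20 := a 2 0
  have a21 := a 2 1
  have a22 := a 2 2
  have o00 := o 0 0
  have o01 := o 0 1
  have o02 := o 0 2
  have o11 := o 1 1
  have o12 := o 1 2
  have o22 := o 2 2
  clear a o hadj hO'
  simp at a00 a01 a02 a10 a11 a12 a20 a21 a22 o00 o01 o02 o11 o12 o22
  obtain ⟨q, hq, h0, h1, h2⟩ := exists_conj_of_relations (I := imQuat (M.col 0))
    (J := imQuat (M.col 1)) (K := imQuat (M.col 2))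
    (by ext <;> simp <;> linarith) (by ext <;> simp <;> linarith) (by ext <;> simp <;> linarith)
    (by ext <;> simp <;> linarith) (by ext <;> simp <;> linarith) (by ext <;> simp <;> linarith)
    (by ext <;> simp <;> linarith) (by ext <;> simp <;> linarith) (by ext <;> simp <;> linarith)
    rfl rfl rfl
  exact ⟨⟨q, mem_sphere_zero_iff_norm.2 hq⟩, Subtype.ext (rotMatrix_eq_of_mul_eq hq h0 h1 h2)⟩

theorem rot_eq_one_iff (q : S3) : rot q = 1 ↔ q = 1 ∨ q = -1 := by
  constructor
  · intro h
    have h' : rotMatrix q = 1 := congrArg Subtype.val h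
    have key : ∀ v, (q : ℍ[ℝ]) * imQuat v = imQuat v * q := fun v => by
      have h1 := imQuat_rotMatrix_mulVec q v
      rw [h', Matrix.one_mulVec] at h1
      nth_rw 2 [h1]
      rw [mul_assoc _ _ (q : ℍ[ℝ]), star_mul_of_norm_eq_one (norm_coe_S3 q), mul_one]
    rcases eq_one_or_eq_neg_one_of_commute (norm_coe_S3 q)
      (imQuat_single_zero ▸ key (Pi.single 0 1)) (imQuat_single_one ▸ key (Pi.single 1 1))
      with h1 | h1
    · exact Or.inl (Subtype.ext h1)
    · exact Or.inr (Subtype.ext h1)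
  · rintro (rfl | rfl)
    · exact map_one rotHom
    · rw [← map_one rotHom]
      refine Subtype.ext (Matrix.ext_of_mulVec_single fun i => ?_)
      change rotMatrix (-1) *ᵥ _ = rotMatrix 1 *ᵥ _
      rw [rotMatrix_mulVec, rotMatrix_mulVec]
      simp only [star_neg, star_one, neg_mul, mul_neg, neg_neg, one_mul, mul_one]

theorem rot_eq_rot_iff (p q : S3) : rot p = rot q ↔ p = q ∨ p = -q := by
  rw [← rotHom_apply, ← rotHom_apply, ← mul_inv_eq_one, ← map_inv, ← map_mul, rotHom_apply,
    rot_eq_one_iff, mul_inv_eq_one, mul_inv_eq_iff_eq_mul, neg_one_mul]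

/-- Compactness makes the surjection closed, hence a quotient map, and a finite kernel in a
Hausdorff group is discrete. -/
theorem isCoveringMap_of_finite_ker {E X : Type*} [Group E] [TopologicalSpace E]
    [IsTopologicalGroup E] [CompactSpace E] [T2Space E] [Group X] [TopologicalSpace X]
    [T2Space X] {f : E →* X} (hc : Continuous f) (hs : Function.Surjective f)
    (hk : (f.ker : Set E).Finite) : IsCoveringMap f :=
  ((hc.isClosedMap.isQuotientMap hc hs).isQuotientCoveringMap_of_isDiscrete_ker_monoidHom
    hk.isDiscrete).isCoveringMap

instance : T2Space SO3 := inferInstanceAs (T2Space {_M : Matrix (Fin 3) (Fin 3) ℝ // _})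

theorem S3_ne_neg (q : S3) : q ≠ -q := by
  intro h
  have h1 : (q : ℍ[ℝ]) = -q := congrArg Subtype.val h
  have h2 := norm_coe_S3 q
  have h3 : (2 : ℝ) • (q : ℍ[ℝ]) = 0 := by
    rw [two_smul]; nth_rw 2 [h1]; exact add_neg_cancel _
  rw [(smul_eq_zero.1 h3).resolve_left two_ne_zero, norm_zero] at h2
  exact zero_ne_one h2

theorem isCoveringMap_rot : IsCoveringMap rot := by
  refine isCoveringMap_of_finite_ker (f := rotHom) continuous_rot surjective_rot ?_
  refine (Set.toFinite {1, -1}).subset fun q hq => ?_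
  simpa using (rot_eq_one_iff q).1 hq

theorem coverMap_eq_iff (p p' : RollingCover) :
    coverMap p = coverMap p' ↔ p' = p ∨ p' = (-p.1, p.2) := by
  simp only [coverMap, Prod.ext_iff, rot_eq_rot_iff]
  have : p.1 = -p'.1 ↔ p'.1 = -p.1 := by
    rw [eq_comm, neg_eq_iff_eq_neg]
  rw [this, or_and_right, eq_comm, @eq_comm _ p.2]

theorem isCoveringMap_coverMap : IsCoveringMap coverMap := by
  refine isLocalHomeomorph_iff_isCoveringMap.1 fun p => ?_
  obtain ⟨e, he, h⟩ := isCoveringMap_rot.isLocalHomeomorph p.1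
  refine ⟨e.prod (OpenPartialHomeomorph.refl S2), ⟨he, trivial⟩, ?_⟩
  exact funext fun x => Prod.ext (congrFun h x.1) rfl

theorem ncard_fiber_coverMap (y : RollingSpace) : (coverMap ⁻¹' {y}).ncard = 2 := by
  obtain ⟨q, hq⟩ := surjective_rot y.1
  have h : coverMap ⁻¹' {y} = {(q, y.2), (-q, y.2)} := by
    ext p
    have : y = coverMap (q, y.2) := by rw [coverMap, hq]
    rw [Set.mem_preimage, Set.mem_singleton_iff, this, eq_comm, coverMap_eq_iff]
    rfl
  rw [h, Set.ncard_pair]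
  exact fun h => S3_ne_neg q (congrArg Prod.fst h)

theorem compactHom_eq_one_iff (x : S3 × S3) : compactHom x = 1 ↔ x = 1 ∨ x = (-1, -1) := by
  constructor
  · obtain ⟨q, p⟩ := x
    intro h
    have h' : ∀ y, (compactHom (q, p)).val.val y = y := fun y => by rw [h]; rfl
    have key : ∀ a, (q : ℍ[ℝ]) * a = a * q := fun a => by
      have h1 := congrArg Prod.fst (h' (a, 0))
      dsimp only [compactHom_apply] at h1
      nth_rw 2 [← h1]
      simp only [mul_assoc]
      rw [star_mul_of_norm_eq_one (norm_coe_S3 q), mul_one]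
    -- The vector `(0, q)` is sent to `(0, p q q̄) = (0, p)`.
    have hpq : p = q := by
      have h1 := congrArg Prod.snd (h' (0, q))
      dsimp only [compactHom_apply] at h1
      rw [mul_star_of_norm_eq_one (norm_coe_S3 q), mul_one] at h1
      exact Subtype.ext h1
    subst hpq
    rcases eq_one_or_eq_neg_one_of_commute (norm_coe_S3 p) (key _) (key _) with h1 | h1
    · have : p = 1 := Subtype.ext h1
      exact Or.inl (by rw [this]; rfl)
    · have : p = -1 := Subtype.ext h1
      exact Or.inr (by rw [this])
  · rintro (rfl | rfl)
    · exact map_one _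
    · refine ext_G2 fun y => ?_
      rw [compactHom_apply]
      have : ((-1 : S3) : ℍ[ℝ]) = -1 := rfl
      simp [this]

/-- A homomorphism with finite kernel from a compact group descends to a covering map from the
quotients of the group by smaller subgroups. -/
theorem exists_isCoveringMap_descent {A B C : Type*} [Group A] [TopologicalSpace A]
    [CompactSpace A] [Group B] [TopologicalSpace B] [IsTopologicalGroup B] [T2Space B] [Group C]
    [TopologicalSpace C] [T2Space C] {f : A →* B} (hf : Continuous f)
    (hfs : Function.Surjective f) {ρ : A →* C} (hρ : Continuous ρ)
    (hρs : Function.Surjective ρ) (hker : f.ker ≤ ρ.ker) (hfin : (ρ.ker : Set A).Finite) :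
    ∃ c : B →* C, IsCoveringMap c ∧ Function.Surjective c ∧ c.ker = ρ.ker.map f ∧
      ∀ x, c (f x) = ρ x := by
  let c : B →* C := f.liftOfSurjective hfs ⟨ρ, hker⟩
  have hcρ : ∀ x, c (f x) = ρ x := fun x => MonoidHom.liftOfRightInverse_comp_apply _ _ _ ⟨ρ, hker⟩ x
  have hcs : Function.Surjective c := fun y => by
    obtain ⟨x, rfl⟩ := hρs y
    exact ⟨_, hcρ x⟩
  have hcc : Continuous c := by
    rw [(hf.isClosedMap.isQuotientMap hf hfs).continuous_iff]
    exact hρ.congr fun x => (hcρ x).symm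
  have hck : c.ker = ρ.ker.map f := by
    ext y
    obtain ⟨x, rfl⟩ := hfs y
    rw [MonoidHom.mem_ker, hcρ, Subgroup.mem_map]
    refine ⟨fun h => ⟨x, h, rfl⟩, ?_⟩
    rintro ⟨z, hz, hzx⟩
    rw [← hcρ, ← hzx, hcρ]
    exact hz
  have : CompactSpace B := hfs.compactSpace hf
  refine ⟨c, isCoveringMap_of_finite_ker hcc hcs ?_, hcs, hck, hcρ⟩
  rw [hck]
  exact hfin.image f

theorem compactHom_neg_one_right_ne : compactHom (1, -1) ≠ 1 := by
  intro h
  rcases (compactHom_eq_one_iff _).1 h with h1 | h1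
  · exact S3_ne_neg 1 (congrArg Prod.snd h1).symm
  · exact S3_ne_neg 1 (congrArg Prod.fst h1)

/-- Of the four sign pairs, those differing by `(-1, -1)` have the same image, which leaves the
two-element kernel of the descended covering. -/
theorem map_rangeRestrict_compactHom {S : Subgroup (S3 × S3)}
    (hS : ∀ x, x ∈ S ↔ (x.1 = 1 ∨ x.1 = -1) ∧ (x.2 = 1 ∨ x.2 = -1)) :
    (S.map compactHom.rangeRestrict : Set compactHom.range) =
      {1, compactHom.rangeRestrict (1, -1)} := by
  have h1 : compactHom.rangeRestrict (-1, -1) = 1 :=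
    Subtype.ext ((compactHom_eq_one_iff _).2 (Or.inr rfl))
  have h2 : compactHom.rangeRestrict (-1, 1) = compactHom.rangeRestrict (1, -1) := by
    refine Subtype.ext (ext_G2 fun x => ?_)
    have e1 : ((-1 : S3) : ℍ[ℝ]) = -1 := rfl
    have e2 : ((1 : S3) : ℍ[ℝ]) = 1 := rfl
    change (compactHom (-1, 1)).val.val x = (compactHom (1, -1)).val.val x
    rw [compactHom_apply, compactHom_apply, e1, e2]
    simp only [star_neg, star_one, neg_mul, mul_neg, one_mul, mul_one, neg_neg]
  ext y
  rw [SetLike.mem_coe, Subgroup.mem_map, Set.mem_insert_iff, Set.mem_singleton_iff]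
  constructor
  · rintro ⟨⟨a, b⟩, hx, rfl⟩
    obtain ⟨rfl | rfl, rfl | rfl⟩ := (hS _).1 hx
    · exact Or.inl (map_one _)
    · exact Or.inr rfl
    · exact Or.inr h2
    · exact Or.inl h1
  · rintro (rfl | rfl)
    · exact ⟨1, S.one_mem, map_one _⟩
    · exact ⟨(1, -1), (hS _).2 ⟨Or.inl rfl, Or.inr rfl⟩, rfl⟩

/-- A double cover of `SO(3) × SO(3)` by `S³ × S³` descends to the image of `compactHom`. -/
theorem exists_descent {ρ : S3 × S3 →* SO3 × SO3} (hc : Continuous ρ)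
    (hs : Function.Surjective ρ)
    (hk : ∀ x, ρ x = 1 ↔ (x.1 = 1 ∨ x.1 = -1) ∧ (x.2 = 1 ∨ x.2 = -1)) :
    ∃ c : compactHom.range →* SO3 × SO3, IsCoveringMap c ∧ Function.Surjective c ∧
      Nat.card c.ker = 2 ∧ ∀ x, c (compactHom.rangeRestrict x) = ρ x := by
  have hker : compactHom.rangeRestrict.ker ≤ ρ.ker := by
    intro x hx
    rw [MonoidHom.ker_rangeRestrict, MonoidHom.mem_ker, compactHom_eq_one_iff] at hx
    rw [MonoidHom.mem_ker, hk]
    rcases hx with rfl | rfl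
    · exact ⟨Or.inl rfl, Or.inl rfl⟩
    · exact ⟨Or.inr rfl, Or.inr rfl⟩
  have hfin : (ρ.ker : Set (S3 × S3)).Finite :=
    (Set.toFinite (({1, -1} : Set S3) ×ˢ ({1, -1} : Set S3))).subset fun x hx => (hk x).1 hx
  obtain ⟨c, h1, h2, h3, h4⟩ := exists_isCoveringMap_descent
    (continuous_compactHom.subtype_mk fun x => (compactHom.rangeRestrict x).2)
    compactHom.rangeRestrict_surjective hc hs hker hfin
  refine ⟨c, h1, h2, ?_, h4⟩
  change Nat.card (c.ker : Set compactHom.range) = 2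
  rw [h3, map_rangeRestrict_compactHom (S := ρ.ker) hk, Nat.card_coe_set_eq, Set.ncard_pair]
  intro h
  exact compactHom_neg_one_right_ne (Subtype.ext_iff.1 h).symm

end SplitOct

/-! ### The Serre presentation of `𝔤₂` -/

namespace G2Serre

/-- The Serre relations of type `G₂`. -/
structure Relations {L : Type*} [LieRing L] [LieAlgebra ℝ L] (h e f : Fin 2 → L) : Prop where
  hh : ⁅h 0, h 1⁆ = 0
  ef : ∀ i, ⁅e i, f i⁆ = h i
  ef01 : ⁅e 0, f 1⁆ = 0
  ef10 : ⁅e 1, f 0⁆ = 0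
  he00 : ⁅h 0, e 0⁆ = (2 : ℝ) • e 0
  he01 : ⁅h 0, e 1⁆ = (-3 : ℝ) • e 1
  he10 : ⁅h 1, e 0⁆ = (-1 : ℝ) • e 0
  he11 : ⁅h 1, e 1⁆ = (2 : ℝ) • e 1
  hf00 : ⁅h 0, f 0⁆ = (-2 : ℝ) • f 0
  hf01 : ⁅h 0, f 1⁆ = (3 : ℝ) • f 1
  hf10 : ⁅h 1, f 0⁆ = (1 : ℝ) • f 0
  hf11 : ⁅h 1, f 1⁆ = (-2 : ℝ) • f 1
  ee0 : ⁅e 0, ⁅e 0, ⁅e 0, ⁅e 0, e 1⁆⁆⁆⁆ = 0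
  ee1 : ⁅e 1, ⁅e 1, e 0⁆⁆ = 0
  ff0 : ⁅f 0, ⁅f 0, ⁅f 0, ⁅f 0, f 1⁆⁆⁆⁆ = 0
  ff1 : ⁅f 1, ⁅f 1, f 0⁆⁆ = 0

section Span

variable {L : Type*} [LieRing L] [LieAlgebra ℝ L] {h e f : Fin 2 → L}

/-- The Chevalley involution: it transfers every computation with positive roots to negative ones.
-/
theorem Relations.symm (H : Relations h e f) : Relations (-h) f e where
  hh := by simp [H.hh]
  ef i := by rw [← lie_skew, H.ef]; rfl
  ef01 := by rw [← lie_skew, H.ef10, neg_zero]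
  ef10 := by rw [← lie_skew, H.ef01, neg_zero]
  he00 := by simp [H.hf00]
  he01 := by simp [H.hf01]
  he10 := by simp [H.hf10]
  he11 := by simp [H.hf11]
  hf00 := by simp [H.he00]
  hf01 := by simp [H.he01]
  hf10 := by simp [H.he10]
  hf11 := by simp [H.he11]
  ee0 := H.ff0
  ee1 := H.ff1
  ff0 := H.ee0
  ff1 := H.ee1

/-- The root vectors of the positive roots. -/
def posWord (e : Fin 2 → L) : Fin 6 → L :=
  ![e 0, e 1, ⁅e 0, e 1⁆, ⁅e 0, ⁅e 0, e 1⁆⁆, ⁅e 0, ⁅e 0, ⁅e 0, e 1⁆⁆⁆,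
    ⁅e 1, ⁅e 0, ⁅e 0, ⁅e 0, e 1⁆⁆⁆⁆]

/-- The Chevalley basis of a Lie algebra with generators satisfying the Serre relations. -/
def word (h e f : Fin 2 → L) : Fin 14 → L :=
  ![h 0, h 1, posWord e 0, posWord e 1, posWord e 2, posWord e 3, posWord e 4, posWord e 5,
    posWord f 0, posWord f 1, posWord f 2, posWord f 3, posWord f 4, posWord f 5]

/-- The six words belong to the positive roots `α`, `β`, `α+β`, `2α+β`, `3α+β`, `3α+2β`, with `α`
short (index 0) and `β` long (index 1). A bracket with a simple root vector or its opposite either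
moves along this list, or lands in the Cartan part, or vanishes by the Serre relations. -/
theorem lie_pos_mem (H : Relations h e f) {M : Submodule ℝ L} (hM : ∀ i, h i ∈ M)
    (eM : ∀ i, posWord e i ∈ M) (i : Fin 2) (k : Fin 6) :
    ⁅e i, posWord e k⁆ ∈ M ∧ ⁅f i, posWord e k⁆ ∈ M := by
  have m1 : e 0 ∈ M := eM 0
  have m2 : e 1 ∈ M := eM 1
  have m3 := eM 2
  have m4 := eM 3
  have m5 := eM 4
  have m6 := eM 5
  simp only [posWord, Matrix.cons_val] at m3 m4 m5 m6
  have fe : ∀ i, ⁅f i, e i⁆ = -h i := fun i => by rw [← lie_skew, H.ef]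
  have f0e1 : ⁅f 0, e 1⁆ = 0 := by rw [← lie_skew, H.ef10, neg_zero]
  have f1e0 : ⁅f 1, e 0⁆ = 0 := by rw [← lie_skew, H.ef01, neg_zero]
  have e1x1 : ⁅e 1, ⁅e 0, e 1⁆⁆ = 0 := by
    rw [← lie_skew (e 0), lie_neg, H.ee1, neg_zero]
  have e1e0 : ⁅e 1, e 0⁆ = -⁅e 0, e 1⁆ := (lie_skew _ _).symm
  set x1 := ⁅e 0, e 1⁆
  have e1x2 : ⁅e 1, ⁅e 0, x1⁆⁆ = 0 := by
    rw [leibniz_lie, e1x1, e1e0, neg_lie, lie_self, lie_zero, neg_zero, zero_add]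
  set x2 := ⁅e 0, x1⁆ with hx2
  have e1x3 : ⁅e 1, ⁅e 0, x2⁆⁆ = -⁅x1, x2⁆ := by
    rw [leibniz_lie, e1x2, e1e0, neg_lie, lie_zero, add_zero]
  set x3 := ⁅e 0, x2⁆ with hx3
  -- There is no root `4α+2β`. Expanding by the Jacobi identity directly, and after writing `⁅e 1,
  -- x3⁆ = -⁅x1, x2⁆`, gives `⁅x1, x3⁆` with opposite signs.
  have e0y : ⁅e 0, ⁅e 1, x3⁆⁆ = 0 := by
    have a1 : ⁅e 0, ⁅e 1, x3⁆⁆ = ⁅x1, x3⁆ := by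
      rw [leibniz_lie, H.ee0, lie_zero, add_zero]
    have a2 : ⁅e 0, ⁅e 1, x3⁆⁆ = -⁅x1, x3⁆ := by
      rw [e1x3, lie_neg, leibniz_lie, ← hx2, lie_self, zero_add]
    have a3 : (2 : ℝ) • ⁅e 0, ⁅e 1, x3⁆⁆ = 0 := by
      rw [two_smul]; nth_rw 1 [a1]; rw [a2, add_neg_cancel]
    exact (smul_eq_zero.1 a3).resolve_left two_ne_zero
  have e1y : ⁅e 1, ⁅e 1, x3⁆⁆ = 0 := by
    rw [e1x3, lie_neg, leibniz_lie, e1x1, e1x2, zero_lie, lie_zero, zero_add, neg_zero]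
  have h0x1 : ⁅h 0, x1⁆ = (-1 : ℝ) • x1 := by
    rw [leibniz_lie, H.he00, H.he01, smul_lie, lie_smul, ← add_smul]; congr 1; norm_num
  have h1x1 : ⁅h 1, x1⁆ = (1 : ℝ) • x1 := by
    rw [leibniz_lie, H.he10, H.he11, smul_lie, lie_smul, ← add_smul]; congr 1; norm_num
  have h0x2 : ⁅h 0, x2⁆ = (1 : ℝ) • x2 := by
    rw [leibniz_lie, H.he00, h0x1, smul_lie, lie_smul, ← add_smul]; congr 1; norm_num
  have h1x2 : ⁅h 1, x2⁆ = (0 : ℝ) • x2 := by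
    rw [leibniz_lie, H.he10, h1x1, smul_lie, lie_smul, ← add_smul]; congr 1; norm_num
  have h1x3 : ⁅h 1, x3⁆ = (-1 : ℝ) • x3 := by
    rw [leibniz_lie, H.he10, h1x2, smul_lie, lie_smul, ← add_smul]; congr 1; norm_num
  -- Under the `sl₂` of index 0, `e 1` is a lowest weight vector of weight -3. The coefficients 3,
  -- 4, 3 are `k(4 - k)` for `k = 1, 2, 3`.
  have f0x1 : ⁅f 0, x1⁆ = (3 : ℝ) • e 1 := by
    rw [leibniz_lie, fe, f0e1, neg_lie, H.he01, lie_zero, add_zero, ← neg_smul]; congr 1; norm_num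
  have f0x2 : ⁅f 0, x2⁆ = (4 : ℝ) • x1 := by
    rw [leibniz_lie, fe, f0x1, neg_lie, h0x1, lie_smul, ← neg_smul, ← add_smul]; congr 1; norm_num
  have f0x3 : ⁅f 0, x3⁆ = (3 : ℝ) • x2 := by
    rw [leibniz_lie, fe, f0x2, neg_lie, h0x2, lie_smul, ← neg_smul, ← add_smul]; congr 1; norm_num
  have f0y : ⁅f 0, ⁅e 1, x3⁆⁆ = 0 := by
    rw [leibniz_lie, f0e1, f0x3, lie_smul, e1x2, zero_lie, smul_zero, zero_add]
  have f1x1 : ⁅f 1, x1⁆ = -e 0 := by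
    rw [leibniz_lie, fe, f1e0, zero_lie, lie_neg, ← lie_skew, H.he10]; simp
  have f1x2 : ⁅f 1, x2⁆ = 0 := by
    rw [leibniz_lie, f1x1, f1e0, zero_lie, lie_neg, lie_self, neg_zero, zero_add]
  have f1x3 : ⁅f 1, x3⁆ = 0 := by
    rw [leibniz_lie, f1x2, f1e0, zero_lie, lie_zero, zero_add]
  have f1y : ⁅f 1, ⁅e 1, x3⁆⁆ = x3 := by
    rw [leibniz_lie, fe, f1x3, neg_lie, h1x3, lie_zero, add_zero]; simp
  fin_cases i
  · fin_cases k <;> simp only [posWord, Matrix.cons_val, Fin.reduceFinMk, Fin.zero_eta,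
      Fin.mk_one, Fin.isValue]
    · exact ⟨by rw [lie_self]; exact M.zero_mem, by rw [fe]; exact M.neg_mem (hM 0)⟩
    · exact ⟨m3, by rw [f0e1]; exact M.zero_mem⟩
    · exact ⟨m4, by rw [f0x1]; exact M.smul_mem _ m2⟩
    · exact ⟨m5, by rw [f0x2]; exact M.smul_mem _ m3⟩
    · exact ⟨by rw [H.ee0]; exact M.zero_mem, by rw [f0x3]; exact M.smul_mem _ m4⟩
    · exact ⟨by rw [e0y]; exact M.zero_mem, by rw [f0y]; exact M.zero_mem⟩
  · fin_cases k <;> simp only [posWord, Matrix.cons_val, Fin.reduceFinMk, Fin.zero_eta,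
      Fin.mk_one, Fin.isValue]
    · exact ⟨by rw [e1e0]; exact M.neg_mem m3, by rw [f1e0]; exact M.zero_mem⟩
    · exact ⟨by rw [lie_self]; exact M.zero_mem, by rw [fe]; exact M.neg_mem (hM 1)⟩
    · exact ⟨by rw [e1x1]; exact M.zero_mem, by rw [f1x1]; exact M.neg_mem m1⟩
    · exact ⟨by rw [e1x2]; exact M.zero_mem, by rw [f1x2]; exact M.zero_mem⟩
    · exact ⟨m6, by rw [f1x3]; exact M.zero_mem⟩
    · exact ⟨by rw [e1y]; exact M.zero_mem, by rw [f1y]; exact m5⟩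

theorem Relations.lie_e_h_mem (H : Relations h e f) {M : Submodule ℝ L} (eM : ∀ i, e i ∈ M)
    (i k : Fin 2) : ⁅e i, h k⁆ ∈ M := by
  rw [← lie_skew]
  refine M.neg_mem ?_
  fin_cases i <;> fin_cases k
  · exact H.he00 ▸ M.smul_mem _ (eM _)
  · exact H.he10 ▸ M.smul_mem _ (eM _)
  · exact H.he01 ▸ M.smul_mem _ (eM _)
  · exact H.he11 ▸ M.smul_mem _ (eM _)

/-- A Lie algebra generated by elements satisfying the Serre relations of type `G₂` is spanned by
its Chevalley basis. -/
theorem Relations.span_word_eq_top (H : Relations h e f)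
    (hgen : ∀ K : LieSubalgebra ℝ L, (∀ i, e i ∈ K) → (∀ i, f i ∈ K) → K = ⊤) :
    Submodule.span ℝ (Set.range (word h e f)) = ⊤ := by
  set M := Submodule.span ℝ (Set.range (word h e f)) with hMdef
  have wM : ∀ i, word h e f i ∈ M := fun i => Submodule.subset_span ⟨i, rfl⟩
  have hM : ∀ i, h i ∈ M := fun i => by
    fin_cases i
    · exact wM 0
    · exact wM 1
  have eM : ∀ i, posWord e i ∈ M := fun i => by
    fin_cases i
    · exact wM 2
    · exact wM 3
    · exact wM 4
    · exact wM 5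
    · exact wM 6
    · exact wM 7
  have fM : ∀ i, posWord f i ∈ M := fun i => by
    fin_cases i
    · exact wM 8
    · exact wM 9
    · exact wM 10
    · exact wM 11
    · exact wM 12
    · exact wM 13
  have eM' : ∀ i, e i ∈ M := fun i => by
    fin_cases i
    · exact eM 0
    · exact eM 1
  have fM' : ∀ i, f i ∈ M := fun i => by
    fin_cases i
    · exact fM 0
    · exact fM 1
  have hM' : ∀ i, (-h) i ∈ M := fun i => M.neg_mem (hM i)
  -- The elements whose adjoint action preserves `M` form a subalgebra. It contains the generators,
  -- so it is everything; then `M` is itself a subalgebra containing the generators.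
  let N : LieSubalgebra ℝ L :=
    { carrier := {x | ∀ m ∈ M, ⁅x, m⁆ ∈ M}
      add_mem' := fun {a b} ha hb m hm => by rw [add_lie]; exact M.add_mem (ha m hm) (hb m hm)
      zero_mem' := fun m _ => by rw [zero_lie]; exact M.zero_mem
      smul_mem' := fun c x hx m hm => by rw [smul_lie]; exact M.smul_mem _ (hx m hm)
      lie_mem' := fun {a b} ha hb m hm => by
        rw [lie_lie]; exact M.sub_mem (ha _ (hb m hm)) (hb _ (ha m hm)) }
  have hN : ∀ x : L, (∀ i, ⁅x, h i⁆ ∈ M) → (∀ i, ⁅x, posWord e i⁆ ∈ M) →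
      (∀ i, ⁅x, posWord f i⁆ ∈ M) → x ∈ N := by
    intro x h1 h2 h3 m hm
    have : M ≤ M.comap (LieAlgebra.ad ℝ L x : L →ₗ[ℝ] L) := by
      rw [hMdef, Submodule.span_le]
      rintro _ ⟨i, rfl⟩
      fin_cases i
      · exact h1 0
      · exact h1 1
      · exact h2 0
      · exact h2 1
      · exact h2 2
      · exact h2 3
      · exact h2 4
      · exact h2 5
      · exact h3 0
      · exact h3 1
      · exact h3 2
      · exact h3 3
      · exact h3 4
      · exact h3 5
    exact this hm
  have hNtop : N = ⊤ := by
    refine hgen N (fun i => hN _ (H.lie_e_h_mem eM' i) (fun k => (lie_pos_mem H hM eM i k).1)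
      (fun k => (lie_pos_mem H.symm hM' fM i k).2))
      (fun i => hN _ (fun k => ?_) (fun k => (lie_pos_mem H hM eM i k).2)
      (fun k => (lie_pos_mem H.symm hM' fM i k).1))
    have := H.symm.lie_e_h_mem fM' i k
    rwa [Pi.neg_apply, lie_neg, neg_mem_iff] at this
  have hall : ∀ x m, m ∈ M → ⁅x, m⁆ ∈ M := fun x m hm => by
    have : x ∈ N := hNtop ▸ trivial
    exact this m hm
  have hM2 := hgen { M with lie_mem' := fun {a b} _ hb => hall a b hb } eM' fM'
  exact congrArg LieSubalgebra.toSubmodule hM2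

end Span

open CartanMatrix

/-- The projection from the free Lie algebra on the Serre generators to `𝔤₂`. -/
noncomputable def proj : FreeLieAlgebra ℝ (Generators (Fin 2)) →ₗ⁅ℝ⁆ LieAlgebra.g₂ ℝ where
  toFun x := (LieSubmodule.Quotient.mk x :
    FreeLieAlgebra ℝ (Generators (Fin 2)) ⧸ Relations.toIdeal ℝ CartanMatrix.G₂)
  map_add' _ _ := rfl
  map_smul' _ _ := rfl
  map_lie' := rfl

theorem surjective_proj : Function.Surjective proj := fun y => by
  obtain ⟨x, hx⟩ := Quot.exists_rep y
  exact ⟨x, hx⟩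

theorem proj_eq_zero_iff {x : FreeLieAlgebra ℝ (Generators (Fin 2))} :
    proj x = 0 ↔ x ∈ CartanMatrix.Relations.toIdeal ℝ G₂ :=
  LieSubmodule.Quotient.mk_eq_zero'

theorem proj_eq_zero {x : FreeLieAlgebra ℝ (Generators (Fin 2))}
    (hx : x ∈ CartanMatrix.Relations.toSet ℝ G₂) : proj x = 0 :=
  proj_eq_zero_iff.2 (LieSubmodule.subset_lieSpan hx)

/-- The Serre generators of `𝔤₂`. -/
noncomputable def genH (i : Fin 2) : LieAlgebra.g₂ ℝ := proj (FreeLieAlgebra.of ℝ (.H i))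
/-- The Serre generators of `𝔤₂`. -/
noncomputable def genE (i : Fin 2) : LieAlgebra.g₂ ℝ := proj (FreeLieAlgebra.of ℝ (.E i))
/-- The Serre generators of `𝔤₂`. -/
noncomputable def genF (i : Fin 2) : LieAlgebra.g₂ ℝ := proj (FreeLieAlgebra.of ℝ (.F i))

theorem relations_gen : Relations genH genE genF := by
  have HH := fun p => proj_eq_zero (x := CartanMatrix.Relations.HH ℝ p)
    (by simp [CartanMatrix.Relations.toSet])
  have EF := fun p => proj_eq_zero (x := CartanMatrix.Relations.EF ℝ p)
    (by simp [CartanMatrix.Relations.toSet])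
  have HE := fun p => proj_eq_zero (x := CartanMatrix.Relations.HE ℝ G₂ p)
    (by simp [CartanMatrix.Relations.toSet])
  have HF := fun p => proj_eq_zero (x := CartanMatrix.Relations.HF ℝ G₂ p)
    (by simp [CartanMatrix.Relations.toSet])
  have adE := fun p => proj_eq_zero (x := CartanMatrix.Relations.adE ℝ G₂ p)
    (by simp [CartanMatrix.Relations.toSet])
  have adF := fun p => proj_eq_zero (x := CartanMatrix.Relations.adF ℝ G₂ p)
    (by simp [CartanMatrix.Relations.toSet])
  simp only [CartanMatrix.Relations.HH, CartanMatrix.Relations.EF, CartanMatrix.Relations.HE,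
    CartanMatrix.Relations.HF, CartanMatrix.Relations.adE, CartanMatrix.Relations.adF, Prod.forall,
    Function.uncurry_apply_pair, Function.comp_apply] at HH EF HE HF adE adF
  have EF' : ∀ i, ⁅genE i, genF i⁆ = genH i := fun i => by
    have := EF i i
    rw [if_pos rfl, map_sub, LieHom.map_lie, sub_eq_zero] at this
    exact this
  have EF'' : ∀ i j, i ≠ j → ⁅genE i, genF j⁆ = 0 := fun i j hij => by
    have := EF i j
    rw [if_neg hij, LieHom.map_lie] at this
    exact this
  have HE' : ∀ i j, ⁅genH i, genE j⁆ = (G₂ i j : ℝ) • genE j := fun i j => by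
    have := HE i j
    rw [map_sub, LieHom.map_lie, map_zsmul, sub_eq_zero] at this
    rw [Int.cast_smul_eq_zsmul]
    exact this
  have HF' : ∀ i j, ⁅genH i, genF j⁆ = (-G₂ i j : ℝ) • genF j := fun i j => by
    have := HF i j
    rw [map_add, LieHom.map_lie, map_zsmul, add_eq_zero_iff_eq_neg] at this
    rw [neg_smul, Int.cast_smul_eq_zsmul]
    exact this
  -- The power of `ad` in the Serre relation is applied to a bracket, so the exponents 3 and 1 give
  -- words with four and two outer factors.
  have n01 : (-G₂ 0 1).toNat = 3 := rfl
  have n10 : (-G₂ 1 0).toNat = 1 := rfl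
  have hE0 := adE 0 1
  have hE1 := adE 1 0
  have hF0 := adF 0 1
  have hF1 := adF 1 0
  simp only [n01, n10, pow_succ, pow_zero, one_mul, Module.End.mul_apply, LieAlgebra.ad_apply,
    LieHom.map_lie] at hE0 hE1 hF0 hF1
  exact
    { hh := (LieHom.map_lie proj _ _).symm.trans (HH 0 1)
      ef := EF'
      ef01 := EF'' 0 1 (by decide)
      ef10 := EF'' 1 0 (by decide)
      he00 := by rw [HE']; congr 1
      he01 := by rw [HE']; congr 1; norm_num [G₂]
      he10 := by rw [HE']; congr 1; norm_num [G₂]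
      he11 := by rw [HE']; congr 1
      hf00 := by rw [HF']; congr 1
      hf01 := by rw [HF']; congr 1; norm_num [G₂]
      hf10 := by rw [HF']; congr 1; norm_num [G₂]
      hf11 := by rw [HF']; congr 1
      ee0 := hE0
      ee1 := hE1
      ff0 := hF0
      ff1 := hF1 }

/-- The projection from the free Lie algebra factors through any subalgebra containing the `E`'s and
`F`'s, since the `H`'s are their brackets. -/
theorem gen_generate (K : LieSubalgebra ℝ (LieAlgebra.g₂ ℝ)) (hE : ∀ i, genE i ∈ K)
    (hF : ∀ i, genF i ∈ K) : K = ⊤ := by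
  have hH : ∀ i, genH i ∈ K := fun i => relations_gen.ef i ▸ K.lie_mem (hE i) (hF i)
  let φ : FreeLieAlgebra ℝ (Generators (Fin 2)) →ₗ⁅ℝ⁆ K := FreeLieAlgebra.lift ℝ fun
    | .H i => ⟨genH i, hH i⟩
    | .E i => ⟨genE i, hE i⟩
    | .F i => ⟨genF i, hF i⟩
  have hφ : K.incl.comp φ = proj := by
    refine FreeLieAlgebra.hom_ext ?_
    rintro (i | i | i) <;> simp [φ, genH, genE, genF]
  refine eq_top_iff.2 fun y _ => ?_
  obtain ⟨x, rfl⟩ := surjective_proj y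
  rw [← hφ]
  exact (φ x).2

/-- Elements of a Lie algebra satisfying the Serre relations of type `G₂` define a homomorphism
from `𝔤₂`. -/
theorem Relations.exists_lieHom {L : Type*} [LieRing L] [LieAlgebra ℝ L] {h e f : Fin 2 → L}
    (H : Relations h e f) : ∃ φ : LieAlgebra.g₂ ℝ →ₗ⁅ℝ⁆ L,
      (∀ i, φ (genH i) = h i) ∧ (∀ i, φ (genE i) = e i) ∧ ∀ i, φ (genF i) = f i := by
  let ψ : FreeLieAlgebra ℝ (Generators (Fin 2)) →ₗ⁅ℝ⁆ L := FreeLieAlgebra.lift ℝ fun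
    | .H i => h i
    | .E i => e i
    | .F i => f i
  have ψH : ∀ i, ψ (FreeLieAlgebra.of ℝ (.H i)) = h i := fun i => by simp [ψ]
  have ψE : ∀ i, ψ (FreeLieAlgebra.of ℝ (.E i)) = e i := fun i => by simp [ψ]
  have ψF : ∀ i, ψ (FreeLieAlgebra.of ℝ (.F i)) = f i := fun i => by simp [ψ]
  have g01 : G₂ 0 1 = -3 := rfl
  have g10 : G₂ 1 0 = -1 := rfl
  have hh10 : ⁅h 1, h 0⁆ = 0 := by rw [← lie_skew, H.hh, neg_zero]
  have z : ∀ (n : ℤ) (x : L), n • x = (n : ℝ) • x := fun n x => (Int.cast_smul_eq_zsmul ℝ n x).symm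
  have hker : CartanMatrix.Relations.toIdeal ℝ G₂ ≤ ψ.ker := by
    refine LieSubmodule.lieSpan_le.2 ?_
    rintro x (((((⟨⟨i, j⟩, rfl⟩ | ⟨⟨i, j⟩, rfl⟩) | ⟨⟨i, j⟩, rfl⟩) | ⟨⟨i, j⟩, rfl⟩) | ⟨⟨i, j⟩, rfl⟩) |
      ⟨⟨i, j⟩, rfl⟩)
    all_goals
      rw [SetLike.mem_coe, LieHom.mem_ker]
      fin_cases i <;> fin_cases j <;>
      simp [CartanMatrix.Relations.HH, CartanMatrix.Relations.EF, CartanMatrix.Relations.HE,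
        CartanMatrix.Relations.HF, CartanMatrix.Relations.adE, CartanMatrix.Relations.adF,
        g01, g10, pow_succ, ψH, ψE, ψF, z, H.hh, hh10, H.ef, H.ef01,
        H.ef10, H.he00, H.he01, H.he10, H.he11, H.hf00, H.hf01, H.hf10, H.hf11, H.ee0, H.ee1,
        H.ff0, H.ff1]
  let φ : LieAlgebra.g₂ ℝ →ₗ[ℝ] L := Submodule.liftQ
    (CartanMatrix.Relations.toIdeal ℝ G₂).toSubmodule
    (ψ : FreeLieAlgebra ℝ (Generators (Fin 2)) →ₗ[ℝ] L) fun x hx => hker hx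
  refine ⟨{ φ with map_lie' := ?_ }, ψH, ψE, ψF⟩
  intro x y
  obtain ⟨x, rfl⟩ := surjective_proj x
  obtain ⟨y, rfl⟩ := surjective_proj y
  rw [← LieHom.map_lie]
  exact ψ.map_lie x y

end G2Serre

/-! ### Derivations of the split octonions -/

namespace SplitOct

open Quaternion

attribute [local instance] LieRing.ofAssociativeRing

/-- The linear map with given coordinates in a Chevalley basis of the derivation algebra, applied
to a vector. -/
noncomputable def derivationFun (c : Fin 14 → ℝ) (x : SplitOctonion) : SplitOctonion :=
  (quat
      (0)
      ((-c 3 / 2 - c 5 + c 9 / 2 + c 11) * x.1.imJ + (c 2 / 2 + 3 * c 7 - c 8 / 2 - 3 * c 13)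
      * x.1.imK + (c 4 - c 10) * x.2.re + (c 0 - c 1) * x.2.imI + (c 3 / 2 - c 5 + c 9 / 2 - c
      11) * x.2.imJ + (-c 2 / 2 - 3 * c 7 - c 8 / 2 - 3 * c 13) * x.2.imK)
      ((c 3 / 2 + c 5 - c 9 / 2 - c 11) * x.1.imI + (-c 4 / 2 - 3 * c 6 - c 10 / 2 - 3 * c 12)
      * x.1.imK + (c 2 + c 8) * x.2.re + (c 3 / 2 + c 5 + c 9 / 2 + c 11) * x.2.imI + (-2 * c
      0 + c 1) * x.2.imJ + (c 4 / 2 + 3 * c 6 - c 10 / 2 - 3 * c 12) * x.2.imK)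
      ((-c 2 / 2 - 3 * c 7 + c 8 / 2 + 3 * c 13) * x.1.imI + (c 4 / 2 + 3 * c 6 + c 10 / 2 + 3
      * c 12) * x.1.imJ + (-2 * c 5 - 2 * c 11) * x.2.re + (c 2 / 2 - 3 * c 7 + c 8 / 2 - 3 *
      c 13) * x.2.imI + (-c 4 / 2 + 3 * c 6 + c 10 / 2 - 3 * c 12) * x.2.imJ + (c 0) *
      x.2.imK),
    quat
      ((c 4 - c 10) * x.1.imI + (c 2 + c 8) * x.1.imJ + (-2 * c 5 - 2 * c 11) * x.1.imK + (c 4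
      + c 10) * x.2.imI + (c 2 - c 8) * x.2.imJ + (2 * c 5 - 2 * c 11) * x.2.imK)
      ((c 0 - c 1) * x.1.imI + (c 3 / 2 + c 5 + c 9 / 2 + c 11) * x.1.imJ + (c 2 / 2 - 3 * c 7
      + c 8 / 2 - 3 * c 13) * x.1.imK + (-c 4 - c 10) * x.2.re + (-c 3 / 2 + c 5 + c 9 / 2 - c
      11) * x.2.imJ + (-c 2 / 2 + 3 * c 7 + c 8 / 2 - 3 * c 13) * x.2.imK)
      ((c 3 / 2 - c 5 + c 9 / 2 - c 11) * x.1.imI + (-2 * c 0 + c 1) * x.1.imJ + (-c 4 / 2 + 3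
      * c 6 + c 10 / 2 - 3 * c 12) * x.1.imK + (-c 2 + c 8) * x.2.re + (c 3 / 2 - c 5 - c 9 /
      2 + c 11) * x.2.imI + (c 4 / 2 - 3 * c 6 + c 10 / 2 - 3 * c 12) * x.2.imK)
      ((-c 2 / 2 - 3 * c 7 - c 8 / 2 - 3 * c 13) * x.1.imI + (c 4 / 2 + 3 * c 6 - c 10 / 2 - 3
      * c 12) * x.1.imJ + (c 0) * x.1.imK + (-2 * c 5 + 2 * c 11) * x.2.re + (c 2 / 2 - 3 * c
      7 - c 8 / 2 + 3 * c 13) * x.2.imI + (-c 4 / 2 + 3 * c 6 - c 10 / 2 + 3 * c 12) *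
      x.2.imJ))

/-- The derivation of the split octonions with given coordinates in a Chevalley basis. -/
noncomputable def derivation : (Fin 14 → ℝ) →ₗ[ℝ] (SplitOctonion →L[ℝ] SplitOctonion) where
  toFun c := LinearMap.toContinuousLinearMap
    { toFun := derivationFun c
      map_add' := fun x y => by ext <;> simp [derivationFun] <;> ring
      map_smul' := fun t x => by ext <;> simp [derivationFun] <;> ring }
  map_add' c d := by
    refine ContinuousLinearMap.ext fun x => ?_
    change derivationFun (c + d) x = derivationFun c x + derivationFun d x
    ext <;> simp [derivationFun] <;> ring
  map_smul' t c := by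
    refine ContinuousLinearMap.ext fun x => ?_
    change derivationFun (t • c) x = t • derivationFun c x
    ext <;> simp [derivationFun] <;> ring

theorem derivation_apply (c : Fin 14 → ℝ) (x : SplitOctonion) :
    derivation c x = derivationFun c x := rfl

/-- Being a derivation of the algebra of split octonions. -/
def IsDerivation (D : SplitOctonion →L[ℝ] SplitOctonion) : Prop :=
  ∀ x y, D (octMul x y) = octMul (D x) y + octMul x (D y)

theorem isDerivation_derivation (c : Fin 14 → ℝ) : IsDerivation (derivation c) := by
  intro x y
  simp only [derivation_apply]
  ext <;> simp [derivationFun, octMul] <;> ring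

/-- The coordinates in the Chevalley basis of the derivation with given values on `i`, `j`, `ℓ`. -/
noncomputable def coords (u v w : SplitOctonion) : Fin 14 → ℝ :=
  ![-u.2.imI - v.2.imJ,
    -2 * u.2.imI - v.2.imJ,
    v.2.re / 2 - w.2.imJ / 2,
    u.1.imJ + u.2.imJ / 2 + v.2.imI / 2 + w.2.imK / 2,
    u.2.re / 2 - w.2.imI / 2,
    -u.2.imJ / 4 + v.2.imI / 4 - w.2.imK / 4,
    -u.2.re / 12 + v.1.imK / 6 + v.2.imK / 6 + w.2.imI / 12,
    -u.1.imK / 6 - u.2.imK / 6 - v.2.re / 12 + w.2.imJ / 12,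
    v.2.re / 2 + w.2.imJ / 2,
    -u.1.imJ + u.2.imJ / 2 + v.2.imI / 2 - w.2.imK / 2,
    -u.2.re / 2 - w.2.imI / 2,
    -u.2.imJ / 4 + v.2.imI / 4 + w.2.imK / 4,
    u.2.re / 12 + v.1.imK / 6 - v.2.imK / 6 + w.2.imI / 12,
    u.1.imK / 6 - u.2.imK / 6 - v.2.re / 12 - w.2.imJ / 12]

/-- Three images in an eight-dimensional space have 24 coordinates. The ten hypotheses each
determine one of them and leave 14 free, which `coords` converts to the Chevalley basis. -/
theorem derivationFun_coords {u v w : SplitOctonion} (hu0 : u.1.re = 0) (hv0 : v.1.re = 0)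
    (hw0 : w.1.re = 0) (huu : u.1.imI = 0) (hvv : v.1.imJ = 0) (hww : w.2.re = 0)
    (huv : v.1.imI = -u.1.imJ) (huw : w.1.imI = u.2.re) (hvw : w.1.imJ = v.2.re)
    (huvw : w.1.imK = u.2.imJ - v.2.imI) :
    derivationFun (coords u v w) oi = u ∧ derivationFun (coords u v w) oj = v ∧
      derivationFun (coords u v w) ol = w := by
  generalize hc : coords u v w = c
  have e := fun i => congrFun hc i
  have e0 := e 0
  have e1 := e 1
  have e2 := e 2
  have e3 := e 3
  have e4 := e 4
  have e5 := e 5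
  have e6 := e 6
  have e7 := e 7
  have e8 := e 8
  have e9 := e 9
  have e10 := e 10
  have e11 := e 11
  have e12 := e 12
  have e13 := e 13
  clear e hc
  simp only [coords, Matrix.cons_val] at e0 e1 e2 e3 e4 e5 e6 e7 e8 e9 e10 e11 e12 e13
  refine ⟨?_, ?_, ?_⟩
  · ext <;> simp [derivationFun, oi] <;> linarith
  · ext <;> simp [derivationFun, oj] <;> linarith
  · ext <;> simp [derivationFun, ol] <;> linarith

theorem IsDerivation.map_one {D : SplitOctonion →L[ℝ] SplitOctonion} (hD : IsDerivation D) :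
    D (1, 0) = 0 := by
  have := hD (1, 0) (1, 0)
  simpa using this

theorem IsDerivation.ext {D D' : SplitOctonion →L[ℝ] SplitOctonion} (hD : IsDerivation D)
    (hD' : IsDerivation D') (hi : D oi = D' oi) (hj : D oj = D' oj) (hl : D ol = D' ol) :
    D = D' := by
  refine ContinuousLinearMap.ext fun x => ?_
  rw [eq_generators x]
  simp only [map_add, map_smul, hD.map_one, hD'.map_one, hi, hj, hl, hD _ _, hD' _ _]

/-- Polarisation of `octMul_self`. -/
theorem octMul_add_octMul_swap (x y : SplitOctonion) : octMul x y + octMul y x =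
    (2 * x.1.re) • y + (2 * y.1.re) • x - (2 * polar x y) • ((1, 0) : SplitOctonion) := by
  ext <;> simp [octMul, polar] <;> ring

/-- For imaginary `x`, `y` the anticommutator is a real multiple of 1, which `D` kills; the Leibniz
rule applied to it gives the identity. -/
theorem IsDerivation.smul_add_smul {D : SplitOctonion →L[ℝ] SplitOctonion} (hD : IsDerivation D)
    {x y : SplitOctonion} (hx : x.1.re = 0) (hy : y.1.re = 0) :
    (D x).1.re • y + (D y).1.re • x =
      (polar (D x) y + polar x (D y)) • ((1, 0) : SplitOctonion) := by
  have h : D (octMul x y + octMul y x) = (octMul (D x) y + octMul y (D x)) +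
      (octMul x (D y) + octMul (D y) x) := by
    rw [map_add, hD, hD]; abel
  rw [octMul_add_octMul_swap, octMul_add_octMul_swap, octMul_add_octMul_swap, hx, hy] at h
  simp only [mul_zero, zero_smul, zero_add, zero_sub, map_neg, map_smul, hD.map_one, smul_zero,
    neg_zero, add_zero] at h
  have h2 : (2 : ℝ) • ((D x).1.re • y + (D y).1.re • x -
      (polar (D x) y + polar x (D y)) • ((1, 0) : SplitOctonion)) = 0 := by
    rw [h]; module
  exact sub_eq_zero.1 ((smul_eq_zero.1 h2).resolve_left two_ne_zero)

/-- With `y = x` the preceding identity says that `2 Re(Dx) x` is a real multiple of 1. Its real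
part is zero, so it vanishes. -/
theorem IsDerivation.re_eq_zero {D : SplitOctonion →L[ℝ] SplitOctonion} (hD : IsDerivation D)
    {x : SplitOctonion} (hx : x.1.re = 0) : (D x).1.re = 0 := by
  by_cases h0 : x = 0
  · rw [h0, map_zero]; rfl
  have h := hD.smul_add_smul hx hx
  rw [← two_smul ℝ, smul_smul] at h
  by_contra hne
  apply h0
  have h1 : (polar (D x) x + polar x (D x)) = 0 := by
    simpa [hx, eq_comm] using congrArg (fun z : SplitOctonion => z.1.re) h
  rw [h1, zero_smul] at h
  exact (smul_eq_zero.1 h).resolve_left (mul_ne_zero two_ne_zero hne)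

theorem IsDerivation.polar_add_polar {D : SplitOctonion →L[ℝ] SplitOctonion}
    (hD : IsDerivation D) {x y : SplitOctonion} (hx : x.1.re = 0) (hy : y.1.re = 0) :
    polar (D x) y + polar x (D y) = 0 := by
  have h := hD.smul_add_smul hx hy
  rw [hD.re_eq_zero hx, hD.re_eq_zero hy, zero_smul, zero_smul, add_zero] at h
  simpa [eq_comm] using congrArg (fun z : SplitOctonion => z.1.re) h

theorem IsDerivation.eq_derivation {D : SplitOctonion →L[ℝ] SplitOctonion}
    (hD : IsDerivation D) : D = derivation (coords (D oi) (D oj) (D ol)) := by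
  have kii := hD.polar_add_polar (x := oi) (y := oi) rfl rfl
  have kjj := hD.polar_add_polar (x := oj) (y := oj) rfl rfl
  have kll := hD.polar_add_polar (x := ol) (y := ol) rfl rfl
  have kij := hD.polar_add_polar (x := oi) (y := oj) rfl rfl
  have kil := hD.polar_add_polar (x := oi) (y := ol) rfl rfl
  have kjl := hD.polar_add_polar (x := oj) (y := ol) rfl rfl
  -- Besides the six skewness relations among `i`, `j`, `ℓ`, one more comes from the orthogonality
  -- of `k = ij` and `ℓ`: a derivation is bound to `k` through the Leibniz rule.
  have kkl := hD.polar_add_polar (x := octMul oi oj) (y := ol) (by simp [octMul, oi, oj]) rfl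
  rw [hD oi oj] at kkl
  have hi := hD.re_eq_zero (x := oi) rfl
  have hj := hD.re_eq_zero (x := oj) rfl
  have hl := hD.re_eq_zero (x := ol) rfl
  suffices h : derivationFun (coords (D oi) (D oj) (D ol)) oi = D oi ∧
      derivationFun (coords (D oi) (D oj) (D ol)) oj = D oj ∧
      derivationFun (coords (D oi) (D oj) (D ol)) ol = D ol from
    hD.ext (isDerivation_derivation _) h.1.symm h.2.1.symm h.2.2.symm
  generalize D oi = u at *
  generalize D oj = v at *
  generalize D ol = w at *
  simp [polar, octMul, oi, oj, ol] at kii kjj kll kij kil kjl kkl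
  exact derivationFun_coords hi hj hl (by linarith) (by linarith) (by linarith) (by linarith)
    (by linarith) (by linarith) (by linarith)

end SplitOct

/-! ### The Lie algebra of `G₂` -/

section Exp

variable {E : Type*} [NormedAddCommGroup E] [NormedSpace ℝ E] [CompleteSpace E]

theorem hasDerivAt_exp_smul_apply (X : E →L[ℝ] E) (t : ℝ) (x : E) :
    HasDerivAt (fun s : ℝ => NormedSpace.exp (s • X) x) (X (NormedSpace.exp (t • X) x)) t := by
  have h := (hasDerivAt_exp_smul_const' (𝕂 := ℝ) X t).clm_apply (hasDerivAt_const t x)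
  simpa using h

theorem exp_mul_exp_neg (X : E →L[ℝ] E) :
    NormedSpace.exp X * NormedSpace.exp (-X) = 1 := by
  let _ : NormedAlgebra ℚ (E →L[ℝ] E) := NormedAlgebra.restrictScalars ℚ ℝ _
  rw [← NormedSpace.exp_add_of_commute (Commute.refl X).neg_right, add_neg_cancel,
    NormedSpace.exp_zero]

/-- The exponential of a derivation of a bilinear operation is multiplicative. -/
theorem exp_map_bilinear_of_derivation (B : E →L[ℝ] E →L[ℝ] E) {X : E →L[ℝ] E}
    (hX : ∀ x y, X (B x y) = B (X x) y + B x (X y)) (x y : E) :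
    NormedSpace.exp X (B x y) = B (NormedSpace.exp X x) (NormedSpace.exp X y) := by
  -- Pulling the product of the flowed vectors back along the flow gives a curve with zero
  -- derivative.
  let f : ℝ → E := fun t =>
    NormedSpace.exp (t • -X) (B (NormedSpace.exp (t • X) x) (NormedSpace.exp (t • X) y))
  have hf : ∀ t, HasDerivAt f 0 t := by
    intro t
    have h1 := (B.hasFDerivAt.comp_hasDerivAt t (hasDerivAt_exp_smul_apply X t x)).clm_apply
      (hasDerivAt_exp_smul_apply X t y)
    have h2 := (hasDerivAt_exp_smul_const (𝕂 := ℝ) (-X) t).clm_apply h1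
    refine h2.congr_deriv ?_
    rw [mul_apply_eq_comp, ← map_add, neg_apply]
    simp only [Function.comp_apply, hX]
    rw [neg_add_cancel, map_zero]
  have hc := is_const_of_deriv_eq_zero (fun t => (hf t).differentiableAt)
    (fun t => (hf t).deriv) 1 0
  simp only [f, one_smul, zero_smul, NormedSpace.exp_zero, one_apply_eq_self] at hc
  rw [← hc, ← mul_apply_eq_comp, exp_mul_exp_neg, one_apply_eq_self]

theorem derivation_of_exp_map_bilinear (B : E →L[ℝ] E →L[ℝ] E) {X : E →L[ℝ] E}
    (hX : ∀ (t : ℝ) x y, NormedSpace.exp (t • X) (B x y) =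
      B (NormedSpace.exp (t • X) x) (NormedSpace.exp (t • X) y)) (x y : E) :
    X (B x y) = B (X x) y + B x (X y) := by
  have h1 := (B.hasFDerivAt.comp_hasDerivAt 0 (hasDerivAt_exp_smul_apply X 0 x)).clm_apply
      (hasDerivAt_exp_smul_apply X 0 y)
  have h2 := hasDerivAt_exp_smul_apply X 0 (B x y)
  have h3 := h2.unique (h1.congr_of_eventuallyEq (Filter.Eventually.of_forall fun t => hX t x y))
  simpa using h3

end Exp

namespace SplitOct

open Quaternion

attribute [local instance] LieRing.ofAssociativeRing

theorem isTopologicalRing_end (E : Type*) [NormedAddCommGroup E] [NormedSpace ℝ E] :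
    IsTopologicalRing (E →L[ℝ] E) := inferInstance

instance : IsTopologicalRing (SplitOctonion →L[ℝ] SplitOctonion) :=
  isTopologicalRing_end SplitOctonion

/-- The elements of the Chevalley basis of the derivation algebra. -/
noncomputable def chevalley (i : Fin 14) : SplitOctonion →L[ℝ] SplitOctonion :=
  derivation (Pi.single i 1)

theorem derivation_eq_sum (c : Fin 14 → ℝ) : derivation c = ∑ i, c i • chevalley i := by
  conv_lhs => rw [← Finset.univ_sum_single c]
  rw [map_sum]
  refine Finset.sum_congr rfl fun i _ => ?_
  rw [chevalley, ← map_smul, ← Pi.single_smul, smul_eq_mul, mul_one]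

/-! ### The Chevalley basis of derivations and its Serre relations. -/

theorem derivationFun_single_0 (x : SplitOctonion) : derivationFun (Pi.single 0 1) x =
    (quat 0 (x.2.imI) (-2 * x.2.imJ) (x.2.imK),
      quat 0 (x.1.imI) (-2 * x.1.imJ) (x.1.imK)) := by
  ext <;> simp [derivationFun]

theorem derivationFun_single_1 (x : SplitOctonion) : derivationFun (Pi.single 1 1) x =
    (quat 0 (-x.2.imI) (x.2.imJ) 0,
      quat 0 (-x.1.imI) (x.1.imJ) 0) := by
  ext <;> simp [derivationFun]

theorem derivationFun_single_2 (x : SplitOctonion) : derivationFun (Pi.single 2 1) x =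
    (quat 0 (x.1.imK / 2 - x.2.imK / 2) (x.2.re) (-x.1.imI / 2 + x.2.imI / 2),
      quat (x.1.imJ + x.2.imJ) (x.1.imK / 2 - x.2.imK / 2) (-x.2.re) (-x.1.imI / 2 + x.2.imI / 2)) := by
  ext <;> simp [derivationFun] <;> ring

theorem derivationFun_single_3 (x : SplitOctonion) : derivationFun (Pi.single 3 1) x =
    (quat 0 (-x.1.imJ / 2 + x.2.imJ / 2) (x.1.imI / 2 + x.2.imI / 2) 0,
      quat 0 (x.1.imJ / 2 - x.2.imJ / 2) (x.1.imI / 2 + x.2.imI / 2) 0) := by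
  ext <;> simp [derivationFun] <;> ring

theorem derivationFun_single_4 (x : SplitOctonion) : derivationFun (Pi.single 4 1) x =
    (quat 0 (x.2.re) (-x.1.imK / 2 + x.2.imK / 2) (x.1.imJ / 2 - x.2.imJ / 2),
      quat (x.1.imI + x.2.imI) (-x.2.re) (-x.1.imK / 2 + x.2.imK / 2) (x.1.imJ / 2 - x.2.imJ / 2)) := by
  ext <;> simp [derivationFun] <;> ring

theorem derivationFun_single_5 (x : SplitOctonion) : derivationFun (Pi.single 5 1) x =
    (quat 0 (-x.1.imJ - x.2.imJ) (x.1.imI + x.2.imI) (-2 * x.2.re),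
      quat (-2 * x.1.imK + 2 * x.2.imK) (x.1.imJ + x.2.imJ) (-x.1.imI - x.2.imI) (-2 * x.2.re)) := by
  ext <;> simp [derivationFun] <;> ring

theorem derivationFun_single_6 (x : SplitOctonion) : derivationFun (Pi.single 6 1) x =
    (quat 0 0 (-3 * x.1.imK + 3 * x.2.imK) (3 * x.1.imJ + 3 * x.2.imJ),
      quat 0 0 (3 * x.1.imK - 3 * x.2.imK) (3 * x.1.imJ + 3 * x.2.imJ)) := by
  ext <;> simp [derivationFun]
  ring

theorem derivationFun_single_7 (x : SplitOctonion) : derivationFun (Pi.single 7 1) x =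
    (quat 0 (3 * x.1.imK - 3 * x.2.imK) 0 (-3 * x.1.imI - 3 * x.2.imI),
      quat 0 (-3 * x.1.imK + 3 * x.2.imK) 0 (-3 * x.1.imI - 3 * x.2.imI)) := by
  ext <;> simp [derivationFun] <;> ring

theorem derivationFun_single_8 (x : SplitOctonion) : derivationFun (Pi.single 8 1) x =
    (quat 0 (-x.1.imK / 2 - x.2.imK / 2) (x.2.re) (x.1.imI / 2 + x.2.imI / 2),
      quat (x.1.imJ - x.2.imJ) (x.1.imK / 2 + x.2.imK / 2) (x.2.re) (-x.1.imI / 2 - x.2.imI / 2)) := by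
  ext <;> simp [derivationFun] <;> ring

theorem derivationFun_single_9 (x : SplitOctonion) : derivationFun (Pi.single 9 1) x =
    (quat 0 (x.1.imJ / 2 + x.2.imJ / 2) (-x.1.imI / 2 + x.2.imI / 2) 0,
      quat 0 (x.1.imJ / 2 + x.2.imJ / 2) (x.1.imI / 2 - x.2.imI / 2) 0) := by
  ext <;> simp [derivationFun] <;> ring

theorem derivationFun_single_10 (x : SplitOctonion) : derivationFun (Pi.single 10 1) x =
    (quat 0 (-x.2.re) (-x.1.imK / 2 - x.2.imK / 2) (x.1.imJ / 2 + x.2.imJ / 2),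
      quat (-x.1.imI + x.2.imI) (-x.2.re) (x.1.imK / 2 + x.2.imK / 2) (-x.1.imJ / 2 - x.2.imJ / 2)) := by
  ext <;> simp [derivationFun] <;> ring

theorem derivationFun_single_11 (x : SplitOctonion) : derivationFun (Pi.single 11 1) x =
    (quat 0 (x.1.imJ - x.2.imJ) (-x.1.imI + x.2.imI) (-2 * x.2.re),
      quat (-2 * x.1.imK - 2 * x.2.imK) (x.1.imJ - x.2.imJ) (-x.1.imI + x.2.imI) (2 * x.2.re)) := by
  ext <;> simp [derivationFun] <;> ring

theorem derivationFun_single_12 (x : SplitOctonion) : derivationFun (Pi.single 12 1) x =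
    (quat 0 0 (-3 * x.1.imK - 3 * x.2.imK) (3 * x.1.imJ - 3 * x.2.imJ),
      quat 0 0 (-3 * x.1.imK - 3 * x.2.imK) (-3 * x.1.imJ + 3 * x.2.imJ)) := by
  ext <;> simp [derivationFun] <;> ring

theorem derivationFun_single_13 (x : SplitOctonion) : derivationFun (Pi.single 13 1) x =
    (quat 0 (-3 * x.1.imK - 3 * x.2.imK) 0 (3 * x.1.imI - 3 * x.2.imI),
      quat 0 (-3 * x.1.imK - 3 * x.2.imK) 0 (-3 * x.1.imI + 3 * x.2.imI)) := by
  ext <;> simp [derivationFun] <;> ring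

theorem lie_chevalley_0_1 : ⁅chevalley 0, chevalley 1⁆ = 0 := by
  refine ContinuousLinearMap.ext fun x => ?_
  change derivationFun (Pi.single 0 1) (derivationFun (Pi.single 1 1) x) -
    derivationFun (Pi.single 1 1) (derivationFun (Pi.single 0 1) x) = 0
  simp only [derivationFun_single_0, derivationFun_single_1]
  ext <;> simp

theorem lie_chevalley_2_8 : ⁅chevalley 2, chevalley 8⁆ = chevalley 0 := by
  refine ContinuousLinearMap.ext fun x => ?_
  change derivationFun (Pi.single 2 1) (derivationFun (Pi.single 8 1) x) -
    derivationFun (Pi.single 8 1) (derivationFun (Pi.single 2 1) x) = derivationFun (Pi.single 0 1) x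
  simp only [derivationFun_single_2, derivationFun_single_8, derivationFun_single_0]
  ext <;> simp <;> ring

theorem lie_chevalley_3_9 : ⁅chevalley 3, chevalley 9⁆ = chevalley 1 := by
  refine ContinuousLinearMap.ext fun x => ?_
  change derivationFun (Pi.single 3 1) (derivationFun (Pi.single 9 1) x) -
    derivationFun (Pi.single 9 1) (derivationFun (Pi.single 3 1) x) = derivationFun (Pi.single 1 1) x
  simp only [derivationFun_single_3, derivationFun_single_9, derivationFun_single_1]
  ext <;> simp <;> ring

theorem lie_chevalley_2_9 : ⁅chevalley 2, chevalley 9⁆ = 0 := by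
  refine ContinuousLinearMap.ext fun x => ?_
  change derivationFun (Pi.single 2 1) (derivationFun (Pi.single 9 1) x) -
    derivationFun (Pi.single 9 1) (derivationFun (Pi.single 2 1) x) = 0
  simp only [derivationFun_single_2, derivationFun_single_9]
  ext <;> simp <;> ring

theorem lie_chevalley_3_8 : ⁅chevalley 3, chevalley 8⁆ = 0 := by
  refine ContinuousLinearMap.ext fun x => ?_
  change derivationFun (Pi.single 3 1) (derivationFun (Pi.single 8 1) x) -
    derivationFun (Pi.single 8 1) (derivationFun (Pi.single 3 1) x) = 0
  simp only [derivationFun_single_3, derivationFun_single_8]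
  ext <;> simp <;> ring

theorem lie_chevalley_0_2 : ⁅chevalley 0, chevalley 2⁆ = (2 : ℝ) • chevalley 2 := by
  refine ContinuousLinearMap.ext fun x => ?_
  change derivationFun (Pi.single 0 1) (derivationFun (Pi.single 2 1) x) -
    derivationFun (Pi.single 2 1) (derivationFun (Pi.single 0 1) x) = (2 : ℝ) • derivationFun (Pi.single 2 1) x
  simp only [derivationFun_single_0, derivationFun_single_2]
  ext <;> simp <;> ring

theorem lie_chevalley_0_3 : ⁅chevalley 0, chevalley 3⁆ = (-3 : ℝ) • chevalley 3 := by
  refine ContinuousLinearMap.ext fun x => ?_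
  change derivationFun (Pi.single 0 1) (derivationFun (Pi.single 3 1) x) -
    derivationFun (Pi.single 3 1) (derivationFun (Pi.single 0 1) x) = (-3 : ℝ) • derivationFun (Pi.single 3 1) x
  simp only [derivationFun_single_0, derivationFun_single_3]
  ext <;> simp <;> ring

theorem lie_chevalley_1_2 : ⁅chevalley 1, chevalley 2⁆ = (-1 : ℝ) • chevalley 2 := by
  refine ContinuousLinearMap.ext fun x => ?_
  change derivationFun (Pi.single 1 1) (derivationFun (Pi.single 2 1) x) -
    derivationFun (Pi.single 2 1) (derivationFun (Pi.single 1 1) x) = (-1 : ℝ) • derivationFun (Pi.single 2 1) x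
  simp only [derivationFun_single_1, derivationFun_single_2]
  ext <;> simp <;> ring

theorem lie_chevalley_1_3 : ⁅chevalley 1, chevalley 3⁆ = (2 : ℝ) • chevalley 3 := by
  refine ContinuousLinearMap.ext fun x => ?_
  change derivationFun (Pi.single 1 1) (derivationFun (Pi.single 3 1) x) -
    derivationFun (Pi.single 3 1) (derivationFun (Pi.single 1 1) x) = (2 : ℝ) • derivationFun (Pi.single 3 1) x
  simp only [derivationFun_single_1, derivationFun_single_3]
  ext <;> simp <;> ring

theorem lie_chevalley_0_8 : ⁅chevalley 0, chevalley 8⁆ = (-2 : ℝ) • chevalley 8 := by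
  refine ContinuousLinearMap.ext fun x => ?_
  change derivationFun (Pi.single 0 1) (derivationFun (Pi.single 8 1) x) -
    derivationFun (Pi.single 8 1) (derivationFun (Pi.single 0 1) x) = (-2 : ℝ) • derivationFun (Pi.single 8 1) x
  simp only [derivationFun_single_0, derivationFun_single_8]
  ext <;> simp <;> ring

theorem lie_chevalley_0_9 : ⁅chevalley 0, chevalley 9⁆ = (3 : ℝ) • chevalley 9 := by
  refine ContinuousLinearMap.ext fun x => ?_
  change derivationFun (Pi.single 0 1) (derivationFun (Pi.single 9 1) x) -
    derivationFun (Pi.single 9 1) (derivationFun (Pi.single 0 1) x) = (3 : ℝ) • derivationFun (Pi.single 9 1) x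
  simp only [derivationFun_single_0, derivationFun_single_9]
  ext <;> simp <;> ring

theorem lie_chevalley_1_8 : ⁅chevalley 1, chevalley 8⁆ = (1 : ℝ) • chevalley 8 := by
  refine ContinuousLinearMap.ext fun x => ?_
  change derivationFun (Pi.single 1 1) (derivationFun (Pi.single 8 1) x) -
    derivationFun (Pi.single 8 1) (derivationFun (Pi.single 1 1) x) = (1 : ℝ) • derivationFun (Pi.single 8 1) x
  simp only [derivationFun_single_1, derivationFun_single_8]
  ext <;> simp <;> ring

theorem lie_chevalley_1_9 : ⁅chevalley 1, chevalley 9⁆ = (-2 : ℝ) • chevalley 9 := by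
  refine ContinuousLinearMap.ext fun x => ?_
  change derivationFun (Pi.single 1 1) (derivationFun (Pi.single 9 1) x) -
    derivationFun (Pi.single 9 1) (derivationFun (Pi.single 1 1) x) = (-2 : ℝ) • derivationFun (Pi.single 9 1) x
  simp only [derivationFun_single_1, derivationFun_single_9]
  ext <;> simp <;> ring

theorem lie_chevalley_2_3 : ⁅chevalley 2, chevalley 3⁆ = chevalley 4 := by
  refine ContinuousLinearMap.ext fun x => ?_
  change derivationFun (Pi.single 2 1) (derivationFun (Pi.single 3 1) x) -
    derivationFun (Pi.single 3 1) (derivationFun (Pi.single 2 1) x) = derivationFun (Pi.single 4 1) x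
  simp only [derivationFun_single_2, derivationFun_single_3, derivationFun_single_4]
  ext <;> simp <;> ring

theorem lie_chevalley_2_4 : ⁅chevalley 2, chevalley 4⁆ = chevalley 5 := by
  refine ContinuousLinearMap.ext fun x => ?_
  change derivationFun (Pi.single 2 1) (derivationFun (Pi.single 4 1) x) -
    derivationFun (Pi.single 4 1) (derivationFun (Pi.single 2 1) x) = derivationFun (Pi.single 5 1) x
  simp only [derivationFun_single_2, derivationFun_single_4, derivationFun_single_5]
  ext <;> simp <;> ring

theorem lie_chevalley_2_5 : ⁅chevalley 2, chevalley 5⁆ = chevalley 6 := by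
  refine ContinuousLinearMap.ext fun x => ?_
  change derivationFun (Pi.single 2 1) (derivationFun (Pi.single 5 1) x) -
    derivationFun (Pi.single 5 1) (derivationFun (Pi.single 2 1) x) = derivationFun (Pi.single 6 1) x
  simp only [derivationFun_single_2, derivationFun_single_5, derivationFun_single_6]
  ext <;> simp <;> ring

theorem lie_chevalley_3_6 : ⁅chevalley 3, chevalley 6⁆ = chevalley 7 := by
  refine ContinuousLinearMap.ext fun x => ?_
  change derivationFun (Pi.single 3 1) (derivationFun (Pi.single 6 1) x) -
    derivationFun (Pi.single 6 1) (derivationFun (Pi.single 3 1) x) = derivationFun (Pi.single 7 1) x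
  simp only [derivationFun_single_3, derivationFun_single_6, derivationFun_single_7]
  ext <;> simp <;> ring

theorem lie_chevalley_2_6 : ⁅chevalley 2, chevalley 6⁆ = 0 := by
  refine ContinuousLinearMap.ext fun x => ?_
  change derivationFun (Pi.single 2 1) (derivationFun (Pi.single 6 1) x) -
    derivationFun (Pi.single 6 1) (derivationFun (Pi.single 2 1) x) = 0
  simp only [derivationFun_single_2, derivationFun_single_6]
  ext <;> simp

theorem lie_chevalley_3_4 : ⁅chevalley 3, chevalley 4⁆ = 0 := by
  refine ContinuousLinearMap.ext fun x => ?_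
  change derivationFun (Pi.single 3 1) (derivationFun (Pi.single 4 1) x) -
    derivationFun (Pi.single 4 1) (derivationFun (Pi.single 3 1) x) = 0
  simp only [derivationFun_single_3, derivationFun_single_4]
  ext <;> simp <;> ring

theorem lie_chevalley_8_9 : ⁅chevalley 8, chevalley 9⁆ = chevalley 10 := by
  refine ContinuousLinearMap.ext fun x => ?_
  change derivationFun (Pi.single 8 1) (derivationFun (Pi.single 9 1) x) -
    derivationFun (Pi.single 9 1) (derivationFun (Pi.single 8 1) x) = derivationFun (Pi.single 10 1) x
  simp only [derivationFun_single_8, derivationFun_single_9, derivationFun_single_10]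
  ext <;> simp <;> ring

theorem lie_chevalley_8_10 : ⁅chevalley 8, chevalley 10⁆ = chevalley 11 := by
  refine ContinuousLinearMap.ext fun x => ?_
  change derivationFun (Pi.single 8 1) (derivationFun (Pi.single 10 1) x) -
    derivationFun (Pi.single 10 1) (derivationFun (Pi.single 8 1) x) = derivationFun (Pi.single 11 1) x
  simp only [derivationFun_single_8, derivationFun_single_10, derivationFun_single_11]
  ext <;> simp <;> ring

theorem lie_chevalley_8_11 : ⁅chevalley 8, chevalley 11⁆ = chevalley 12 := by
  refine ContinuousLinearMap.ext fun x => ?_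
  change derivationFun (Pi.single 8 1) (derivationFun (Pi.single 11 1) x) -
    derivationFun (Pi.single 11 1) (derivationFun (Pi.single 8 1) x) = derivationFun (Pi.single 12 1) x
  simp only [derivationFun_single_8, derivationFun_single_11, derivationFun_single_12]
  ext <;> simp <;> ring

theorem lie_chevalley_9_12 : ⁅chevalley 9, chevalley 12⁆ = chevalley 13 := by
  refine ContinuousLinearMap.ext fun x => ?_
  change derivationFun (Pi.single 9 1) (derivationFun (Pi.single 12 1) x) -
    derivationFun (Pi.single 12 1) (derivationFun (Pi.single 9 1) x) = derivationFun (Pi.single 13 1) x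
  simp only [derivationFun_single_9, derivationFun_single_12, derivationFun_single_13]
  ext <;> simp <;> ring

theorem lie_chevalley_8_12 : ⁅chevalley 8, chevalley 12⁆ = 0 := by
  refine ContinuousLinearMap.ext fun x => ?_
  change derivationFun (Pi.single 8 1) (derivationFun (Pi.single 12 1) x) -
    derivationFun (Pi.single 12 1) (derivationFun (Pi.single 8 1) x) = 0
  simp only [derivationFun_single_8, derivationFun_single_12]
  ext <;> simp <;> ring

theorem lie_chevalley_9_10 : ⁅chevalley 9, chevalley 10⁆ = 0 := by
  refine ContinuousLinearMap.ext fun x => ?_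
  change derivationFun (Pi.single 9 1) (derivationFun (Pi.single 10 1) x) -
    derivationFun (Pi.single 10 1) (derivationFun (Pi.single 9 1) x) = 0
  simp only [derivationFun_single_9, derivationFun_single_10]
  ext <;> simp <;> ring

theorem relations_chevalley : G2Serre.Relations ![chevalley 0, chevalley 1]
    ![chevalley 2, chevalley 3] ![chevalley 8, chevalley 9] where
  hh := lie_chevalley_0_1
  ef i := by
    fin_cases i
    · exact lie_chevalley_2_8
    · exact lie_chevalley_3_9
  ef01 := lie_chevalley_2_9
  ef10 := lie_chevalley_3_8
  he00 := lie_chevalley_0_2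
  he01 := lie_chevalley_0_3
  he10 := lie_chevalley_1_2
  he11 := lie_chevalley_1_3
  hf00 := lie_chevalley_0_8
  hf01 := lie_chevalley_0_9
  hf10 := lie_chevalley_1_8
  hf11 := lie_chevalley_1_9
  ee0 := by
    simp only [Matrix.cons_val]
    rw [lie_chevalley_2_3, lie_chevalley_2_4, lie_chevalley_2_5, lie_chevalley_2_6]
  ee1 := by
    simp only [Matrix.cons_val]
    rw [← lie_skew (chevalley 3) (chevalley 2), lie_neg, lie_chevalley_2_3, lie_chevalley_3_4, neg_zero]
  ff0 := by
    simp only [Matrix.cons_val]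
    rw [lie_chevalley_8_9, lie_chevalley_8_10, lie_chevalley_8_11, lie_chevalley_8_12]
  ff1 := by
    simp only [Matrix.cons_val]
    rw [← lie_skew (chevalley 9) (chevalley 8), lie_neg, lie_chevalley_8_9, lie_chevalley_9_10, neg_zero]

theorem exp_derivation_mem (D : SplitOctonion →L[ℝ] SplitOctonion) (hD : IsDerivation D) :
    ∃ u ∈ G2, (u : SplitOctonion →L[ℝ] SplitOctonion) = NormedSpace.exp D := by
  refine ⟨⟨NormedSpace.exp D, NormedSpace.exp (-D), exp_mul_exp_neg D, ?_⟩, fun x y => ?_, rfl⟩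
  · have := exp_mul_exp_neg (-D)
    rwa [neg_neg] at this
  · exact exp_map_bilinear_of_derivation octMulL hD x y

theorem eq_zero_of_derivation_eq_zero {c : Fin 14 → ℝ} (h : derivation c = 0) : c = 0 := by
  have h' : ∀ x, derivationFun c x = 0 := fun x => by
    rw [← derivation_apply, h]; rfl
  have hi := h' oi
  have hj := h' oj
  have hl := h' ol
  simp only [Prod.ext_iff, Quaternion.ext_iff] at hi hj hl
  simp [derivationFun, oi, oj, ol] at hi hj hl
  obtain ⟨⟨i1, i2⟩, i3, i4, i5, i6⟩ := hi
  obtain ⟨⟨j1, j2⟩, j3, j4, j5, j6⟩ := hj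
  obtain ⟨⟨l1, l2, l3⟩, l4, l5, l6⟩ := hl
  ext k
  fin_cases k <;> simp only [Pi.zero_apply, Fin.zero_eta, Fin.mk_one, Fin.reduceFinMk] <;> linarith

/-- The Lie algebra of `G₂` is the split Lie algebra `𝔤₂`. -/
theorem exists_lieHom_G2 : ∃ e : LieAlgebra.g₂ ℝ →ₗ⁅ℝ⁆ (SplitOctonion →L[ℝ] SplitOctonion),
    Function.Injective e ∧ ∀ X : SplitOctonion →L[ℝ] SplitOctonion, X ∈ Set.range e ↔
      ∀ t : ℝ, ∃ u ∈ G2, (u : SplitOctonion →L[ℝ] SplitOctonion) = NormedSpace.exp (t • X) := by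
  obtain ⟨φ, hH, hE, hF⟩ := relations_chevalley.exists_lieHom
  let w := G2Serre.word G2Serre.genH G2Serre.genE G2Serre.genF
  have hE0 : φ (G2Serre.genE 0) = chevalley 2 := hE 0
  have hE1 : φ (G2Serre.genE 1) = chevalley 3 := hE 1
  have hF0 : φ (G2Serre.genF 0) = chevalley 8 := hF 0
  have hF1 : φ (G2Serre.genF 1) = chevalley 9 := hF 1
  -- The words spanning `𝔤₂` go to the basis of derivations. Independence of the latter then yields
  -- injectivity, and their span gives the range.
  have hw : ∀ i, φ (w i) = chevalley i := by
    intro i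
    fin_cases i <;> simp only [w, G2Serre.word, G2Serre.posWord, Matrix.cons_val, Fin.zero_eta,
      Fin.mk_one, Fin.reduceFinMk, LieHom.map_lie, hE0, hE1, hF0, hF1, lie_chevalley_2_3,
      lie_chevalley_2_4, lie_chevalley_2_5, lie_chevalley_3_6, lie_chevalley_8_9,
      lie_chevalley_8_10, lie_chevalley_8_11, lie_chevalley_9_12]
    · exact hH 0
    · exact hH 1
  have hsum : ∀ c : Fin 14 → ℝ, φ (∑ i, c i • w i) = derivation c := fun c => by
    rw [derivation_eq_sum, map_sum]
    exact Finset.sum_congr rfl fun i _ => by rw [map_smul, hw]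
  have hspan : ∀ x, ∃ c : Fin 14 → ℝ, ∑ i, c i • w i = x := fun x => by
    have : x ∈ Submodule.span ℝ (Set.range w) := by
      rw [G2Serre.relations_gen.span_word_eq_top G2Serre.gen_generate]
      trivial
    exact (Submodule.mem_span_range_iff_exists_fun ℝ).1 this
  refine ⟨φ, (injective_iff_map_eq_zero φ).2 fun x hx => ?_, fun X => ⟨?_, fun hX => ?_⟩⟩
  · obtain ⟨c, rfl⟩ := hspan x
    rw [hsum] at hx
    rw [eq_zero_of_derivation_eq_zero hx]
    simp
  · rintro ⟨x, rfl⟩ t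
    obtain ⟨c, rfl⟩ := hspan x
    rw [hsum, ← map_smul]
    exact exp_derivation_mem _ (isDerivation_derivation _)
  · have hD : IsDerivation X := derivation_of_exp_map_bilinear octMulL fun t x y => by
      obtain ⟨u, hu, h⟩ := hX t
      have h1 : ∀ z, NormedSpace.exp (t • X) z = u.val z := fun z => by rw [h]
      have h2 := hu x y
      rw [← h1, ← h1, ← h1] at h2
      exact h2
    exact ⟨_, (hsum _).trans hD.eq_derivation.symm⟩

theorem isSplitAdjointG2_G2 : IsSplitAdjointG2 G2 :=
  ⟨isClosed_G2, isConnected_G2, exists_lieHom_G2, center_G2_eq_bot⟩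

end SplitOct

/-! ### Spheres and smooth maps -/

section Unitize

variable {E : Type*} [NormedAddCommGroup E]

open Classical in
/-- The radial projection to the unit sphere, with a given value at the origin. -/
noncomputable def unitize [NormedSpace ℝ E] (o : Metric.sphere (0 : E) 1) (y : E) :
    Metric.sphere (0 : E) 1 :=
  if h : y = 0 then o else ⟨‖y‖⁻¹ • y, by
    rw [mem_sphere_zero_iff_norm, norm_smul, norm_inv, norm_norm,
      inv_mul_cancel₀ (norm_ne_zero_iff.2 h)]⟩

theorem coe_unitize [NormedSpace ℝ E] (o : Metric.sphere (0 : E) 1) {y : E} (hy : y ≠ 0) :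
    (unitize o y : E) = ‖y‖⁻¹ • y := by
  rw [unitize, dif_neg hy]

theorem unitize_smul [NormedSpace ℝ E] (o x : Metric.sphere (0 : E) 1) {t : ℝ} (ht : 0 < t) :
    unitize o (t • (x : E)) = x := by
  have hx := mem_sphere_zero_iff_norm.1 x.2
  have h0 : (x : E) ≠ 0 := fun h => by rw [h, norm_zero] at hx; exact zero_ne_one hx
  refine Subtype.ext ?_
  rw [coe_unitize _ (smul_ne_zero ht.ne' h0), norm_smul, hx, mul_one, Real.norm_of_nonneg ht.le,
    smul_smul, inv_mul_cancel₀ ht.ne', one_smul]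

theorem contMDiffAt_unitize [InnerProductSpace ℝ E] {n : ℕ}
    [Fact (Module.finrank ℝ E = n + 1)] (o : Metric.sphere (0 : E) 1) {y : E} (hy : y ≠ 0) :
    ContMDiffAt 𝓘(ℝ, E) (𝓡 n) ∞ (unitize o) y := by
  -- Restricting smoothly to the sphere is available for globally smooth maps, so the radial
  -- projection is treated on the open submanifold where it is smooth everywhere.
  let U : TopologicalSpace.Opens E := ⟨{0}ᶜ, isOpen_compl_singleton⟩
  have hf : ContMDiff 𝓘(ℝ, E) 𝓘(ℝ, E) ∞ fun x : U => ‖(x : E)‖⁻¹ • (x : E) := by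
    intro x
    have hx : (x : E) ≠ 0 := x.2
    have h : ContDiffAt ℝ ∞ (fun x : E => ‖x‖⁻¹ • x) (x : E) :=
      ((contDiffAt_norm ℝ hx).inv (norm_ne_zero_iff.2 hx)).smul contDiffAt_id
    exact contMDiffAt_subtype_iff.2 h.contMDiffAt
  have hm : ∀ x : U, ‖(x : E)‖⁻¹ • (x : E) ∈ Metric.sphere (0 : E) 1 := fun x => by
    rw [← coe_unitize o x.2]; exact (unitize o (x : E)).2
  have h := hf.codRestrict_sphere (n := n) hm
  have he : (fun x : U => unitize o (x : E)) = Set.codRestrict _ _ hm := by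
    funext x
    exact Subtype.ext (coe_unitize o x.2)
  rw [← he] at h
  exact contMDiffAt_subtype_iff.1 (h ⟨y, hy⟩)

end Unitize

namespace SplitOct

open Quaternion

/-- The embedding of `S³ × S²` into a vector space. -/
def ambient (p : RollingCover) : ℍ[ℝ] × E3 := (p.1, p.2)

theorem contMDiff_ambient : ContMDiff coverModel 𝓘(ℝ, ℍ[ℝ] × E3) ∞ ambient :=
  ContMDiff.prodMk_space (contMDiff_coe_sphere.comp contMDiff_fst)
    (contMDiff_coe_sphere.comp contMDiff_snd)

theorem mdifferentiable_ambient : MDifferentiable coverModel 𝓘(ℝ, ℍ[ℝ] × E3) ambient :=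
  contMDiff_ambient.mdifferentiable (by simp)

/-- The derivative of the embedding of `S³ × S²` into a vector space. -/
noncomputable def ambientDeriv (p : RollingCover) :
    TangentSpace coverModel p →L[ℝ] ℍ[ℝ] × E3 :=
  mfderiv coverModel 𝓘(ℝ, ℍ[ℝ] × E3) ambient p

theorem mfderiv_comp_ambient {V : Type*} [NormedAddCommGroup V] [NormedSpace ℝ V]
    {f : ℍ[ℝ] × E3 → V} (p : RollingCover) (hf : DifferentiableAt ℝ f (ambient p))
    (v : TangentSpace coverModel p) :
    mfderiv coverModel 𝓘(ℝ, V) (f ∘ ambient) p v = fderiv ℝ f (ambient p) (ambientDeriv p v) := by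
  rw [mfderiv_comp p hf.mdifferentiableAt (mdifferentiable_ambient p), mfderiv_eq_fderiv]
  rfl

theorem fderiv_apply_of_hasDerivAt {V W : Type*} [NormedAddCommGroup V] [NormedSpace ℝ V]
    [NormedAddCommGroup W] [NormedSpace ℝ W] {f : V → W} {x v : V} {w : W}
    (hf : DifferentiableAt ℝ f x) (h : HasDerivAt (fun t : ℝ => f (x + t • v)) w 0) :
    fderiv ℝ f x v = w := by
  rw [← hf.lineDeriv_eq_fderiv]
  exact HasLineDerivAt.lineDeriv h

/-- Differentiating `‖L‖² = 1` along the manifold. With `L` either projection it expresses tangency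
to the corresponding sphere. -/
theorem inner_ambientDeriv {V : Type*} [NormedAddCommGroup V] [InnerProductSpace ℝ V]
    (L : ℍ[ℝ] × E3 →L[ℝ] V) (hL : ∀ p, ‖L (ambient p)‖ = 1) (p : RollingCover)
    (v : TangentSpace coverModel p) : inner ℝ (L (ambient p)) (L (ambientDeriv p v)) = 0 := by
  have hd : Differentiable ℝ fun y : ℍ[ℝ] × E3 => inner ℝ (L y) (L y) :=
    L.differentiable.inner ℝ L.differentiable
  have h := mfderiv_comp_ambient p (hd _) v
  have hc : (fun y : ℍ[ℝ] × E3 => inner ℝ (L y) (L y)) ∘ ambient = fun _ => (1 : ℝ) := by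
    funext p
    rw [Function.comp_apply, real_inner_self_eq_norm_sq, hL, one_pow]
  rw [hc, mfderiv_const, fderiv_inner_apply ℝ L.differentiableAt L.differentiableAt,
    L.fderiv, real_inner_comm (L (ambient p))] at h
  have h4 : (0 : ℝ) = _ := h
  linarith

theorem inner_ambientDeriv_fst (p : RollingCover) (v : TangentSpace coverModel p) :
    inner ℝ (p.1 : ℍ[ℝ]) (ambientDeriv p v).1 = 0 :=
  inner_ambientDeriv (ContinuousLinearMap.fst ℝ _ _) (fun p => norm_coe_S3 p.1) p v

theorem inner_ambientDeriv_snd (p : RollingCover) (v : TangentSpace coverModel p) :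
    inner ℝ (p.2 : E3) (ambientDeriv p v).2 = 0 :=
  inner_ambientDeriv (ContinuousLinearMap.snd ℝ _ _) (fun p => norm_coe_S2 p.2) p v

/-- The linear inclusion of the imaginary quaternions. -/
noncomputable def imQuatL : E3 →L[ℝ] ℍ[ℝ] :=
  LinearMap.toContinuousLinearMap
    { toFun := fun x => imQuat x.ofLp
      map_add' := fun x y => by ext <;> simp
      map_smul' := fun c x => by ext <;> simp }

theorem imQuatL_apply (x : E3) : imQuatL x = imQuat x.ofLp := rfl

/-- The linear projection to the imaginary quaternions. -/
noncomputable def imVecL : ℍ[ℝ] →L[ℝ] E3 :=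
  LinearMap.toContinuousLinearMap
    { toFun := fun z => WithLp.toLp 2 (imVec z)
      map_add' := fun x y => by ext i; fin_cases i <;> simp [imVec]
      map_smul' := fun c x => by ext i; fin_cases i <;> simp [imVec] }

theorem imVecL_imQuatL (x : E3) : imVecL (imQuatL x) = x := by
  ext i; fin_cases i <;> simp [imVecL, imQuatL, imVec]

theorem imQuatL_imVecL {z : ℍ[ℝ]} (hz : z.re = 0) : imQuatL (imVecL z) = z :=
  imQuat_imVec hz

theorem inner_imQuatL (x y : E3) : inner ℝ (imQuatL x) (imQuatL y) = inner ℝ x y := by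
  rw [Quaternion.inner_def]
  simp [imQuatL_apply, PiLp.inner_apply, Fin.sum_univ_three]
  ring

theorem norm_imQuatL (x : E3) : ‖imQuatL x‖ = ‖x‖ := by
  rw [← sq_eq_sq₀ (norm_nonneg _) (norm_nonneg _), ← real_inner_self_eq_norm_sq,
    ← real_inner_self_eq_norm_sq, inner_imQuatL]

theorem imQuat_crossProduct (v w : Fin 3 → ℝ) :
    (2 : ℝ) • imQuat (v ⨯₃ w) = imQuat v * imQuat w - imQuat w * imQuat v := by
  ext <;> simp [cross_apply] <;> ring

theorem imQuat_mul_imQuat (v w : Fin 3 → ℝ) :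
    imQuat v * imQuat w = imQuat (v ⨯₃ w) - (v ⬝ᵥ w) • (1 : ℍ[ℝ]) := by
  ext <;> simp [cross_apply, Matrix.vec3_dotProduct] <;> ring

/-! ### The lifted rolling distribution -/

/-- The polynomial extension of the covering map to the ambient space. -/
noncomputable def coverPoly (y : ℍ[ℝ] × E3) : AmbientSpace :=
  (fun i k => rotMatrix y.1 i k, y.2)

theorem coverMapAmbient_eq : coverMapAmbient = coverPoly ∘ ambient := rfl

instance : StarModule ℝ ℍ[ℝ] := ⟨fun r q => by ext <;> simp⟩

theorem contDiff_star_quaternion : ContDiff ℝ ∞ fun q : ℍ[ℝ] => star q :=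
  (starL' ℝ : ℍ[ℝ] ≃L[ℝ] ℍ[ℝ]).contDiff

theorem differentiable_star_quaternion : Differentiable ℝ fun q : ℍ[ℝ] => star q :=
  contDiff_star_quaternion.differentiable (by simp)

theorem differentiable_rotMatrix : Differentiable ℝ fun q : ℍ[ℝ] => fun i k => rotMatrix q i k := by
  refine differentiable_pi.2 fun i => differentiable_pi.2 fun k => ?_
  have h : Differentiable ℝ fun q : ℍ[ℝ] => imVecL (q * imQuat (Pi.single k 1) * star q) :=
    imVecL.differentiable.comp
      ((differentiable_id.mul_const _).mul differentiable_star_quaternion)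
  exact (EuclideanSpace.proj (𝕜 := ℝ) i : E3 →L[ℝ] ℝ).differentiable.comp h

theorem differentiable_coverPoly : Differentiable ℝ coverPoly :=
  (differentiable_rotMatrix.comp differentiable_fst).prodMk differentiable_snd

theorem fderiv_coverPoly_snd (y v : ℍ[ℝ] × E3) : (fderiv ℝ coverPoly y v).2 = v.2 := by
  have h := (ContinuousLinearMap.snd ℝ (Fin 3 → Fin 3 → ℝ) E3).hasFDerivAt.comp y
    (differentiable_coverPoly y).hasFDerivAt
  exact congrArg (fun L : ℍ[ℝ] × E3 →L[ℝ] E3 => L v)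
    (h.unique (ContinuousLinearMap.snd ℝ ℍ[ℝ] E3).hasFDerivAt)

theorem hasDerivAt_line {V : Type*} [NormedAddCommGroup V] [NormedSpace ℝ V] (x v : V) :
    HasDerivAt (fun t : ℝ => x + t • v) v 0 := by
  simpa using ((hasDerivAt_id (0 : ℝ)).smul_const v).const_add x

theorem fderiv_coverPoly_fst (y v : ℍ[ℝ] × E3) (P : Fin 3 → ℝ) :
    Matrix.of (fderiv ℝ coverPoly y v).1 *ᵥ P =
      imVec (v.1 * imQuat P * star y.1 + y.1 * imQuat P * star v.1) := by
  let L : AmbientSpace →L[ℝ] E3 := LinearMap.toContinuousLinearMap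
    { toFun := fun A => WithLp.toLp 2 (Matrix.of A.1 *ᵥ P)
      map_add' := fun A B => by
        rw [← WithLp.toLp_add, ← Matrix.add_mulVec]; rfl
      map_smul' := fun c A => by
        rw [RingHom.id_apply, ← WithLp.toLp_smul, ← Matrix.smul_mulVec]; rfl }
  have h1 : HasFDerivAt (L ∘ coverPoly) (L.comp (fderiv ℝ coverPoly y)) y :=
    L.hasFDerivAt.comp y (differentiable_coverPoly y).hasFDerivAt
  have h2 : L ∘ coverPoly = fun y => imVecL (y.1 * imQuat P * star y.1) := by
    funext y
    exact congrArg (WithLp.toLp 2) (rotMatrix_mulVec y.1 P)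
  have h3 : fderiv ℝ (L ∘ coverPoly) y v =
      imVecL (v.1 * imQuat P * star y.1 + y.1 * imQuat P * star v.1) := by
    refine fderiv_apply_of_hasDerivAt h1.differentiableAt ?_
    rw [h2]
    have h4 := hasDerivAt_line y.1 v.1
    have h5 : HasDerivAt (fun t : ℝ => imVecL ((y.1 + t • v.1) * imQuat P * star (y.1 + t • v.1)))
        _ 0 := imVecL.hasFDerivAt.comp_hasDerivAt (0 : ℝ) ((h4.mul_const (imQuat P)).mul h4.star)
    simpa using h5
  rw [h1.fderiv] at h3
  exact congrArg WithLp.ofLp h3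

end SplitOct

/-! ### Angular velocity and the rolling conditions in quaternions. -/

namespace SplitOct

open Quaternion

theorem crossProduct_left_injective {v w : Fin 3 → ℝ} (h : ∀ u, v ⨯₃ u = w ⨯₃ u) : v = w := by
  have h0 := h (Pi.single 0 1)
  have h1 := h (Pi.single 1 1)
  have e1 := congrFun h0 1
  have e2 := congrFun h0 2
  have e0 := congrFun h1 2
  simp [cross_apply] at e0 e1 e2
  ext i
  fin_cases i <;> simp [e0, e1, e2]

theorem imVec_eq_iff {z w : ℍ[ℝ]} : z = w ↔ z.re = w.re ∧ imVec z = imVec w := by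
  refine ⟨fun h => by rw [h]; exact ⟨rfl, rfl⟩, fun ⟨h, h'⟩ => ?_⟩
  have h0 := congrFun h' 0
  have h1 := congrFun h' 1
  have h2 := congrFun h' 2
  ext
  exacts [h, h0, h1, h2]

theorem exists_rotMatrix_mulVec_eq (q : S3) (u : Fin 3 → ℝ) :
    ∃ P, rotMatrix q.val *ᵥ P = u := by
  refine ⟨rotMatrix (star q.val) *ᵥ u, ?_⟩
  rw [Matrix.mulVec_mulVec, ← rotMatrix_mul, mul_star_of_norm_eq_one (norm_coe_S3 q),
    rotMatrix_mulVec, star_one, one_mul, mul_one, imVec_imQuat]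

/-- The quaternion `q' q̄` is half the angular velocity; it is imaginary because `q'` is orthogonal
to `q`. -/
theorem angularVelocity_re (p : RollingCover) (v : TangentSpace coverModel p) :
    ((ambientDeriv p v).1 * star p.1.val).re = 0 := by
  rw [← Quaternion.inner_def, real_inner_comm, inner_ambientDeriv_fst]

/-- With `W = q' q̄` imaginary, the derivative of `q P q̄` is the commutator of `W` with `q P q̄`,
and a commutator of imaginary quaternions is twice their cross product. Hence the angular velocity
is `2W`. -/
theorem mulVec_coverPoly {q q' : ℍ[ℝ]} (hq : ‖q‖ = 1) (hW : (q' * star q).re = 0)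
    (P : Fin 3 → ℝ) :
    imVec (q' * imQuat P * star q + q * imQuat P * star q') =
      ((2 : ℝ) • imVec (q' * star q)) ⨯₃ (rotMatrix q *ᵥ P) := by
  have h1 := imQuat_crossProduct (imVec (q' * star q)) (rotMatrix q *ᵥ P)
  rw [imQuat_imVec hW, imQuat_rotMatrix_mulVec] at h1
  have h2 : (2 : ℝ) • imQuat (imVec (q' * star q) ⨯₃ (rotMatrix q *ᵥ P)) =
      imQuat (((2 : ℝ) • imVec (q' * star q)) ⨯₃ (rotMatrix q *ᵥ P)) := by
    ext <;> simp
  have h3 : star (q' * star q) = -(q' * star q) := by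
    ext <;> simp at hW ⊢ <;> linarith
  have h4 := star_mul_of_norm_eq_one hq
  rw [← imVec_imQuat (_ ⨯₃ _), ← h2, h1]
  congr 1
  have e1 : q' * star q * (q * imQuat P * star q) = q' * imQuat P * star q := by
    calc q' * star q * (q * imQuat P * star q) = q' * (star q * q) * imQuat P * star q := by
          noncomm_ring
      _ = _ := by rw [h4, mul_one]
  have e2 : q * imQuat P * star q * (q' * star q) = -(q * imQuat P * star q') := by
    calc q * imQuat P * star q * (q' * star q) = -(q * imQuat P * star q * star (q' * star q)) := by
          rw [h3, mul_neg, neg_neg]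
      _ = -(q * imQuat P * (star q * q) * star q') := by rw [star_mul, star_star]; noncomm_ring
      _ = _ := by rw [h4, mul_one]
  rw [e1, e2, sub_neg_eq_add]

/-- The no-slip and no-spin conditions as one quaternionic equation. -/
theorem mem_liftedPlane_iff {R r : ℝ} {p : RollingCover} {v : TangentSpace coverModel p} :
    v ∈ liftedPlane R r p ↔ (R / r + 1) • imQuatL (ambientDeriv p v).2 =
      (2 : ℝ) • ((ambientDeriv p v).1 * star p.1.val * imQuatL p.2.val) := by
  have hd : mfderiv coverModel 𝓘(ℝ, AmbientSpace) coverMapAmbient p v =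
      fderiv ℝ coverPoly (ambient p) (ambientDeriv p v) := by
    rw [coverMapAmbient_eq, mfderiv_comp_ambient p (differentiable_coverPoly _)]
  have hW := angularVelocity_re p v
  have hq := norm_coe_S3 p.1
  have hm : v ∈ liftedPlane R r p ↔
      fderiv ℝ coverPoly (ambient p) (ambientDeriv p v) ∈ rollingPlane R r (coverMap p) := by
    rw [← hd]; rfl
  rw [hm]
  generalize ambientDeriv p v = v' at *
  set W := v'.1 * star p.1.val with hWdef
  -- The product of imaginary quaternions has the cross product as imaginary part and minus the
  -- inner product as real part: the imaginary part of the equation is no slip, the real part no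
  -- spin.
  have hmul : W * imQuatL p.2.val = imQuat (imVec W ⨯₃ p.2.val.ofLp) -
      (imVec W ⬝ᵥ p.2.val.ofLp) • (1 : ℍ[ℝ]) := by
    rw [imQuatL_apply, ← imQuat_mul_imQuat, imQuat_imVec hW]
  have hcond : (R / r + 1) • imQuatL v'.2 = (2 : ℝ) • (W * imQuatL p.2.val) ↔
      (R / r + 1) • v'.2.ofLp = ((2 : ℝ) • imVec W) ⨯₃ p.2.val.ofLp ∧
        ((2 : ℝ) • imVec W) ⬝ᵥ p.2.val.ofLp = 0 := by
    rw [hmul, imVec_eq_iff, and_comm]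
    refine and_congr ?_ ?_
    · have e1 : imVec ((R / r + 1) • imQuatL v'.2) = (R / r + 1) • v'.2.ofLp := by
        ext i; fin_cases i <;> simp [imVec, imQuatL_apply]
      have e2 : imVec ((2 : ℝ) • (imQuat (imVec W ⨯₃ p.2.val.ofLp) -
          (imVec W ⬝ᵥ p.2.val.ofLp) • (1 : ℍ[ℝ]))) = ((2 : ℝ) • imVec W) ⨯₃ p.2.val.ofLp := by
        rw [map_smul, LinearMap.smul_apply]
        generalize imVec W ⨯₃ p.2.val.ofLp = u
        ext i; fin_cases i <;> simp [imVec]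
      rw [e1, e2]
    · rw [smul_dotProduct]
      simp [imQuatL_apply, eq_comm]
  rw [hcond]
  constructor
  · rintro ⟨w, h1, h2, h3⟩
    -- The angular velocity is unique, since a rotation is surjective and a vector is determined by
    -- its cross products.
    have hw : w = (2 : ℝ) • imVec W := by
      refine crossProduct_left_injective fun u => ?_
      obtain ⟨P, rfl⟩ := exists_rotMatrix_mulVec_eq p.1 u
      rw [← mulVec_coverPoly hq hW]
      exact (h1 P).symm.trans (fderiv_coverPoly_fst _ _ P)
    rw [fderiv_coverPoly_snd, hw] at h2
    rw [hw] at h3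
    exact ⟨h2, h3⟩
  · rintro ⟨h2, h3⟩
    refine ⟨(2 : ℝ) • imVec W, fun P => ?_, ?_, h3⟩
    · exact (fderiv_coverPoly_fst _ _ P).trans (mulVec_coverPoly hq hW P)
    · rw [fderiv_coverPoly_snd]
      exact h2

end SplitOct

/-! ### The action on null rays -/

namespace SplitOct

open Quaternion

/-- An identification of `S³ × S²` with the space of null rays in the imaginary split octonions,
under which the lifted rolling distribution becomes the set of directions annihilated by the
multiplication with the base point. -/
structure NullChart (R r : ℝ) where
  /-- The null vector spanning the ray. -/
  toFun : ℍ[ℝ] × E3 → SplitOctonion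
  /-- The first component of the inverse, up to normalization. -/
  fst : SplitOctonion → ℍ[ℝ]
  /-- The second component of the inverse, up to normalization. -/
  snd : SplitOctonion → E3
  contDiff_toFun : ContDiff ℝ ∞ toFun
  contDiff_fst : ContDiff ℝ ∞ fst
  contDiff_snd : ContDiff ℝ ∞ snd
  re_toFun : ∀ p, (toFun (ambient p)).1.re = 0
  norm_toFun_fst : ∀ p, ‖(toFun (ambient p)).1‖ = 1
  norm_toFun_snd : ∀ p, ‖(toFun (ambient p)).2‖ = 1
  fst_smul : ∀ p, ∀ t > (0 : ℝ), ∃ s > (0 : ℝ), fst (t • toFun (ambient p)) = s • p.1.val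
  snd_smul : ∀ p, ∀ t > (0 : ℝ), ∃ s > (0 : ℝ), snd (t • toFun (ambient p)) = s • p.2.val
  exists_eq_smul : ∀ y : SplitOctonion, y.1.re = 0 → ‖y.1‖ = 1 → ‖y.2‖ = 1 →
    ∃ p, toFun (ambient p) = y
  toFun_neg : ∀ q x, toFun (-q, x) = ((toFun (q, x)).1, -(toFun (q, x)).2)
  mem_liftedPlane : ∀ p (v : TangentSpace coverModel p), v ∈ liftedPlane R r p ↔
    octMul (toFun (ambient p)) (fderiv ℝ toFun (ambient p) (ambientDeriv p v)) = 0

namespace NullChart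

variable {R r : ℝ} (C : NullChart R r)

/-- The null vector spanning the ray of a point. -/
noncomputable def vec (p : RollingCover) : SplitOctonion := C.toFun (ambient p)

/-- The point of a null ray. -/
noncomputable def inv (o : RollingCover) (y : SplitOctonion) : RollingCover :=
  (unitize o.1 (C.fst y), unitize o.2 (C.snd y))

/-- The point `o` only supplies a value where `fst` or `snd` vanishes, which does not occur on the
rays of the chart, so it plays no role here. -/
theorem inv_smul_vec (o p : RollingCover) {t : ℝ} (ht : 0 < t) : C.inv o (t • C.vec p) = p := by
  obtain ⟨s, hs, h⟩ := C.fst_smul p t ht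
  obtain ⟨s', hs', h'⟩ := C.snd_smul p t ht
  refine Prod.ext ?_ ?_
  · rw [inv, vec, h, unitize_smul _ _ hs]
  · rw [inv, vec, h', unitize_smul _ _ hs']

theorem inv_vec (o p : RollingCover) : C.inv o (C.vec p) = p := by
  have := C.inv_smul_vec o p one_pos
  rwa [one_smul] at this

theorem quad_vec (p : RollingCover) : quad (C.vec p) = 0 := by
  rw [quad_eq_norm, vec, C.norm_toFun_fst, C.norm_toFun_snd, sub_self]

theorem re_vec (p : RollingCover) : (C.vec p).1.re = 0 := C.re_toFun p

theorem vec_fst_ne_zero (p : RollingCover) : (C.vec p).1 ≠ 0 := by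
  rw [← norm_ne_zero_iff, vec, C.norm_toFun_fst]
  exact one_ne_zero

theorem exists_smul_vec {y : SplitOctonion} (hre : y.1.re = 0) (hq : quad y = 0)
    (h0 : y.1 ≠ 0) : ∃ p, y = ‖y.1‖ • C.vec p := by
  have hn : 0 < ‖y.1‖ := norm_pos_iff.2 h0
  have h2 : ‖y.2‖ = ‖y.1‖ := by
    rw [quad_eq_norm] at hq
    rw [← sq_eq_sq₀ (norm_nonneg _) (norm_nonneg _)]
    linarith
  obtain ⟨p, hp⟩ := C.exists_eq_smul (‖y.1‖⁻¹ • y) (by simp [hre])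
    (by rw [Prod.smul_fst, norm_smul, norm_inv, norm_norm, inv_mul_cancel₀ hn.ne'])
    (by rw [Prod.smul_snd, norm_smul, norm_inv, norm_norm, h2, inv_mul_cancel₀ hn.ne'])
  exact ⟨p, by rw [vec, hp, smul_smul, mul_inv_cancel₀ hn.ne', one_smul]⟩

/-- The image of a null vector is null, so a vanishing first component would make the whole image
zero. -/
theorem apply_vec_fst_ne_zero (g : G2) (p : RollingCover) : (g.val.val (C.vec p)).1 ≠ 0 := by
  intro h
  have hq := quad_map g (C.re_vec p)
  rw [C.quad_vec, quad_eq_norm, h, norm_zero] at hq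
  have h2 : (g.val.val (C.vec p)).2 = 0 := by
    rw [← norm_eq_zero]; nlinarith
  have h3 : g.val.val (C.vec p) = g.val.val 0 := by
    rw [map_zero]; exact Prod.ext h h2
  exact C.vec_fst_ne_zero p (by rw [(bijective_apply g).1 h3]; rfl)

/-- The action of a linear map on the space of null rays. -/
noncomputable def act (o : RollingCover) (z : (SplitOctonion →L[ℝ] SplitOctonion) × RollingCover) :
    RollingCover :=
  C.inv o (z.1 (C.vec z.2))

/-- The defining property of the action: the new point spans the ray of the image vector. The group
law and the invariance of the distribution are derived from it. -/
theorem smul_vec_act (o : RollingCover) (g : G2) (p : RollingCover) :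
    ‖(g.val.val (C.vec p)).1‖ • C.vec (C.act o (g.val.val, p)) = g.val.val (C.vec p) := by
  have hq : quad (g.val.val (C.vec p)) = 0 := (quad_map g (C.re_vec p)).trans (C.quad_vec p)
  have h0 := C.apply_vec_fst_ne_zero g p
  obtain ⟨p', hp'⟩ := C.exists_smul_vec (re_map g (C.re_vec p)) hq h0
  have h1 : C.act o (g.val.val, p) = p' := by
    rw [act]
    change C.inv o (g.val.val (C.vec p)) = p'
    rw [hp', C.inv_smul_vec _ _ (norm_pos_iff.2 h0)]
  rw [h1, ← hp']

theorem act_mul (o : RollingCover) (g h : G2) (p : RollingCover) :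
    C.act o ((g * h).val.val, p) = C.act o (g.val.val, C.act o (h.val.val, p)) := by
  have h0 := norm_pos_iff.2 (C.apply_vec_fst_ne_zero h p)
  have h1 := norm_pos_iff.2 (C.apply_vec_fst_ne_zero g (C.act o (h.val.val, p)))
  have e : (g * h).val.val (C.vec p) = (‖(h.val.val (C.vec p)).1‖ *
      ‖(g.val.val (C.vec (C.act o (h.val.val, p)))).1‖) •
        C.vec (C.act o (g.val.val, C.act o (h.val.val, p))) := by
    rw [mul_smul, C.smul_vec_act, ← map_smul, C.smul_vec_act, mul_apply]
  rw [act]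
  change C.inv o ((g * h).val.val (C.vec p)) = _
  rw [e, C.inv_smul_vec _ _ (mul_pos h0 h1)]

theorem act_one (o p : RollingCover) : C.act o ((1 : G2).val.val, p) = p :=
  C.inv_vec o p

/-- The action of `G₂` by permutations. -/
noncomputable def perm (o : RollingCover) : G2 →* Equiv.Perm RollingCover where
  toFun g :=
    { toFun := fun p => C.act o (g.val.val, p)
      invFun := fun p => C.act o (g⁻¹.val.val, p)
      left_inv := fun p => (C.act_mul o g⁻¹ g p).symm.trans (by rw [inv_mul_cancel, C.act_one])
      right_inv := fun p => (C.act_mul o g g⁻¹ p).symm.trans (by rw [mul_inv_cancel, C.act_one]) }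
  map_one' := Equiv.ext fun p => C.act_one o p
  map_mul' g h := Equiv.ext fun p => C.act_mul o g h p

theorem perm_apply (o : RollingCover) (g : G2) (p : RollingCover) :
    C.perm o g p = C.act o (g.val.val, p) := rfl

theorem perm_apply_eq (o : RollingCover) {g : G2} {p p' : RollingCover} {t : ℝ} (ht : 0 < t)
    (h : g.val.val (C.vec p) = t • C.vec p') : C.perm o g p = p' := by
  rw [perm_apply, act]
  change C.inv o (g.val.val (C.vec p)) = p'
  rw [h, C.inv_smul_vec _ _ ht]

theorem contMDiff_vec : ContMDiff coverModel 𝓘(ℝ, SplitOctonion) ∞ C.vec :=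
  C.contDiff_toFun.comp_contMDiff contMDiff_ambient

theorem contMDiffAt_inv (o : RollingCover) (p : RollingCover) {t : ℝ} (ht : 0 < t) :
    ContMDiffAt 𝓘(ℝ, SplitOctonion) coverModel ∞ (C.inv o) (t • C.vec p) := by
  obtain ⟨s, hs, h⟩ := C.fst_smul p t ht
  obtain ⟨s', hs', h'⟩ := C.snd_smul p t ht
  have h1 : C.fst (t • C.vec p) ≠ 0 := by
    rw [vec, h]
    exact smul_ne_zero hs.ne' (norm_ne_zero_iff.1 (by rw [norm_coe_S3]; exact one_ne_zero))
  have h2 : C.snd (t • C.vec p) ≠ 0 := by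
    rw [vec, h']
    exact smul_ne_zero hs'.ne' (norm_ne_zero_iff.1 (by rw [norm_coe_S2]; exact one_ne_zero))
  exact ((contMDiffAt_unitize (n := 3) o.1 h1).comp _ C.contDiff_fst.contDiffAt.contMDiffAt).prodMk
    ((contMDiffAt_unitize (n := 2) o.2 h2).comp _ C.contDiff_snd.contDiffAt.contMDiffAt)

/-- Smoothness is obtained in all directions of the space of linear maps, near points of the group;
joint smoothness on the group follows by restriction. -/
theorem contMDiffAt_act (o : RollingCover) (g : G2) (p : RollingCover) :
    ContMDiffAt (𝓘(ℝ, SplitOctonion →L[ℝ] SplitOctonion).prod coverModel) coverModel ∞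
      (C.act o) (g.val.val, p) := by
  have h1 : ContMDiffAt (𝓘(ℝ, SplitOctonion →L[ℝ] SplitOctonion).prod coverModel)
      𝓘(ℝ, SplitOctonion) ∞
      (fun z : (SplitOctonion →L[ℝ] SplitOctonion) × RollingCover => z.1 (C.vec z.2))
      (g.val.val, p) :=
    ContMDiffAt.clm_apply contMDiffAt_fst (C.contMDiff_vec.comp contMDiff_snd).contMDiffAt
  have h2 := C.contMDiffAt_inv o (C.act o (g.val.val, p))
    (norm_pos_iff.2 (C.apply_vec_fst_ne_zero g p))
  rw [C.smul_vec_act] at h2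
  exact h2.comp (g.val.val, p) h1

theorem contMDiff_perm (o : RollingCover) (g : G2) :
    ContMDiff coverModel coverModel ∞ (C.perm o g) := fun p =>
  (C.contMDiffAt_act o g p).comp p (contMDiffAt_const.prodMk contMDiffAt_id)

end NullChart

end SplitOct

/-! ### Invariance of the distribution and faithfulness of the action. -/

namespace SplitOct

open Quaternion

theorem injective_mfderiv_of_leftInverse {f : Equiv.Perm RollingCover}
    (hf : ContMDiff coverModel coverModel ∞ f) (hf' : ContMDiff coverModel coverModel ∞ f.symm)
    (p : RollingCover) : Function.Injective (mfderiv coverModel coverModel f p) := by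
  have h : (mfderiv coverModel coverModel f.symm (f p)).comp
      (mfderiv coverModel coverModel f p) = ContinuousLinearMap.id ℝ (TangentSpace coverModel p) := by
    rw [← mfderiv_comp p (hf'.mdifferentiable (by simp) _) (hf.mdifferentiable (by simp) _)]
    have : (f.symm ∘ f : RollingCover → RollingCover) = id := by ext1 x; simp
    rw [this]
    exact mfderiv_id
  exact Function.LeftInverse.injective (g := mfderiv coverModel coverModel f.symm (f p))
    fun v => congrArg (fun L => L v) h

theorem surjective_mfderiv_of_leftInverse {f : Equiv.Perm RollingCover}
    (hf : ContMDiff coverModel coverModel ∞ f) (hf' : ContMDiff coverModel coverModel ∞ f.symm)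
    (p : RollingCover) : Function.Surjective (mfderiv coverModel coverModel f p) :=
  have (q : RollingCover) : FiniteDimensional ℝ (TangentSpace coverModel q) :=
    inferInstanceAs (FiniteDimensional ℝ (EuclideanSpace ℝ (Fin 3) × EuclideanSpace ℝ (Fin 2)))
  (LinearMap.injective_iff_surjective_of_finrank_eq_finrank
    (f := (mfderiv coverModel coverModel f p).toLinearMap) rfl).1
    (injective_mfderiv_of_leftInverse hf hf' p)

/-- The rescaling of a split octonion that makes its first component a unit. -/
noncomputable def normalizeFst (y : SplitOctonion) : SplitOctonion := ‖y.1‖⁻¹ • y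

/-- Only the shape matters: a multiple of the identity plus a term along `y`. The second term
disappears on multiplying by `y`, as null imaginary vectors have square zero. -/
theorem exists_hasFDerivAt_normalizeFst {y : SplitOctonion} (hy : y.1 ≠ 0) :
    ∃ a : SplitOctonion →L[ℝ] ℝ, HasFDerivAt normalizeFst
      (‖y.1‖⁻¹ • ContinuousLinearMap.id ℝ SplitOctonion + a.smulRight y) y := by
  have h : DifferentiableAt ℝ (fun y : SplitOctonion => ‖y.1‖⁻¹) y :=
    ((differentiableAt_fst).norm ℝ hy).inv (norm_ne_zero_iff.2 hy)
  exact ⟨_, h.hasFDerivAt.smul (hasFDerivAt_id y)⟩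

theorem octMul_self_of_null {y : SplitOctonion} (hre : y.1.re = 0) (hq : quad y = 0) :
    octMul y y = 0 := by
  rw [octMul_self, hre, hq, mul_zero, zero_smul, zero_smul, sub_zero]

namespace NullChart

variable {R r : ℝ} (C : NullChart R r)

/-- In the chart the action is `g` followed by a rescaling. If `z` is the derivative of the null
vector `y`, the new derivative is a nonzero multiple of `g z` plus a multiple of `g y`. Multiplied
by a nonzero multiple of `g y` it gives a nonzero multiple of `g(yz)`, because `(g y)² = 0`; and `g`
is injective. -/
theorem mem_liftedPlane_perm_iff (o : RollingCover) (g : G2) (p : RollingCover)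
    (v : TangentSpace coverModel p) :
    mfderiv coverModel coverModel (C.perm o g) p v ∈ liftedPlane R r (C.perm o g p) ↔
      v ∈ liftedPlane R r p := by
  have hd : Differentiable ℝ C.toFun := C.contDiff_toFun.differentiable (by simp)
  have h0 := C.apply_vec_fst_ne_zero g p
  obtain ⟨a, ha⟩ := exists_hasFDerivAt_normalizeFst h0
  have hdiff : HasFDerivAt (normalizeFst ∘ g.val.val ∘ C.toFun) _ (ambient p) :=
    HasFDerivAt.comp (ambient p) ha (g.val.val.hasFDerivAt.comp (ambient p) (hd _).hasFDerivAt)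
  have hcomp : C.toFun ∘ ambient ∘ C.perm o g =
      (normalizeFst ∘ g.val.val ∘ C.toFun) ∘ ambient := by
    funext p'
    have h := C.smul_vec_act o g p'
    have hn := norm_ne_zero_iff.2 (C.apply_vec_fst_ne_zero g p')
    change C.vec (C.act o (g.val.val, p')) = normalizeFst (g.val.val (C.vec p'))
    rw [normalizeFst]
    rw [← h, smul_smul, h, inv_mul_cancel₀ hn, one_smul]
  have h1 : mfderiv coverModel 𝓘(ℝ, SplitOctonion) ((C.toFun ∘ ambient) ∘ C.perm o g) p v =
      fderiv ℝ C.toFun (ambient (C.perm o g p))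
        (ambientDeriv (C.perm o g p) (mfderiv coverModel coverModel (C.perm o g) p v)) := by
    rw [mfderiv_comp (g := C.toFun ∘ ambient) p (C.contMDiff_vec.mdifferentiable (by simp) _)
      ((C.contMDiff_perm o g).mdifferentiable (by simp) p)]
    exact mfderiv_comp_ambient _ (hd _) _
  have h2 := mfderiv_comp_ambient p hdiff.differentiableAt v
  rw [← hcomp, hdiff.fderiv] at h2
  have h3 := h1.symm.trans h2
  rw [C.mem_liftedPlane, C.mem_liftedPlane, h3]
  have h4 : C.toFun (ambient (C.perm o g p)) =
      ‖(g.val.val (C.vec p)).1‖⁻¹ • g.val.val (C.vec p) := congrFun hcomp p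
  rw [h4]
  have hn := inv_ne_zero (norm_ne_zero_iff.2 h0)
  have hnull : octMul (g.val.val (C.vec p)) (g.val.val (C.vec p)) = 0 :=
    octMul_self_of_null (re_map g (C.re_vec p))
      ((quad_map g (C.re_vec p)).trans (C.quad_vec p))
  generalize ambientDeriv p v = v'
  change octMul (‖(g.val.val (C.vec p)).1‖⁻¹ • g.val.val (C.vec p))
    (‖(g.val.val (C.vec p)).1‖⁻¹ • g.val.val (fderiv ℝ C.toFun (ambient p) v') +
      a (g.val.val (fderiv ℝ C.toFun (ambient p) v')) • g.val.val (C.vec p)) = 0 ↔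
    octMul (C.vec p) (fderiv ℝ C.toFun (ambient p) v') = 0
  rw [octMul_add, smul_octMul, smul_octMul, octMul_smul, octMul_smul, hnull, smul_zero, smul_zero,
    add_zero, ← map_octMul, smul_eq_zero_iff_right hn, smul_eq_zero_iff_right hn,
    map_eq_zero_iff _ (bijective_apply g).1]

theorem perm_mem_rollingAut (o : RollingCover) (g : G2) : C.perm o g ∈ rollingAut R r := by
  have hf := C.contMDiff_perm o g
  have hf' : ContMDiff coverModel coverModel ∞ (C.perm o g).symm := by
    have h := C.contMDiff_perm o g⁻¹
    rwa [map_inv] at h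
  refine ⟨hf, hf', fun p => Submodule.ext fun w => ⟨?_, fun hw => ?_⟩⟩
  · rintro ⟨v, hv, rfl⟩
    exact (C.mem_liftedPlane_perm_iff o g p v).2 hv
  · obtain ⟨v, rfl⟩ := surjective_mfderiv_of_leftInverse hf hf' p w
    exact ⟨v, (C.mem_liftedPlane_perm_iff o g p v).1 hw, rfl⟩

/-- The action of `G₂` by automorphisms of the lifted rolling distribution. -/
noncomputable def toAut (o : RollingCover) : G2 →* rollingAut R r :=
  (C.perm o).codRestrict _ (C.perm_mem_rollingAut o)

theorem exists_apply_eq_smul (o : RollingCover) {g : G2} (hg : C.perm o g = 1)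
    {y : SplitOctonion} (hre : y.1.re = 0) (h1 : ‖y.1‖ = 1) (h2 : ‖y.2‖ = 1) :
    ∃ t > (0 : ℝ), g.val.val y = t • y := by
  obtain ⟨p, rfl⟩ := C.exists_eq_smul y hre h1 h2
  refine ⟨_, norm_pos_iff.2 (C.apply_vec_fst_ne_zero g p), ?_⟩
  have h := C.smul_vec_act o g p
  rw [← C.perm_apply, hg] at h
  exact h.symm

/-- An element acting trivially rescales every null vector. The two expressions for the image of `ℓ`
coming from `i ± ℓ` and `j ± ℓ` force one common factor `d` on `i`, `j`, `ℓ`. Then `k + ℓ` goes to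
`d² k + d ℓ`, which is a multiple of `k + ℓ` only if `d² = d`, so `d = 1`. -/
theorem injective_toAut (o : RollingCover) : Function.Injective (C.toAut o) := by
  refine (injective_iff_map_eq_one _).2 fun g hg => ?_
  have hg' : C.perm o g = 1 := congrArg Subtype.val hg
  have hI : ‖(unitI : ℍ[ℝ])‖ = 1 := norm_unitI
  have hJ : ‖(unitJ : ℍ[ℝ])‖ = 1 := norm_unitJ
  have hK : ‖(unitK : ℍ[ℝ])‖ = 1 := by
    rw [← normSq_eq_one_iff_norm]; simp [normSq_def']
  obtain ⟨a, ha, e1⟩ := C.exists_apply_eq_smul o hg' (y := (unitI, 1)) (by simp) hI norm_one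
  obtain ⟨b, hb, e2⟩ := C.exists_apply_eq_smul o hg' (y := (unitI, -1)) (by simp) hI (by simp)
  obtain ⟨c, hc, e3⟩ := C.exists_apply_eq_smul o hg' (y := (unitJ, 1)) (by simp) hJ norm_one
  obtain ⟨d, hd, e4⟩ := C.exists_apply_eq_smul o hg' (y := (unitJ, -1)) (by simp) hJ (by simp)
  obtain ⟨e, he, e5⟩ := C.exists_apply_eq_smul o hg' (y := (unitK, 1)) (by simp) hK norm_one
  have s1 : ((unitI, 1) : SplitOctonion) = oi + ol := by ext <;> simp [oi, ol]
  have s2 : ((unitI, -1) : SplitOctonion) = oi - ol := by ext <;> simp [oi, ol]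
  have s3 : ((unitJ, 1) : SplitOctonion) = oj + ol := by ext <;> simp [oj, ol]
  have s4 : ((unitJ, -1) : SplitOctonion) = oj - ol := by ext <;> simp [oj, ol]
  have s5 : ((unitK, 1) : SplitOctonion) = octMul oi oj + ol := by
    ext <;> simp [octMul, oi, oj, ol]
  rw [s1] at e1
  rw [s2] at e2
  rw [s3] at e3
  rw [s4] at e4
  rw [s5] at e5
  rw [map_add] at e1 e3 e5
  rw [map_sub] at e2 e4
  rw [map_octMul] at e5
  have key : g.val.val oi = oi ∧ g.val.val oj = oj ∧ g.val.val ol = ol := by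
    generalize g.val.val oi = u at *
    generalize g.val.val oj = v at *
    generalize g.val.val ol = w at *
    have hu : u = (2⁻¹ : ℝ) • (a • (oi + ol) + b • (oi - ol)) := by
      rw [← e1, ← e2]; module
    have hv : v = (2⁻¹ : ℝ) • (c • (oj + ol) + d • (oj - ol)) := by
      rw [← e3, ← e4]; module
    have hw : w = (2⁻¹ : ℝ) • (a • (oi + ol) - b • (oi - ol)) := by
      rw [← e1, ← e2]; module
    have hw' : w = (2⁻¹ : ℝ) • (c • (oj + ol) - d • (oj - ol)) := by
      rw [← e3, ← e4]; module
    have hww := hw.symm.trans hw'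
    have h1 := congrArg (fun z : SplitOctonion => z.1.imI) hww
    have h2 := congrArg (fun z : SplitOctonion => z.1.imJ) hww
    have h3 := congrArg (fun z : SplitOctonion => z.2.re) hww
    simp [oi, oj, ol] at h1 h2 h3
    obtain rfl : b = a := by linarith
    obtain rfl : d = c := by linarith
    obtain rfl : d = b := by linarith
    obtain rfl : u = d • oi := by rw [hu]; module
    obtain rfl : v = d • oj := by rw [hv]; module
    obtain rfl : w = d • ol := by rw [hw]; module
    have h4 := congrArg (fun z : SplitOctonion => z.1.imK) e5
    have h5 := congrArg (fun z : SplitOctonion => z.2.re) e5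
    simp [octMul, oi, oj, ol] at h4 h5
    have h6 : d = 1 := by
      have : d * (d - 1) = 0 := by linarith
      rcases mul_eq_zero.1 this with h | h <;> linarith
    rw [h6]
    simp
  exact ext_generators key.1 key.2.1 key.2.2

end NullChart

end SplitOct

/-! ### Failure to descend, and the octonion products in the two charts. -/

namespace SplitOct

open Quaternion

namespace NullChart

variable {R r : ℝ} (C : NullChart R r)

theorem vec_neg (q : S3) (x : S2) : C.vec (-q, x) = ((C.vec (q, x)).1, -(C.vec (q, x)).2) :=
  C.toFun_neg q x

theorem vec_fst_eq {p p' : RollingCover} (h : coverMap p = coverMap p') :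
    (C.vec p').1 = (C.vec p).1 := by
  rcases (coverMap_eq_iff p p').1 h with rfl | rfl
  · rfl
  · rw [vec_neg]

/-- Some element of `G₂` does not map fibres of the double cover to fibres. -/
theorem not_descends (o : RollingCover) :
    ∃ g : G2, ¬ ∃ ψ : RollingSpace → RollingSpace,
      ∀ p : RollingCover, coverMap (C.perm o g p) = ψ (coverMap p) := by
  refine ⟨boost (Multiplicative.ofAdd 1), ?_⟩
  rintro ⟨ψ, hψ⟩
  -- The null vectors `(j, i)` and `(j, -i)` lie over the same point. The boost sends their first
  -- components to `cosh 1 · j ± sinh 1 · k`, of equal norm but different direction, whereas points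
  -- of one fibre have equal first components.
  obtain ⟨p, hp⟩ := C.exists_eq_smul (unitJ, unitI) (by simp) norm_unitJ norm_unitI
  obtain ⟨q, x⟩ := p
  have hp1 : C.vec (q, x) = (unitJ, unitI) := hp
  have hp2 : C.vec (-q, x) = (unitJ, -unitI) := by rw [vec_neg, hp1]
  have hc : coverMap (q, x) = coverMap (-q, x) := (coverMap_eq_iff _ _).2 (Or.inr rfl)
  have h := C.vec_fst_eq ((hψ (q, x)).trans ((congrArg ψ hc).trans (hψ (-q, x)).symm))
  have e1 := congrArg Prod.fst (C.smul_vec_act o (boost (Multiplicative.ofAdd 1)) (q, x))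
  have e2 := congrArg Prod.fst (C.smul_vec_act o (boost (Multiplicative.ofAdd 1)) (-q, x))
  rw [Prod.smul_fst] at e1 e2
  rw [perm_apply, perm_apply] at h
  rw [h, hp2] at e2
  rw [hp1] at e1
  have hn : ‖((boost (Multiplicative.ofAdd 1)).val.val (unitJ, -unitI)).1‖ =
      ‖((boost (Multiplicative.ofAdd 1)).val.val (unitJ, unitI)).1‖ := by
    rw [← sq_eq_sq₀ (norm_nonneg _) (norm_nonneg _), sq, sq, ← normSq_eq_norm_mul_self,
      ← normSq_eq_norm_mul_self, boost_apply, boost_apply]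
    simp [normSq_def']
  rw [hn, e1, boost_apply, boost_apply] at e2
  have e3 := congrArg (fun z : ℍ[ℝ] => z.imK) e2
  simp at e3
  have := Real.sinh_pos_iff.2 one_pos
  linarith

end NullChart

theorem coe_inv_S3 (q : S3) : ((q⁻¹ : S3) : ℍ[ℝ]) = star (q : ℍ[ℝ]) := by
  have h : ((q⁻¹ : S3) : ℍ[ℝ]) * q = 1 := congrArg Subtype.val (inv_mul_cancel q)
  have h2 := congrArg (fun z => z * star (q : ℍ[ℝ])) h
  simpa only [mul_assoc, mul_star_of_norm_eq_one (norm_coe_S3 q), mul_one, one_mul] using h2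

theorem star_imQuatL (x : E3) : star (imQuatL x) = -imQuatL x := by
  ext <;> simp [imQuatL_apply]

theorem imQuatL_mul_self (x : S2) : imQuatL x * imQuatL x = -1 :=
  mul_self_of_imaginary rfl ((norm_imQuatL _).trans (norm_coe_S2 x))

theorem norm_imQuatL_S2 (x : S2) : ‖imQuatL x‖ = 1 := (norm_imQuatL _).trans (norm_coe_S2 x)

theorem exists_imQuatL_eq {u : ℍ[ℝ]} (hre : u.re = 0) (hu : ‖u‖ = 1) :
    ∃ x : S2, imQuatL x = u :=
  ⟨⟨imVecL u, mem_sphere_zero_iff_norm.2 (by rw [← norm_imQuatL, imQuatL_imVecL hre, hu])⟩,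
    imQuatL_imVecL hre⟩

theorem exists_S3_eq {u : ℍ[ℝ]} (hu : ‖u‖ = 1) : ∃ q : S3, (q : ℍ[ℝ]) = u :=
  ⟨⟨u, mem_sphere_zero_iff_norm.2 hu⟩, rfl⟩

theorem imQuatL_rotSphere (q : S3) (x : S2) :
    imQuatL (rotSphere (rot q) x) = q * imQuatL x * star (q : ℍ[ℝ]) :=
  imQuat_rotMatrix_mulVec _ _

theorem rollingAct_rot (a b q : S3) (x : S2) :
    rollingAct (rot a, rot b) (coverMap (q, x)) =
      coverMap (a * q * b⁻¹, rotSphere (rot a) x) := by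
  refine Prod.ext ?_ rfl
  change rotHom a * rotHom q * (rotHom b)⁻¹ = rotHom (a * q * b⁻¹)
  rw [map_mul, map_mul, map_inv]

theorem imQuatL_ambientDeriv_mul (p : RollingCover) (v : TangentSpace coverModel p) :
    imQuatL (ambientDeriv p v).2 * imQuatL p.2 = -(imQuatL p.2 * imQuatL (ambientDeriv p v).2) := by
  have h := inner_ambientDeriv_snd p v
  simp only [PiLp.inner_apply, Fin.sum_univ_three] at h
  ext <;> simp [imQuatL_apply] at h ⊢ <;> linarith

section Algebra

variable {q X X' W : ℍ[ℝ]}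

/-- The second factor is the derivative of `(X, q̄ X)` when `q' = W q`. The product vanishes exactly
with `2X' - WX`, `X` being invertible on the sphere, and this is the rolling equation `4X' = 2WX`.
-/
theorem octMul_rolling_three (hq : q * star q = 1) (hs : star X = -X)
    (hs' : star X' = -X') (hW : star W = -W) (hXX : X' * X = -(X * X')) :
    octMul (X, star q * X) (X', star (W * q) * X + star q * X') =
      (X * ((2 : ℝ) • X' - W * X), star q * (((2 : ℝ) • X' - W * X) * X)) := by
  refine Prod.ext ?_ ?_
  · simp only [octMul, star_add, star_mul, star_star, hs, hs', hW, star_neg, neg_neg]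
    calc X * X' + (-X * (W * q) + -X' * q) * (star q * X)
        = X * X' - X * W * (q * star q) * X - X' * (q * star q) * X := by noncomm_ring
      _ = _ := by rw [hq, mul_one, mul_one, hXX, two_smul]; noncomm_ring
  · simp only [octMul, star_add, star_mul, star_star, hs, hs', hW, star_neg, neg_neg]
    calc (star q * -W * X + star q * X') * X + star q * X * -X'
        = star q * (-(W * X * X) + X' * X - X * X') := by noncomm_ring
      _ = star q * (-(W * X * X) + X' * X + X' * X) := by rw [hXX]; noncomm_ring
      _ = _ := by rw [two_smul]; noncomm_ring

/-- The same computation for the derivative of `(q̄ X q, X q)`; both components contain the factor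
`2X' - WX + 2XW`. -/
theorem octMul_rolling_third (hq : q * star q = 1) (hX : X * X = -1) (hs : star X = -X)
    (hs' : star X' = -X') (hW : star W = -W) (hXX : X' * X = -(X * X')) :
    octMul (star q * X * q, X * q)
        (star (W * q) * X * q + star q * X' * q + star q * X * (W * q), X' * q + X * (W * q)) =
      (star q * (X * ((2 : ℝ) • X' - W * X + (2 : ℝ) • (X * W)) * q),
        ((2 : ℝ) • X' - W * X + (2 : ℝ) • (X * W)) * X * q) := by
  have hXW : X * X * W = -W := by rw [hX, neg_one_mul]
  have hWX : W * X * X = -W := by rw [mul_assoc, hX, mul_neg_one]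
  refine Prod.ext ?_ ?_
  · simp only [octMul, star_add, star_mul, star_star, hs, hs', hW, star_neg, neg_neg]
    calc star q * X * q * (star q * -W * X * q + star q * X' * q + star q * X * (W * q)) +
          (star q * -X' + star q * -W * -X) * (X * q)
        = star q * (X * (q * star q) * (-W * X) + X * (q * star q) * X' +
            X * (q * star q) * X * W - X' * X + W * X * X) * q := by noncomm_ring
      _ = star q * (-(X * W * X) + (X * X' - X' * X) + (X * X * W + W * X * X)) * q := by
          rw [hq]; noncomm_ring
      _ = star q * (-(X * W * X) + (X * X' + X * X') + (X * X * W + X * X * W)) * q := by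
          rw [hXX, hXW, hWX]; noncomm_ring
      _ = _ := by rw [two_smul, two_smul]; noncomm_ring
  · simp only [octMul, star_add, star_mul, star_star, hs, hs', hW, star_neg, neg_neg]
    calc (X' * q + X * (W * q)) * (star q * X * q) +
          X * q * (star q * (-X * (W * q)) + star q * (-X' * q) + star q * -W * (-X * q))
        = (X' * (q * star q) * X + X * W * (q * star q) * X + X * (q * star q) * (-X * W) -
            X * (q * star q) * X' + X * (q * star q) * W * X) * q := by noncomm_ring
      _ = (X' * X - X * X' + (X * W * X + X * W * X) - X * X * W) * q := by
          rw [hq]; noncomm_ring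
      _ = (X' * X + X' * X + (X * W * X + X * W * X) - W * X * X) * q := by
          rw [hXX, hXW, hWX]; noncomm_ring
      _ = _ := by rw [two_smul, two_smul]; noncomm_ring

end Algebra

end SplitOct

/-! ### The charts for the ratios 3:1 and 1:3. -/

namespace SplitOct

open Quaternion

theorem contDiff_imQuatL_snd : ContDiff ℝ ∞ fun y : ℍ[ℝ] × E3 => imQuatL y.2 :=
  imQuatL.contDiff.comp contDiff_snd

theorem contDiff_star_fst : ContDiff ℝ ∞ fun y : ℍ[ℝ] × E3 => star y.1 :=
  contDiff_star_quaternion.comp contDiff_fst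

theorem norm_star_quaternion (q : ℍ[ℝ]) : ‖star q‖ = ‖q‖ := by
  rw [← sq_eq_sq₀ (norm_nonneg _) (norm_nonneg _), sq, sq, ← normSq_eq_norm_mul_self,
    ← normSq_eq_norm_mul_self, normSq_star]

theorem mul_eq_zero_iff_of_mul_self {X Z : ℍ[ℝ]} (hX : X * X = -1) : X * Z = 0 ↔ Z = 0 := by
  refine ⟨fun h => ?_, fun h => by rw [h, mul_zero]⟩
  have h2 : X * (X * Z) = 0 := by rw [h, mul_zero]
  rw [← mul_assoc, hX, neg_one_mul, neg_eq_zero] at h2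
  exact h2

theorem ambientDeriv_fst_eq (p : RollingCover) (v : TangentSpace coverModel p) :
    (ambientDeriv p v).1 = (ambientDeriv p v).1 * star p.1.val * p.1.val := by
  rw [mul_assoc, star_mul_of_norm_eq_one (norm_coe_S3 p.1), mul_one]

/-- The null vector `(x, q̄ x)` of a point `(q, x)`. -/
noncomputable def vecThree (y : ℍ[ℝ] × E3) : SplitOctonion :=
  (imQuatL y.2, star y.1 * imQuatL y.2)

theorem contDiff_vecThree : ContDiff ℝ ∞ vecThree :=
  contDiff_imQuatL_snd.prodMk (contDiff_star_fst.mul contDiff_imQuatL_snd)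

theorem fderiv_vecThree (y v : ℍ[ℝ] × E3) : fderiv ℝ vecThree y v =
    (imQuatL v.2, star v.1 * imQuatL y.2 + star y.1 * imQuatL v.2) := by
  refine fderiv_apply_of_hasDerivAt (contDiff_vecThree.differentiable (by simp) y) ?_
  have h1 := (hasDerivAt_line y.1 v.1).star
  have h2 : HasDerivAt (fun t : ℝ => imQuatL (y.2 + t • v.2)) (imQuatL v.2) 0 :=
    imQuatL.hasFDerivAt.comp_hasDerivAt (0 : ℝ) (hasDerivAt_line y.2 v.2)
  have h3 := h1.mul h2
  simp only [zero_smul, add_zero] at h3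
  exact h2.prodMk h3

/-- The identification with null rays for a ball rolling on a ball of three times its radius. -/
noncomputable def chartThree {R r : ℝ} (hr : 0 < r) (h : R = 3 * r) : NullChart R r where
  toFun := vecThree
  -- For `y = (x, q̄ x)` one has `x (q̄ x)* = x x̄ q = q`.
  fst y := y.1 * star y.2
  snd y := imVecL y.1
  contDiff_toFun := contDiff_vecThree
  contDiff_fst := contDiff_fst.mul (contDiff_star_quaternion.comp contDiff_snd)
  contDiff_snd := imVecL.contDiff.comp contDiff_fst
  re_toFun p := rfl
  norm_toFun_fst p := norm_imQuatL_S2 p.2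
  norm_toFun_snd p := by
    rw [vecThree, norm_mul, norm_star_quaternion]
    change ‖p.1.val‖ * ‖imQuatL p.2‖ = 1
    rw [norm_coe_S3, norm_imQuatL_S2, mul_one]
  fst_smul p t ht := by
    refine ⟨t * t, mul_pos ht ht, ?_⟩
    change t • imQuatL p.2 * star (t • (star p.1.val * imQuatL p.2)) = (t * t) • p.1.val
    rw [Quaternion.star_smul, star_mul, star_star, star_imQuatL, smul_mul_smul_comm,
      ← mul_assoc, mul_neg, imQuatL_mul_self, neg_neg, one_mul]
  snd_smul p t ht := by
    refine ⟨t, ht, ?_⟩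
    change imVecL (t • imQuatL p.2) = t • p.2.val
    rw [map_smul, imVecL_imQuatL]
  exists_eq_smul y hre h1 h2 := by
    obtain ⟨x, hx⟩ := exists_imQuatL_eq hre h1
    obtain ⟨q, hq⟩ := exists_S3_eq (u := y.1 * star y.2)
      (by rw [norm_mul, norm_star_quaternion, h1, h2, mul_one])
    refine ⟨(q, x), Prod.ext hx ?_⟩
    change star q.val * imQuatL x = y.2
    rw [hx, hq, star_mul, star_star, mul_assoc, star_mul_of_norm_eq_one h1, mul_one]
  toFun_neg q x := by
    refine Prod.ext rfl ?_
    change star (-q) * imQuatL x = -(star q * imQuatL x)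
    rw [star_neg, neg_mul]
  mem_liftedPlane p v := by
    -- Split as a product so that one factor 2 cancels against the 2 of the angular velocity.
    have hk : R / r + 1 = 2 * 2 := by rw [h]; field_simp; norm_num
    have hX := imQuatL_mul_self p.2
    have hq := mul_star_of_norm_eq_one (norm_coe_S3 p.1)
    rw [mem_liftedPlane_iff, fderiv_vecThree]
    have e := octMul_rolling_three hq (star_imQuatL p.2)
      (star_imQuatL (ambientDeriv p v).2) (star_eq_neg.2 (angularVelocity_re p v))
      (imQuatL_ambientDeriv_mul p v)
    rw [← ambientDeriv_fst_eq] at e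
    change _ ↔ octMul (imQuatL p.2, star p.1.val * imQuatL p.2) (imQuatL (ambientDeriv p v).2,
      star (ambientDeriv p v).1 * imQuatL p.2 + star p.1.val * imQuatL (ambientDeriv p v).2) = 0
    rw [e, hk, mul_smul, (smul_right_injective ℍ[ℝ] (two_ne_zero (α := ℝ))).eq_iff, ← sub_eq_zero,
      Prod.mk_eq_zero, mul_eq_zero_iff_of_mul_self hX]
    exact ⟨fun hz => ⟨hz, by rw [hz, zero_mul, mul_zero]⟩, fun hz => hz.1⟩

/-- The pair `(a, b)` sends `(x, q̄ x)` to `(a x ā, b q̄ x ā)`, the null vector of `(a q b̄, a x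
ā)`. -/
theorem perm_chartThree {R r : ℝ} (hr : 0 < r) (h : R = 3 * r) (o : RollingCover)
    (k : S3 × S3) (p : RollingCover) :
    coverMap ((chartThree hr h).perm o (compactHom k) p) =
      rollingAct (rotHom.prodMap rotHom k) (coverMap p) := by
  obtain ⟨a, b⟩ := k
  obtain ⟨q, x⟩ := p
  refine Eq.trans (congrArg coverMap (NullChart.perm_apply_eq _ o one_pos ?_))
    (rollingAct_rot a b q x).symm
  have ha := star_mul_of_norm_eq_one (norm_coe_S3 a)
  rw [one_smul, compactHom_apply]
  refine Prod.ext ?_ ?_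
  · change _ = imQuatL (rotSphere (rot a) x)
    rw [imQuatL_rotSphere, mul_assoc]
    rfl
  · change _ = star (a.val * q.val * (b⁻¹ : S3).val) * imQuatL (rotSphere (rot a) x)
    change b.val * (star q.val * imQuatL x * star a.val) = _
    rw [imQuatL_rotSphere, coe_inv_S3, star_mul, star_mul, star_star]
    calc b.val * (star q.val * imQuatL x * star a.val)
        = b.val * (star q.val * (star a.val * a.val) * imQuatL x * star a.val) := by
          rw [ha, mul_one]
      _ = _ := by noncomm_ring

/-- The null vector `(q̄ x q, x q)` of a point `(q, x)`. -/
noncomputable def vecThird (y : ℍ[ℝ] × E3) : SplitOctonion :=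
  (star y.1 * imQuatL y.2 * y.1, imQuatL y.2 * y.1)

theorem contDiff_vecThird : ContDiff ℝ ∞ vecThird :=
  ((contDiff_star_fst.mul contDiff_imQuatL_snd).mul contDiff_fst).prodMk
    (contDiff_imQuatL_snd.mul contDiff_fst)

theorem fderiv_vecThird (y v : ℍ[ℝ] × E3) : fderiv ℝ vecThird y v =
    (star v.1 * imQuatL y.2 * y.1 + star y.1 * imQuatL v.2 * y.1 + star y.1 * imQuatL y.2 * v.1,
      imQuatL v.2 * y.1 + imQuatL y.2 * v.1) := by
  refine fderiv_apply_of_hasDerivAt (contDiff_vecThird.differentiable (by simp) y) ?_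
  have h0 := hasDerivAt_line y.1 v.1
  have h1 := h0.star
  have h2 : HasDerivAt (fun t : ℝ => imQuatL (y.2 + t • v.2)) (imQuatL v.2) 0 :=
    imQuatL.hasFDerivAt.comp_hasDerivAt (0 : ℝ) (hasDerivAt_line y.2 v.2)
  have h3 := (h1.mul h2).mul h0
  have h4 := h2.mul h0
  simp only [Pi.mul_apply, zero_smul, add_zero, add_mul] at h3 h4
  exact h3.prodMk h4

/-- The real part of either equation says that `W` is orthogonal to `X`. Then `XW = -WX`, and both
become `2X' = 3WX`. -/
theorem third_condition_iff {X X' W : ℍ[ℝ]} (hX : X.re = 0) (hX' : X'.re = 0) (hW : W.re = 0) :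
    (4 / 3 : ℝ) • X' = (2 : ℝ) • (W * X) ↔
      (2 : ℝ) • X' - W * X + (2 : ℝ) • (X * W) = 0 := by
  simp only [Quaternion.ext_iff]
  simp [hX, hX', hW]
  constructor
  · rintro ⟨h0, h1, h2, h3⟩
    refine ⟨?_, ?_, ?_, ?_⟩ <;> linarith
  · rintro ⟨h0, h1, h2, h3⟩
    refine ⟨?_, ?_, ?_, ?_⟩ <;> linarith

/-- The identification with null rays for a ball rolling on a ball of a third of its radius. -/
noncomputable def chartThird {R r : ℝ} (hR : 0 < R) (h : r = 3 * R) : NullChart R r where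
  toFun := vecThird
  -- For `y = (q̄ x q, x q)` the product `y.2 * y.1` is `x² q = -q`; multiplying it by the conjugate
  -- of `x q` then recovers `x`.
  fst y := -(y.2 * y.1)
  snd y := imVecL (y.2 * y.1 * star y.2)
  contDiff_toFun := contDiff_vecThird
  contDiff_fst := (contDiff_snd.mul contDiff_fst).neg
  contDiff_snd := imVecL.contDiff.comp
    ((contDiff_snd.mul contDiff_fst).mul (contDiff_star_quaternion.comp contDiff_snd))
  re_toFun p := by
    have h1 : (vecThird (ambient p)).1.re = normSq p.1.val * (imQuatL p.2).re := by
      simp [vecThird, ambient, normSq_def']; ring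
    rw [h1]
    exact mul_zero _
  norm_toFun_fst p := by
    rw [vecThird, norm_mul, norm_mul, norm_star_quaternion]
    change ‖p.1.val‖ * ‖imQuatL p.2‖ * ‖p.1.val‖ = 1
    rw [norm_coe_S3, norm_imQuatL_S2, mul_one, mul_one]
  norm_toFun_snd p := by
    rw [vecThird, norm_mul]
    change ‖imQuatL p.2‖ * ‖p.1.val‖ = 1
    rw [norm_coe_S3, norm_imQuatL_S2, mul_one]
  fst_smul p t ht := by
    refine ⟨t * t, mul_pos ht ht, ?_⟩
    change -(t • (imQuatL p.2 * p.1.val) * t • (star p.1.val * imQuatL p.2 * p.1.val)) = _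
    have hq := mul_star_of_norm_eq_one (norm_coe_S3 p.1)
    have e : imQuatL p.2 * p.1.val * (star p.1.val * imQuatL p.2 * p.1.val) = -p.1.val := by
      calc imQuatL p.2 * p.1.val * (star p.1.val * imQuatL p.2 * p.1.val)
          = imQuatL p.2 * (p.1.val * star p.1.val) * imQuatL p.2 * p.1.val := by noncomm_ring
        _ = _ := by rw [hq, mul_one, imQuatL_mul_self, neg_one_mul]
    rw [smul_mul_smul_comm, e, smul_neg, neg_neg]
  snd_smul p t ht := by
    refine ⟨t * t * t, by positivity, ?_⟩
    change imVecL (t • (imQuatL p.2 * p.1.val) * t • (star p.1.val * imQuatL p.2 * p.1.val) *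
      star (t • (imQuatL p.2 * p.1.val))) = _
    have hq := mul_star_of_norm_eq_one (norm_coe_S3 p.1)
    have e : imQuatL p.2 * p.1.val * (star p.1.val * imQuatL p.2 * p.1.val) *
        (star p.1.val * -imQuatL p.2) = imQuatL p.2 := by
      calc imQuatL p.2 * p.1.val * (star p.1.val * imQuatL p.2 * p.1.val) *
            (star p.1.val * -imQuatL p.2)
          = -(imQuatL p.2 * (p.1.val * star p.1.val) * imQuatL p.2 *
              (p.1.val * star p.1.val) * imQuatL p.2) := by noncomm_ring
        _ = _ := by rw [hq, mul_one, mul_one, imQuatL_mul_self, neg_one_mul, neg_neg]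
    rw [Quaternion.star_smul, star_mul, star_imQuatL, smul_mul_smul_comm, smul_mul_smul_comm,
      e, map_smul, imVecL_imQuatL]
  exists_eq_smul y hre h1 h2 := by
    have hy := mul_self_of_imaginary hre h1
    have hs := star_eq_neg.2 hre
    have hb := star_mul_of_norm_eq_one h2
    have hre' : (y.2 * y.1 * star y.2).re = 0 := by
      have : (y.2 * y.1 * star y.2).re = normSq y.2 * y.1.re := by
        simp [normSq_def']; ring
      rw [this, hre, mul_zero]
    obtain ⟨x, hx⟩ := exists_imQuatL_eq hre'
      (by rw [norm_mul, norm_mul, norm_star_quaternion, h1, h2, mul_one, mul_one])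
    obtain ⟨q, hq⟩ := exists_S3_eq (u := -(y.2 * y.1))
      (by rw [norm_neg, norm_mul, h1, h2, mul_one])
    have e2 : imQuatL x * q.val = y.2 := by
      rw [hx, hq]
      calc y.2 * y.1 * star y.2 * -(y.2 * y.1) = -(y.2 * y.1 * (star y.2 * y.2) * y.1) := by
            noncomm_ring
        _ = -(y.2 * (y.1 * y.1)) := by rw [hb, mul_one, mul_assoc]
        _ = y.2 := by rw [hy, mul_neg_one, neg_neg]
    refine ⟨(q, x), Prod.ext ?_ e2⟩
    change star q.val * imQuatL x * q.val = y.1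
    rw [mul_assoc, e2, hq, star_neg, star_mul, hs]
    simp only [neg_mul, neg_neg, mul_assoc, hb, mul_one]
  toFun_neg q x := by
    refine Prod.ext ?_ ?_
    · change star (-q) * imQuatL x * -q = star q * imQuatL x * q
      rw [star_neg, neg_mul, neg_mul_neg]
    · change imQuatL x * -q = -(imQuatL x * q)
      rw [mul_neg]
  mem_liftedPlane p v := by
    have hk : R / r + 1 = 4 / 3 := by rw [h]; field_simp; norm_num
    have hX := imQuatL_mul_self p.2
    have hq := mul_star_of_norm_eq_one (norm_coe_S3 p.1)
    rw [mem_liftedPlane_iff, fderiv_vecThird, hk,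
      third_condition_iff rfl rfl (angularVelocity_re p v)]
    have e := octMul_rolling_third hq hX (star_imQuatL p.2)
      (star_imQuatL (ambientDeriv p v).2) (star_eq_neg.2 (angularVelocity_re p v))
      (imQuatL_ambientDeriv_mul p v)
    rw [← ambientDeriv_fst_eq] at e
    generalize (2 : ℝ) • imQuatL (ambientDeriv p v).2 - _ + _ = Z at e ⊢
    refine Iff.trans ?_ (Eq.congr_left e).symm
    refine ⟨fun hz => by rw [hz]; simp, fun hz => ?_⟩
    have hz2 : Z * imQuatL p.2 * p.1.val = 0 := congrArg Prod.snd hz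
    have hz3 := congrArg (fun z => z * star p.1.val * imQuatL p.2) hz2
    simp only [zero_mul] at hz3
    rwa [mul_assoc _ p.1.val, hq, mul_one, mul_assoc, hX, mul_neg_one, neg_eq_zero] at hz3

/-- The pair `(a, b)` sends `(q̄ x q, x q)` to the null vector of `(b q ā, b x b̄)`, so the two
factors exchange roles compared with the other ratio. -/
theorem perm_chartThird {R r : ℝ} (hR : 0 < R) (h : r = 3 * R) (o : RollingCover)
    (k : S3 × S3) (p : RollingCover) :
    coverMap ((chartThird hR h).perm o (compactHom k) p) =
      rollingAct (rotHom.prodMap rotHom k.swap) (coverMap p) := by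
  obtain ⟨a, b⟩ := k
  obtain ⟨q, x⟩ := p
  refine Eq.trans (congrArg coverMap (NullChart.perm_apply_eq _ o one_pos ?_))
    (rollingAct_rot b a q x).symm
  have hb := star_mul_of_norm_eq_one (norm_coe_S3 b)
  have hx : imQuatL (rotSphere (rot b) x) * (b.val * q.val * (a⁻¹ : S3).val) =
      b.val * (imQuatL x * q.val * star a.val) := by
    rw [imQuatL_rotSphere, coe_inv_S3]
    calc b.val * imQuatL x * star b.val * (b.val * q.val * star a.val)
        = b.val * imQuatL x * (star b.val * b.val) * q.val * star a.val := by noncomm_ring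
      _ = _ := by rw [hb, mul_one]; noncomm_ring
  rw [one_smul, compactHom_apply]
  refine Prod.ext ?_ hx.symm
  change a.val * (star q.val * imQuatL x * q.val * star a.val) =
    star (b.val * q.val * (a⁻¹ : S3).val) * imQuatL (rotSphere (rot b) x) *
      (b.val * q.val * (a⁻¹ : S3).val)
  rw [mul_assoc (star (b.val * q.val * (a⁻¹ : S3).val)), hx, coe_inv_S3, star_mul, star_mul, star_star]
  calc a.val * (star q.val * imQuatL x * q.val * star a.val)
      = a.val * (star q.val * (1 * imQuatL x * q.val) * star a.val) := by noncomm_ring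
    _ = _ := by rw [← hb]; noncomm_ring

/-! ### Assembly of the theorem. -/

theorem rotHom_prodMap_eq_one_iff (x : S3 × S3) :
    rotHom.prodMap rotHom x = 1 ↔ (x.1 = 1 ∨ x.1 = -1) ∧ (x.2 = 1 ∨ x.2 = -1) := by
  rw [← rot_eq_one_iff, ← rot_eq_one_iff]
  exact Prod.ext_iff

theorem continuous_rotHom_prodMap : Continuous (rotHom.prodMap rotHom) :=
  continuous_rot.prodMap continuous_rot

theorem surjective_rotHom_prodMap : Function.Surjective (rotHom.prodMap rotHom) :=
  surjective_rot.prodMap surjective_rot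

theorem NullChart.exists_action {R r : ℝ} (C : NullChart R r) {ρ : S3 × S3 →* SO3 × SO3}
    (hc : Continuous ρ) (hs : Function.Surjective ρ)
    (hk : ∀ x, ρ x = 1 ↔ (x.1 = 1 ∨ x.1 = -1) ∧ (x.2 = 1 ∨ x.2 = -1))
    (hρ : ∀ (o : RollingCover) (k : S3 × S3) (p : RollingCover),
      coverMap (C.perm o (compactHom k) p) = rollingAct (ρ k) (coverMap p)) :
    ∃ Φ : G2 →* rollingAut R r,
      Function.Injective Φ ∧
      (∃ F : (SplitOctonion →L[ℝ] SplitOctonion) × RollingCover → RollingCover,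
        ContMDiffOn (𝓘(ℝ, SplitOctonion →L[ℝ] SplitOctonion).prod coverModel) coverModel ∞ F
          ((Units.val '' (G2 : Set (SplitOctonion →L[ℝ] SplitOctonion)ˣ)) ×ˢ Set.univ) ∧
        ∀ (g : G2) (p : RollingCover), (Φ g).val p = F (g.val.val, p)) ∧
      (∃ j : S3 × S3 →* G2,
        Continuous j ∧
        (∀ x, j x = 1 ↔ x = 1 ∨ x = (-1, -1)) ∧
        Maximal (fun H : Subgroup G2 => IsCompact (H : Set G2)) j.range ∧
        ∃ c : j.range →* SO3 × SO3,
          IsCoveringMap c ∧ Function.Surjective c ∧ Nat.card c.ker = 2 ∧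
          ∀ (k : j.range) (p : RollingCover),
            coverMap ((Φ k.val).val p) = rollingAct (c k) (coverMap p)) ∧
      ∃ g : G2, ¬ ∃ ψ : RollingSpace → RollingSpace,
        ∀ p : RollingCover, coverMap ((Φ g).val p) = ψ (coverMap p) := by
  obtain ⟨x, -⟩ := exists_imQuatL_eq (u := unitI) rfl norm_unitI
  let o : RollingCover := (1, x)
  obtain ⟨c, c1, c2, c3, c4⟩ := exists_descent hc hs hk
  refine ⟨C.toAut o, C.injective_toAut o, ⟨C.act o, ?_, fun g p => rfl⟩,
    ⟨compactHom, continuous_compactHom, compactHom_eq_one_iff, maximal_compactHom,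
      c, c1, c2, c3, ?_⟩, C.not_descends o⟩
  · rintro ⟨A, p⟩ ⟨⟨u, hu, rfl⟩, -⟩
    exact (C.contMDiffAt_act o ⟨u, hu⟩ p).contMDiffWithinAt
  · rintro ⟨_, k, rfl⟩ p
    refine (hρ o k p).trans ?_
    rw [← c4 k]
    rfl

end SplitOct

theorem theorem1 (R r : ℝ) (hR : 0 < R) (hr : 0 < r) (hratio : R = 3 * r ∨ r = 3 * R) :
    IsSplitAdjointG2 G2 ∧
    (IsCoveringMap coverMap ∧ ∀ q : RollingSpace, (coverMap ⁻¹' {q}).ncard = 2) ∧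
    ∃ Φ : G2 →* rollingAut R r,
      Function.Injective Φ ∧
      (∃ F : (SplitOctonion →L[ℝ] SplitOctonion) × RollingCover → RollingCover,
        ContMDiffOn (𝓘(ℝ, SplitOctonion →L[ℝ] SplitOctonion).prod coverModel) coverModel ∞ F
          ((Units.val '' (G2 : Set (SplitOctonion →L[ℝ] SplitOctonion)ˣ)) ×ˢ Set.univ) ∧
        ∀ (g : G2) (p : RollingCover), (Φ g).val p = F (g.val.val, p)) ∧
      (∃ j : S3 × S3 →* G2,
        Continuous j ∧
        (∀ x, j x = 1 ↔ x = 1 ∨ x = (-1, -1)) ∧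
        Maximal (fun H : Subgroup G2 => IsCompact (H : Set G2)) j.range ∧
        ∃ c : j.range →* SO3 × SO3,
          IsCoveringMap c ∧ Function.Surjective c ∧ Nat.card c.ker = 2 ∧
          ∀ (k : j.range) (p : RollingCover),
            coverMap ((Φ k.val).val p) = rollingAct (c k) (coverMap p)) ∧
      ∃ g : G2, ¬ ∃ ψ : RollingSpace → RollingSpace,
        ∀ p : RollingCover, coverMap ((Φ g).val p) = ψ (coverMap p) := by
  refine ⟨SplitOct.isSplitAdjointG2_G2,
    ⟨SplitOct.isCoveringMap_coverMap, SplitOct.ncard_fiber_coverMap⟩, ?_⟩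
  rcases hratio with h | h
  · exact (SplitOct.chartThree hr h).exists_action SplitOct.continuous_rotHom_prodMap
      SplitOct.surjective_rotHom_prodMap SplitOct.rotHom_prodMap_eq_one_iff
      (SplitOct.perm_chartThree hr h)
  · exact (SplitOct.chartThird hR h).exists_action
      -- The swap accounts for the exchanged roles of the two factors in the chart for 1:3.
      (ρ := (SplitOct.rotHom.prodMap SplitOct.rotHom).comp (MulEquiv.prodComm : S3 × S3 ≃* _))
      (SplitOct.continuous_rotHom_prodMap.comp continuous_swap)
      (SplitOct.surjective_rotHom_prodMap.comp Prod.swap_surjective)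
      (fun x => (SplitOct.rotHom_prodMap_eq_one_iff x.swap).trans and_comm)
      (SplitOct.perm_chartThird hR h)
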